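/- **Setting.** Let $n\to\infty$ and $p=p_n\to\infty$ with $c_n:=p/n\to c\in(0,\infty)$. Let $(z_{ij})_{i,j\ge1}$ and $(w_i)_{i\ge1}$ be two independent arrays of i.i.d. real random variables with $E z_{11}=0$, $E z_{11}^2=1$, $E z_{11}^4<\infty$, and suppose that the law $G$ of $w_1^2$ satisfies $G([a,b])=1$ for some $0<a<b<\infty$. For each $n$ let $\mathbf T_p\in\mathbb R^{p\times p}$ be a symmetric positive definite matrix with $\operatorname{tr}(\mathbf T_p^2)=p$, and suppose that the spectral distribution of $\mathbf T_p^2$ (the uniform distribution on its $p$ eigenvalues) converges weakly to a probability measure $H$. The observations are $\mathbf x_i=w_i\mathbf T_p\mathbf z_i$ with $\mathbf z_i=(z_{i1},\dots,z_{ip})'$, $i=1,\dots,n$; their population covariance matrix is $\Sigma_p=E(w_1^2)\,\mathbf T_p^2$. Let $B_n=\frac1n\sum_{i=1}^n\mathbf x_i\mathbf x_i'$, with eigenvalues $\lambda_1,\dots,\lambda_p$, and let $\hat\beta_{nk}=\frac1p\sum_{j=1}^p\lambda_j^k$. For each $n$ let $Q_1,\dots,Q_n$ be i.i.d. uniformly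 distributed random $p\times p$ permutation matrices, independent of $(z_{ij})$ and $(w_i)$; put $\check{\mathbf x}_i=Q_i\mathbf x_i$, $\check B_n=\frac1n\sum_{i=1}^n\check{\mathbf x}_i\check{\mathbf x}_i'$ and $\check\beta_{nk}=\operatorname{tr}(\check B_n^k)/p$. Define $$T_n=\hat\beta_{n2}-\check\beta_{n2},\qquad \hat\gamma_{n2}=\frac{\hat\beta_{n2}-\hat\beta_{n1}^2}{c_n},\qquad \delta_n=E(T_n).$$ The null hypothesis is $H_0$: $\Sigma_p=\sigma^2 I_p$ for some $\sigma^2>0$ (for all large $n$); the alternative hypothesis is that, for all large $n$, $\Sigma_p$ is not of this form. For $\alpha\in(0,1)$ let $z_\alpha$ be the $(1-\alpha)$-quantile of $N(0,1)$; the test of level $\alpha$ rejects $H_0$ when $nT_n>\sqrt8\,\hat\gamma_{n2}\,z_\alpha$. **Theorem.** 1. Under the null hypothesis, if $E(z_{11}^8)<\infty$, then $$\frac{nT_n}{\sqrt8\,\hat\gamma_{n2}}\xrightarrow{D}N(0,1).$$ 2. Under the alternative hypothesis, if $\operatorname{tr}(\mathbf T_p^4)/p\to\int t^2\,dH(t)<\infty$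 and $n\delta_n\to\infty$, then for every $\alpha\in(0,1)$ the power of the test tends to $1$: $$P\bigl(nT_n>\sqrt8\,\hat\gamma_{n2}\,z_\alpha\bigr)\to1.$$ -/

import Mathlib

open MeasureTheory ProbabilityTheory Filter Topology Matrix
open scoped ENNReal BoundedContinuousFunction

namespace ScaleMixture

noncomputable section

/-- The finite set of permutations of `d` coordinates carries the discrete σ-algebra. -/
instance permMeasurableSpace (d : ℕ) : MeasurableSpace (Equiv.Perm (Fin d)) := ⊤

/-- The (empirical) spectral distribution `d⁻¹ ∑ⱼ δ_{λⱼ}` of a real symmetric `d × d` matrix. -/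
def spectralDist {d : ℕ} (A : Matrix (Fin d) (Fin d) ℝ) (hA : A.IsHermitian) : Measure ℝ :=
  (d : ℝ≥0∞)⁻¹ • ∑ j, Measure.dirac (hA.eigenvalues j)

/-- Weak convergence `ν n → H` of (finite) measures on `ℝ`. -/
def WeaklyConverges (ν : ℕ → Measure ℝ) (H : Measure ℝ) : Prop :=
  ∀ f : ℝ →ᵇ ℝ, Tendsto (fun n => ∫ t, f t ∂(ν n)) atTop (𝓝 (∫ t, f t ∂H))

/-- The square of a symmetric matrix is symmetric. -/
theorem isHermitian_sq {d : ℕ} {A : Matrix (Fin d) (Fin d) ℝ} (hA : A.IsHermitian) :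
    (A ^ 2).IsHermitian := hA.pow 2

/-- The sample covariance matrix `n⁻¹ ∑ᵢ xᵢ xᵢ'` (no centring) of `x₁, …, xₙ ∈ ℝᵈ`. -/
def sampleCov {n d : ℕ} (x : Fin n → Fin d → ℝ) : Matrix (Fin d) (Fin d) ℝ :=
  (n : ℝ)⁻¹ • ∑ i, vecMulVec (x i) (x i)

theorem isHermitian_sampleCov {n d : ℕ} (x : Fin n → Fin d → ℝ) :
    (sampleCov x).IsHermitian := by
  ext a b
  simp [sampleCov, Matrix.sum_apply, vecMulVec_apply, mul_comm]

/-- `β̂_{nk}`: the `k`-th moment of the empirical spectral distribution of the sample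
covariance matrix. -/
def betaHat {n d : ℕ} (x : Fin n → Fin d → ℝ) (k : ℕ) : ℝ :=
  ∫ t, t ^ k ∂(spectralDist (sampleCov x) (isHermitian_sampleCov x))

/-- The sample `x̌ᵢ = Qᵢ xᵢ`, where `Qᵢ` is the matrix of the permutation `q i`. -/
def permutedSample {n d : ℕ} (x : Fin n → Fin d → ℝ) (q : Fin n → Equiv.Perm (Fin d)) :
    Fin n → Fin d → ℝ :=
  fun i => (q i).permMatrix ℝ *ᵥ x i

/-- `β̌_{nk} = tr(B̌ᵏ)/d`, with `B̌` the sample covariance matrix of the permuted sample. -/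
def betaCheck {n d : ℕ} (x : Fin n → Fin d → ℝ) (q : Fin n → Equiv.Perm (Fin d)) (k : ℕ) : ℝ :=
  (sampleCov (permutedSample x q) ^ k).trace / d

/-- The test statistic `T_n = β̂_{n2} - β̌_{n2}`. -/
def testStat {n d : ℕ} (x : Fin n → Fin d → ℝ) (q : Fin n → Equiv.Perm (Fin d)) : ℝ :=
  betaHat x 2 - betaCheck x q 2

/-- `γ̂_{n2} = (β̂_{n2} - β̂_{n1}²)/c_n` with `c_n = d/n`. -/
def gammaHat {n d : ℕ} (x : Fin n → Fin d → ℝ) : ℝ :=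
  (betaHat x 2 - betaHat x 1 ^ 2) / ((d : ℝ) / (n : ℝ))

/-- The observations `xᵢ = wᵢ T zᵢ`, `i < n`, where `zᵢ = (z_{i1}, …, z_{id})'`. -/
def observations {n d : ℕ} (T : Matrix (Fin d) (Fin d) ℝ) (z : ℕ → ℕ → ℝ) (w : ℕ → ℝ) :
    Fin n → Fin d → ℝ :=
  fun i => w i • (T *ᵥ fun j : Fin d => z i j)

/-- The null hypothesis: the population covariance matrix is `σ² I` for some `σ² > 0`. -/
def IsSpherical {d : ℕ} (S : Matrix (Fin d) (Fin d) ℝ) : Prop :=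
  ∃ s : ℝ, 0 < s ∧ S = s • (1 : Matrix (Fin d) (Fin d) ℝ)

end

end ScaleMixture

set_option linter.unusedSectionVars false

namespace ScaleMixture

/-! ### Resampling coordinates of a product measure -/

section Resampling

variable {ι E : Type*} [Fintype ι] [DecidableEq ι] [MeasurableSpace E]
  (ν : Measure E) [IsProbabilityMeasure ν]

/-! Put `X i = (w_i, z_i, Q_i)`. These triples are i.i.d. with law `obsLaw` (`map_obs_eq_pi`). The
trace of the squared sample covariance matrix is `n⁻² ∑ᵢⱼ (xᵢ·xⱼ)²`, and permuting coordinates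
preserves lengths, so the diagonal terms of the two second spectral moments cancel. Hence `n Tₙ` is
exactly a sum over ordered pairs of distinct indices of the symmetric kernel `(pn)⁻¹ ((x·y)² -
(x̌·y̌)²)` (`testStat_eq`), and both claims concern this statistic of order two.

Null hypothesis. The trace normalization and positivity force `T = 1` (`eq_one_of_isSpherical`). The
identity is invariant under averaging over permutations, so the kernel has conditional mean zero
given one argument (`integral_obsKernel_one_right`): the statistic is degenerate. Its limit law
comes from a differential equation for the characteristic function `φ`. If `S = ∑ D_k` with `D_k`
the row sums, then `S - 2 D_k` does not depend on `X k`, so `E D_k exp(it(S - 2 D_k)) = 0`.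
Subtracting these zeros from `φ'` and expanding gives `φ'(t) ≈ -t E[2 ∑ D_k² exp(itS)]`, which is
about `-t s φ(t)` once `2 ∑ D_k²` concentrates at `s` (`norm_integral_cexp_pairSum_sub_le`,
`tendsto_integral_cexp_pairSum`). Concentration requires bounded rescaled fourth moments of the
kernel, hence eighth moments of `z`, and smallness of the squared integral operator. The latter
holds because the kernel is a signed sum of products of features, the entries of `z zᵀ - 1` before
and after permutation, whose Gram operator is bounded independently of the dimension
(`integral_kernelSq_sq_le`, `integral_sum_nullFeature_sq_le`). The original and the permuted
features are asymptotically uncorrelated, so `s = 8 (E w⁴)²`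
(`abs_integral_obsKernel_one_sq_sub_le`). Since the normalizing statistic converges to `E w⁴` in
`L¹` (`integral_abs_normStat_sub_le`), Slutsky's theorem concludes.

Alternative hypothesis. The mean `D = n δₙ` is a multiple of the squared Frobenius distance from `T
Tᵀ` to its average over simultaneous permutations (`integral_obsKernel`). The variance is at most a
constant times `1 + D + D²/n` (`integral_pairSum_statKernel_sub_sq_le`), which is `o(D²)`, while the
normalizing statistic is bounded in `L¹` (`integral_abs_normStat_le`). Chebyshev's and Markov's
inequalities finish the proof (`tendsto_measure_test`). -/

theorem measurePreserving_update (i : ι) :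
    MeasurePreserving (fun xt : (ι → E) × E => Function.update xt.1 i xt.2)
      ((Measure.pi fun _ : ι => ν).prod ν) (Measure.pi fun _ : ι => ν) := by
  have hm : Measurable (fun xt : (ι → E) × E => Function.update xt.1 i xt.2) := by
    refine measurable_pi_lambda _ fun j => ?_
    by_cases hj : j = i
    · subst hj; simpa using measurable_snd
    · simp only [Function.update_of_ne hj]
      exact (measurable_pi_apply j).comp measurable_fst
  refine ⟨hm, Eq.symm (Measure.pi_eq fun s hs => ?_)⟩
  rw [Measure.map_apply hm (MeasurableSet.univ_pi hs)]
  -- The old value of coordinate `i` is overwritten and therefore unconstrained; only the fresh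
  -- value has to lie in `s i`.
  have : (fun xt : (ι → E) × E => Function.update xt.1 i xt.2) ⁻¹' (Set.univ.pi s)
      = (Set.univ.pi (Function.update s i Set.univ)) ×ˢ (s i) := by
    ext ⟨x, t⟩
    simp only [Set.mem_preimage, Set.mem_pi, Set.mem_univ, forall_true_left, Set.mem_prod]
    constructor
    · intro h
      refine ⟨fun j => ?_, by simpa using h i⟩
      by_cases hj : j = i
      · subst hj; simp
      · simpa [hj] using h j
    · rintro ⟨h, ht⟩ j
      by_cases hj : j = i
      · subst hj; simpa using ht
      · simpa [hj] using h j
  rw [this, Measure.prod_prod, Measure.pi_pi]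
  rw [← Finset.mul_prod_erase _ _ (Finset.mem_univ i),
    ← Finset.mul_prod_erase (Finset.univ) (fun j => ν (s j)) (Finset.mem_univ i)]
  simp only [Function.update_self, measure_univ, one_mul]
  rw [mul_comm]
  congr 1
  refine Finset.prod_congr rfl fun j hj => ?_
  rw [Function.update_of_ne (Finset.ne_of_mem_erase hj)]

variable {ν} {G : Type*} [NormedAddCommGroup G] [NormedSpace ℝ G]

/-- Coordinate `i` is replaced by an independent copy. The inner integral plays the role of the
conditional expectation given the other coordinates. -/
theorem integral_update {F : (ι → E) → G} (hF : Integrable F (Measure.pi fun _ => ν)) (i : ι) :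
    ∫ x, F x ∂(Measure.pi fun _ => ν)
      = ∫ x, ∫ t, F (Function.update x i t) ∂ν ∂(Measure.pi fun _ => ν) := by
  have h := measurePreserving_update ν i
  conv_lhs => rw [← h.map_eq]
  rw [integral_map h.measurable.aemeasurable (by rw [h.map_eq]; exact hF.1), integral_prod]
  exact h.integrable_comp_of_integrable hF

theorem integral_update_swap {F : (ι → E) → G} (hF : Integrable F (Measure.pi fun _ => ν))
    (i : ι) :
    ∫ x, F x ∂(Measure.pi fun _ => ν)
      = ∫ t, ∫ x, F (Function.update x i t) ∂(Measure.pi fun _ => ν) ∂ν := by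
  have h := measurePreserving_update ν i
  conv_lhs => rw [← h.map_eq]
  rw [integral_map h.measurable.aemeasurable (by rw [h.map_eq]; exact hF.1), integral_prod_symm]
  exact h.integrable_comp_of_integrable hF

/-- The source of the vanishing cross expectations: it is enough that one coordinate averages out.
Integrability need not be assumed, because the Bochner integral of a non-integrable function is
zero. -/
theorem integral_eq_zero_of_update {F : (ι → E) → G} (i : ι)
    (h0 : ∀ x, ∫ t, F (Function.update x i t) ∂ν = 0) :
    ∫ x, F x ∂(Measure.pi fun _ => ν) = 0 := by
  by_cases hF : Integrable F (Measure.pi fun _ => ν)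
  · rw [integral_update hF i]; simp [h0]
  · exact integral_undef hF

variable (ν)

theorem measurePreserving_pair {i j : ι} (hij : i ≠ j) :
    MeasurePreserving (fun x : ι → E => (x i, x j)) (Measure.pi fun _ => ν) (ν.prod ν) := by
  have hm : Measurable (fun x : ι → E => (x i, x j)) := by fun_prop
  refine ⟨hm, ?_⟩
  have hI : iIndepFun (fun (i : ι) (x : ι → E) => x i) (Measure.pi fun _ => ν) :=
    iIndepFun_pi (X := fun _ => id) fun _ => aemeasurable_id
  have := (indepFun_iff_map_prod_eq_prod_map_map (measurable_pi_apply i).aemeasurable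
    (measurable_pi_apply j).aemeasurable).1 (hI.indepFun hij)
  rw [this, (measurePreserving_eval (fun _ : ι => ν) i).map_eq,
    (measurePreserving_eval (fun _ : ι => ν) j).map_eq]

variable {ν}

theorem integral_pair {i j : ι} (hij : i ≠ j) {F : E × E → G}
    (hF : AEStronglyMeasurable F (ν.prod ν)) :
    ∫ x, F (x i, x j) ∂(Measure.pi fun _ : ι => ν) = ∫ e, F e ∂(ν.prod ν) := by
  have h := measurePreserving_pair ν hij
  rw [← h.map_eq, integral_map h.measurable.aemeasurable (by rwa [h.map_eq])]

theorem integrable_pair {i j : ι} (hij : i ≠ j) {F : E × E → G} (hF : Integrable F (ν.prod ν)) :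
    Integrable (fun x : ι → E => F (x i, x j)) (Measure.pi fun _ : ι => ν) :=
  (measurePreserving_pair ν hij).integrable_comp_of_integrable hF

theorem integral_coord (i : ι) {F : E → G} (hF : AEStronglyMeasurable F ν) :
    ∫ x, F (x i) ∂(Measure.pi fun _ : ι => ν) = ∫ e, F e ∂ν := by
  have h := measurePreserving_eval (fun _ : ι => ν) i
  rw [← integral_map (φ := Function.eval i) h.measurable.aemeasurable
    (by rwa [h.map_eq]), h.map_eq]

theorem integrable_coord (i : ι) {F : E → G} (hF : Integrable F ν) :
    Integrable (fun x : ι → E => F (x i)) (Measure.pi fun _ : ι => ν) :=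
  (measurePreserving_eval (fun _ : ι => ν) i).integrable_comp_of_integrable hF

end Resampling

/-! ### Even moments of sums of independent centred variables -/

section Moments

theorem MemLp.integrable_pow_of_le {Ω : Type*} [MeasurableSpace Ω] {P : Measure Ω}
    [IsFiniteMeasure P] {f : Ω → ℝ} {m : ℕ} (hf : MemLp f m P) {k : ℕ} (hk : k ≤ m) :
    Integrable (fun ω => f ω ^ k) P := by
  rcases Nat.eq_zero_or_pos k with rfl | hk0
  · simp
  · have h1 : MemLp f (k : ℝ≥0∞) P := hf.mono_exponent (by exact_mod_cast hk)
    have h2 := h1.integrable_norm_pow hk0.ne'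
    refine h2.mono (h1.1.pow k) (ae_of_all _ fun ω => ?_)
    simp

theorem memLp_of_integrable_even_pow {Ω : Type*} [MeasurableSpace Ω] {P : Measure Ω}
    {f : Ω → ℝ} (hf : AEStronglyMeasurable f P) {r : ℕ}
    (h : Integrable (fun ω => f ω ^ (2 * r)) P) : MemLp f ((2 * r : ℕ) : ℝ≥0∞) P := by
  rcases Nat.eq_zero_or_pos r with rfl | hr
  · simpa using hf
  · rw [← integrable_norm_rpow_iff hf (by simp; omega) (ENNReal.natCast_ne_top _)]
    refine h.congr (ae_of_all _ fun ω => ?_)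
    simp only [ENNReal.toReal_natCast, Real.rpow_natCast, Real.norm_eq_abs]
    rw [Even.pow_abs (even_two_mul r)]

/-- The two lowest terms in `y` of the binomial expansion are kept exactly, because the linear one
will have mean zero. Every other monomial lies below one of the two extreme ones, according to
whether `|s| ≤ |y|`, and the binomial coefficients add up to at most `2 ^ (2 * r + 2)`. -/
theorem add_pow_le_even (r : ℕ) (s y : ℝ) :
    (s + y) ^ (2 * r + 2) ≤ s ^ (2 * r + 2) + (2 * r + 2 : ℕ) * (s ^ (2 * r + 1) * y)
      + 4 ^ (r + 1) * (s ^ (2 * r) * y ^ 2 + y ^ (2 * r + 2)) := by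
  have hs : (s ^ (2 * r)) = |s| ^ (2 * r) := by rw [Even.pow_abs (even_two_mul r)]
  have hy : (y ^ (2 * r + 2)) = |y| ^ (2 * r + 2) := by
    rw [Even.pow_abs ⟨r + 1, by ring⟩]
  have hy2 : y ^ 2 = |y| ^ 2 := by rw [sq_abs]
  have key : ∀ m ∈ Finset.range (2 * r + 1),
      y ^ (m + 2) * s ^ (2 * r - m) ≤ s ^ (2 * r) * y ^ 2 + y ^ (2 * r + 2) := by
    intro m hm
    have hm' : m ≤ 2 * r := by simpa [Nat.lt_succ_iff] using hm
    calc y ^ (m + 2) * s ^ (2 * r - m) ≤ |y ^ (m + 2) * s ^ (2 * r - m)| := le_abs_self _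
      _ = |y| ^ (m + 2) * |s| ^ (2 * r - m) := by rw [abs_mul, abs_pow, abs_pow]
      _ ≤ |s| ^ (2 * r) * |y| ^ 2 + |y| ^ (2 * r + 2) := by
        rcases le_total |s| |y| with h | h
        · have : |y| ^ (m + 2) * |s| ^ (2 * r - m) ≤ |y| ^ (2 * r + 2) := by
            calc |y| ^ (m + 2) * |s| ^ (2 * r - m) ≤ |y| ^ (m + 2) * |y| ^ (2 * r - m) := by
                  gcongr
              _ = |y| ^ (2 * r + 2) := by rw [← pow_add]; congr 1; omega
          have : 0 ≤ |s| ^ (2 * r) * |y| ^ 2 := by positivity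
          linarith
        · have : |y| ^ (m + 2) * |s| ^ (2 * r - m) ≤ |s| ^ (2 * r) * |y| ^ 2 := by
            calc |y| ^ (m + 2) * |s| ^ (2 * r - m) = |y| ^ m * |s| ^ (2 * r - m) * |y| ^ 2 := by ring
              _ ≤ |s| ^ m * |s| ^ (2 * r - m) * |y| ^ 2 := by gcongr
              _ = _ := by rw [← pow_add]; congr 2; omega
          have : 0 ≤ |y| ^ (2 * r + 2) := by positivity
          linarith
      _ = _ := by rw [hs, hy, hy2]
  have h1 : (s + y) ^ (2 * r + 2) = s ^ (2 * r + 2) + (2 * r + 2 : ℕ) * (s ^ (2 * r + 1) * y)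
      + ∑ m ∈ Finset.range (2 * r + 1),
          y ^ (m + 2) * s ^ (2 * r - m) * ((2 * r + 2).choose (m + 2) : ℝ) := by
    rw [add_comm s y, add_pow, Finset.sum_range_succ', Finset.sum_range_succ']
    simp only [pow_zero, Nat.sub_zero, Nat.choose_zero_right, Nat.cast_one, one_mul, mul_one,
      zero_add, pow_one, Nat.choose_one_right]
    rw [show 2 * r + 2 - 1 = 2 * r + 1 by omega]
    have : ∀ m, 2 * r + 2 - (m + 1 + 1) = 2 * r - m := fun m => by omega
    simp only [this, add_assoc, show (1 + 1 : ℕ) = 2 from rfl]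
    ring
  have hnn : 0 ≤ s ^ (2 * r) * y ^ 2 + y ^ (2 * r + 2) := by rw [hs, hy]; positivity
  have h2 : ∑ m ∈ Finset.range (2 * r + 1), ((2 * r + 2).choose (m + 2) : ℝ) ≤ 4 ^ (r + 1) := by
    have h3 := Nat.sum_range_choose (2 * r + 2)
    rw [Finset.sum_range_succ', Finset.sum_range_succ'] at h3
    have h4 : (2 : ℕ) ^ (2 * r + 2) = 4 ^ (r + 1) := by
      rw [show 2 * r + 2 = 2 * (r + 1) by ring, pow_mul]; norm_num
    have h5 : ∑ m ∈ Finset.range (2 * r + 1), (2 * r + 2).choose (m + 2) ≤ 4 ^ (r + 1) := by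
      rw [← h4, ← h3]; simp only [add_assoc, show (1 + 1 : ℕ) = 2 from rfl]; omega
    exact_mod_cast h5
  rw [h1]
  gcongr
  calc _ ≤ ∑ m ∈ Finset.range (2 * r + 1),
        (s ^ (2 * r) * y ^ 2 + y ^ (2 * r + 2)) * ((2 * r + 2).choose (m + 2) : ℝ) :=
        Finset.sum_le_sum fun m hm => mul_le_mul_of_nonneg_right (key m hm) (by positivity)
    _ = (∑ m ∈ Finset.range (2 * r + 1), ((2 * r + 2).choose (m + 2) : ℝ))
        * (s ^ (2 * r) * y ^ 2 + y ^ (2 * r + 2)) := by rw [← Finset.mul_sum, mul_comm]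
    _ ≤ _ := mul_le_mul_of_nonneg_right h2 hnn

/-- The constants in `integral_sum_even_pow_le`. -/
def momentConst : ℕ → ℝ
  | 0 => 1
  | r + 1 => 4 ^ (r + 1) * (momentConst r + 1)

theorem momentConst_pos (r : ℕ) : 0 < momentConst r := by
  induction r with
  | zero => simp [momentConst]
  | succ r ih => simp only [momentConst]; positivity

/-- A Marcinkiewicz–Zygmund type bound for even moments. -/
theorem integral_sum_even_pow_le {ι Ω : Type*} [MeasurableSpace Ω] {P : Measure Ω}
    [IsProbabilityMeasure P] {Y : ι → Ω → ℝ} (hind : iIndepFun Y P)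
    (hm : ∀ i, Measurable (Y i)) (h0 : ∀ i, ∫ ω, Y i ω ∂P = 0) {v : ι → ℝ} (hv : ∀ i, 0 ≤ v i)
    {κ : ℝ} (hκ : 1 ≤ κ) (r : ℕ) (hint : ∀ i, MemLp (Y i) ((2 * r : ℕ) : ℝ≥0∞) P)
    (hmom : ∀ i, ∀ k, k ≤ r → ∫ ω, Y i ω ^ (2 * k) ∂P ≤ κ * v i ^ k) (s : Finset ι) :
    ∫ ω, (∑ i ∈ s, Y i ω) ^ (2 * r) ∂P ≤ momentConst r * κ ^ r * (∑ i ∈ s, v i) ^ r := by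
  classical
  have hκ0 : 0 < κ := by linarith
  -- Outer induction on half the exponent, inner induction on the index set. When a variable is
  -- added, independence and centring kill the linear term, and the outer hypothesis controls the
  -- moment of order `2 * r` that multiplies its variance.
  induction r generalizing s with
  | zero => simp [momentConst]
  | succ r ih =>
    have ih' := ih (fun i => (hint i).mono_exponent (by norm_cast; omega))
      (fun i k hk => hmom i k (by omega))
    have hL : ∀ s : Finset ι, MemLp (fun ω => ∑ i ∈ s, Y i ω) ((2 * (r + 1) : ℕ) : ℝ≥0∞) P :=
      fun s => memLp_finsetSum s fun i _ => hint i
    have hC := momentConst_pos r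
    induction s using Finset.induction_on with
    | empty => simp
    | insert a s ha ihs =>
      have hindep : IndepFun (fun ω => ∑ i ∈ s, Y i ω) (Y a) P := by
        have := hind.indepFun_finsetSum_of_notMem hm ha
        rwa [show (∑ j ∈ s, Y j) = fun ω => ∑ i ∈ s, Y i ω by ext; simp] at this
      have hSm : Measurable (fun ω => ∑ i ∈ s, Y i ω) := by fun_prop
      have hprod : ∀ k l : ℕ, k ≤ 2 * (r + 1) → l ≤ 2 * (r + 1) →
          Integrable (fun ω => (∑ i ∈ s, Y i ω) ^ k * Y a ω ^ l) P ∧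
          ∫ ω, (∑ i ∈ s, Y i ω) ^ k * Y a ω ^ l ∂P
            = (∫ ω, (∑ i ∈ s, Y i ω) ^ k ∂P) * ∫ ω, Y a ω ^ l ∂P := by
        intro k l hk hl
        have hi : IndepFun (fun ω => (∑ i ∈ s, Y i ω) ^ k) (fun ω => Y a ω ^ l) P :=
          hindep.comp (φ := fun t => t ^ k) (ψ := fun t => t ^ l) (by fun_prop) (by fun_prop)
        exact ⟨hi.integrable_mul (MemLp.integrable_pow_of_le (hL s) hk)
            (MemLp.integrable_pow_of_le (hint a) hl),
          hi.integral_fun_mul_eq_mul_integral (hSm.pow_const k).aestronglyMeasurable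
            ((hm a).pow_const l).aestronglyMeasurable⟩
      have hV : 0 ≤ ∑ i ∈ s, v i := Finset.sum_nonneg fun i _ => hv i
      set V := ∑ i ∈ s, v i with hVdef
      have e1 := hprod (2 * r + 1) 1 (by omega) (by omega)
      have e2 := hprod (2 * r) 2 (by omega) (by omega)
      have i0 : Integrable (fun ω => (∑ i ∈ s, Y i ω) ^ (2 * r + 2)) P :=
        MemLp.integrable_pow_of_le (hL s) (by omega)
      have i4 : Integrable (fun ω => Y a ω ^ (2 * r + 2)) P :=
        MemLp.integrable_pow_of_le (hint a) (by omega)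
      have hstep : ∫ ω, (∑ i ∈ insert a s, Y i ω) ^ (2 * (r + 1)) ∂P
          ≤ ∫ ω, (∑ i ∈ s, Y i ω) ^ (2 * r + 2) ∂P
            + 4 ^ (r + 1) * ((∫ ω, (∑ i ∈ s, Y i ω) ^ (2 * r) ∂P) * ∫ ω, Y a ω ^ 2 ∂P
              + ∫ ω, Y a ω ^ (2 * r + 2) ∂P) := by
        have e3 : ∫ ω, (∑ i ∈ s, Y i ω) ^ (2 * r + 1) * Y a ω ∂P = 0 := by
          have := e1.2
          simp only [pow_one, h0 a, mul_zero] at this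
          exact this
        have e1' : Integrable (fun ω => (∑ i ∈ s, Y i ω) ^ (2 * r + 1) * Y a ω) P := by
          simpa using e1.1
        calc _ ≤ ∫ ω, ((∑ i ∈ s, Y i ω) ^ (2 * r + 2)
              + (2 * r + 2 : ℕ) * ((∑ i ∈ s, Y i ω) ^ (2 * r + 1) * Y a ω)
              + 4 ^ (r + 1) * ((∑ i ∈ s, Y i ω) ^ (2 * r) * Y a ω ^ 2
                + Y a ω ^ (2 * r + 2))) ∂P := by
              refine integral_mono (MemLp.integrable_pow_of_le (hL _) le_rfl) ?_ fun ω => ?_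
              · exact (i0.add (e1'.const_mul _)).add ((e2.1.add i4).const_mul _)
              · simp only [Finset.sum_insert ha]
                rw [add_comm (Y a ω)]
                exact add_pow_le_even r _ _
          _ = _ := by
              have j1 : Integrable (fun ω => (∑ i ∈ s, Y i ω) ^ (2 * r + 2)
                + (2 * r + 2 : ℕ) * ((∑ i ∈ s, Y i ω) ^ (2 * r + 1) * Y a ω)) P :=
                i0.add (e1'.const_mul _)
              have j2 : Integrable (fun ω => (∑ i ∈ s, Y i ω) ^ (2 * r) * Y a ω ^ 2
                + Y a ω ^ (2 * r + 2)) P := e2.1.add i4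
              rw [integral_add j1 (j2.const_mul _),
                integral_add i0 (e1'.const_mul _), integral_const_mul, integral_const_mul,
                integral_add e2.1 i4, e3, e2.2]
              ring
      have hv2 : ∫ ω, Y a ω ^ 2 ∂P ≤ κ * v a := by
        simpa using hmom a 1 (by omega)
      have hv4 : ∫ ω, Y a ω ^ (2 * r + 2) ∂P ≤ κ * v a ^ (r + 1) := hmom a (r + 1) le_rfl
      have hva := hv a
      have hS := ih' s
      have hY2 : 0 ≤ ∫ ω, Y a ω ^ 2 ∂P := integral_nonneg fun ω => by positivity
      rw [Finset.sum_insert ha, ← hVdef]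
      rw [← hVdef] at hS
      -- Upgrades the single factor `κ` of the highest moment to `κ ^ (r + 1)`.
      have hκr : 1 ≤ κ ^ r := one_le_pow₀ hκ
      calc _ ≤ momentConst (r + 1) * κ ^ (r + 1) * V ^ (r + 1)
            + 4 ^ (r + 1) * ((momentConst r * κ ^ r * V ^ r) * (κ * v a)
              + κ ^ (r + 1) * v a ^ (r + 1)) := by
              refine hstep.trans (add_le_add ihs ?_)
              gcongr
              refine hv4.trans ?_
              gcongr
              rw [pow_succ]; nlinarith
        _ ≤ momentConst (r + 1) * κ ^ (r + 1) * V ^ (r + 1)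
            + momentConst (r + 1) * κ ^ (r + 1) * ((v a + V) ^ r * v a) := by
              have b1 : V ^ r * v a ≤ (v a + V) ^ r * v a := by gcongr; linarith
              have b2 : v a ^ (r + 1) ≤ (v a + V) ^ r * v a := by
                rw [pow_succ]; gcongr; linarith
              simp only [momentConst]
              have : momentConst r * κ ^ r * V ^ r * (κ * v a) + κ ^ (r + 1) * v a ^ (r + 1)
                ≤ (momentConst r + 1) * κ ^ (r + 1) * ((v a + V) ^ r * v a) := by
                calc _ = momentConst r * κ ^ (r + 1) * (V ^ r * v a)
                      + κ ^ (r + 1) * v a ^ (r + 1) := by ring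
                  _ ≤ momentConst r * κ ^ (r + 1) * ((v a + V) ^ r * v a)
                      + κ ^ (r + 1) * ((v a + V) ^ r * v a) := by gcongr
                  _ = _ := by ring
              calc _ ≤ _ + 4 ^ (r + 1) * ((momentConst r + 1) * κ ^ (r + 1)
                    * ((v a + V) ^ r * v a)) := by gcongr
                _ = _ := by ring
        _ ≤ _ := by
              -- Together with the increment this gives `V ^ (r + 1) + (v a + V) ^ r * v a ≤ (v a +
              -- V) ^ (r + 1)`, so the constant does not grow along the inner induction.
              have b3 : V ^ (r + 1) ≤ (v a + V) ^ r * V := by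
                rw [pow_succ]; gcongr; linarith
              have hC' := momentConst_pos (r + 1)
              calc _ = momentConst (r + 1) * κ ^ (r + 1) * (V ^ (r + 1) + (v a + V) ^ r * v a) := by
                    ring
                _ ≤ momentConst (r + 1) * κ ^ (r + 1) * ((v a + V) ^ r * V + (v a + V) ^ r * v a) := by
                    gcongr
                _ = _ := by ring

end Moments

/-! ### Second moments of double sums over pairs of independent variables -/

section PairSums

theorem sq_integral_le_integral_sq {Ω : Type*} [MeasurableSpace Ω] {P : Measure Ω}
    [IsProbabilityMeasure P] {f : Ω → ℝ} (hf : MemLp f 2 P) :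
    (∫ ω, f ω ∂P) ^ 2 ≤ ∫ ω, f ω ^ 2 ∂P := by
  have h1 := variance_nonneg f P
  have h2 := variance_eq_sub hf
  simp only [Pi.pow_apply] at h2
  linarith

/-- Second moments of pair sums, triple sums and quadratic forms are all obtained from a table `c`
of bounds for the pairwise expectations. -/
theorem integral_sq_sum_le {I Ω : Type*} [MeasurableSpace Ω] {P : Measure Ω} (s : Finset I)
    {Y : I → Ω → ℝ} {c : I → I → ℝ}
    (hint : ∀ a ∈ s, ∀ b ∈ s, Integrable (fun ω => Y a ω * Y b ω) P)
    (hc : ∀ a ∈ s, ∀ b ∈ s, ∫ ω, Y a ω * Y b ω ∂P ≤ c a b) :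
    ∫ ω, (∑ a ∈ s, Y a ω) ^ 2 ∂P ≤ ∑ a ∈ s, ∑ b ∈ s, c a b := by
  simp_rw [sq, Finset.sum_mul_sum]
  rw [integral_finsetSum _ fun a ha => integrable_finsetSum _ fun b hb => hint a ha b hb]
  refine Finset.sum_le_sum fun a ha => ?_
  rw [integral_finsetSum _ fun b hb => hint a ha b hb]
  exact Finset.sum_le_sum fun b hb => hc a ha b hb

variable {ι E : Type*} [Fintype ι] [DecidableEq ι] [MeasurableSpace E]
  {ν : Measure E} [IsProbabilityMeasure ν]

theorem integrable_integral_update {G : Type*} [NormedAddCommGroup G] [NormedSpace ℝ G]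
    {F : (ι → E) → G} (hF : Integrable F (Measure.pi fun _ => ν)) (i : ι) :
    Integrable (fun x => ∫ t, F (Function.update x i t) ∂ν) (Measure.pi fun _ => ν) :=
  ((measurePreserving_update ν i).integrable_comp_of_integrable hF).integral_prod_left

/-- The sum of a kernel over all ordered pairs of distinct indices. -/
def pairSum (F : E → E → ℝ) (x : ι → E) : ℝ :=
  ∑ q ∈ (Finset.univ : Finset ι).offDiag, F (x q.1) (x q.2)

theorem memLp_pair {F : E → E → ℝ} {r : ℝ≥0∞} (hF : MemLp (Function.uncurry F) r (ν.prod ν))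
    {i j : ι} (hij : i ≠ j) :
    MemLp (fun x : ι → E => F (x i) (x j)) r (Measure.pi fun _ : ι => ν) :=
  hF.comp_measurePreserving (measurePreserving_pair ν hij)

theorem integrable_mul_pair {F : E → E → ℝ} (hF : MemLp (Function.uncurry F) 2 (ν.prod ν))
    {i j k l : ι} (hij : i ≠ j) (hkl : k ≠ l) :
    Integrable (fun x : ι → E => F (x i) (x j) * F (x k) (x l)) (Measure.pi fun _ : ι => ν) :=
  (memLp_pair hF hij).integrable_mul (memLp_pair hF hkl)

/-- Without a common index the factors are independent; resampling `i` and `j` integrates the first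
one to its mean. -/
theorem integral_mul_pair_eq_zero {F : E → E → ℝ}
    (hF : MemLp (Function.uncurry F) 2 (ν.prod ν))
    (h0 : ∫ e, F e.1 e.2 ∂(ν.prod ν) = 0) {i j k l : ι} (hij : i ≠ j) (hkl : k ≠ l)
    (hik : i ≠ k) (hil : i ≠ l) (hjk : j ≠ k) (hjl : j ≠ l) :
    ∫ x : ι → E, F (x i) (x j) * F (x k) (x l) ∂(Measure.pi fun _ : ι => ν) = 0 := by
  rw [integral_update (integrable_mul_pair hF hij hkl) i]
  apply integral_eq_zero_of_update j
  intro x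
  have e : ∀ t s, F (Function.update (Function.update x j t) i s i)
      (Function.update (Function.update x j t) i s j)
      * F (Function.update (Function.update x j t) i s k)
        (Function.update (Function.update x j t) i s l) = F s t * F (x k) (x l) := by
    intro t s
    simp [hij.symm, hik.symm, hil.symm, hjk.symm, hjl.symm]
  simp_rw [e, integral_mul_const]
  have hi : Integrable (Function.uncurry F) (ν.prod ν) := hF.integrable (by norm_num)
  have := integral_prod_symm _ hi
  simp only [Function.uncurry_apply_pair] at this
  rw [← this]
  have h0' : ∫ e, Function.uncurry F e ∂(ν.prod ν) = 0 := h0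
  rw [h0', zero_mul]

/-- Given the shared coordinate, the two factors are conditionally i.i.d., so the conditional mean
appears squared. -/
theorem integral_mul_pair_share {F : E → E → ℝ}
    (hF : MemLp (Function.uncurry F) 2 (ν.prod ν)) {i j l : ι} (hij : i ≠ j) (hil : i ≠ l)
    (hjl : j ≠ l) :
    ∫ x : ι → E, F (x i) (x j) * F (x i) (x l) ∂(Measure.pi fun _ : ι => ν)
      = ∫ t, (∫ s, F t s ∂ν) ^ 2 ∂ν := by
  have hint := integrable_mul_pair hF hij hil
  have hint2 := integrable_integral_update hint j
  rw [integral_update hint j, integral_update hint2 l]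
  have e : ∀ (x : ι → E) t s, F (Function.update (Function.update x l t) j s i)
      (Function.update (Function.update x l t) j s j)
      * F (Function.update (Function.update x l t) j s i)
        (Function.update (Function.update x l t) j s l) = F (x i) s * F (x i) t := by
    intro x t s
    simp [hij, hil, hjl.symm]
  simp_rw [e, integral_mul_const, integral_const_mul, ← sq]
  have hm : AEStronglyMeasurable (fun t => (∫ s, F t s ∂ν) ^ 2) ν :=
    (AEStronglyMeasurable.integral_prod_right' (f := Function.uncurry F) hF.1).pow 2
  exact integral_coord i hm

theorem integral_sq_integral_le {F : E → E → ℝ}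
    (hF : MemLp (Function.uncurry F) 2 (ν.prod ν)) :
    ∫ t, (∫ s, F t s ∂ν) ^ 2 ∂ν ≤ ∫ e, F e.1 e.2 ^ 2 ∂(ν.prod ν) := by
  have hsq : Integrable (fun e => Function.uncurry F e ^ 2) (ν.prod ν) := hF.integrable_sq
  have h2 : ∫ e, F e.1 e.2 ^ 2 ∂(ν.prod ν) = ∫ t, ∫ s, F t s ^ 2 ∂ν ∂ν :=
    integral_prod (f := fun e => Function.uncurry F e ^ 2) hsq
  rw [h2]
  have hae := hsq.prod_right_ae
  have hmae := hF.1.prodMk_left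
  have hle : ∀ᵐ t ∂ν, (∫ s, F t s ∂ν) ^ 2 ≤ ∫ s, F t s ^ 2 ∂ν := by
    filter_upwards [hae, hmae] with t h1 h3
    exact sq_integral_le_integral_sq ((memLp_two_iff_integrable_sq h3).2 h1)
  refine integral_mono_of_nonneg (ae_of_all _ fun t => sq_nonneg _) ?_ hle
  exact hsq.integral_prod_left

/-- Pairs of index pairs are sorted by overlap: equal pairs, up to order, contribute the second
moment (at most `2 N²` of them), pairs sharing one index contribute the second moment of the
projection of `F` on one variable (at most `4 N³`), and disjoint pairs contribute nothing. For a
degenerate kernel the second contribution would vanish. -/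
theorem integral_pairSum_sq_le {F : E → E → ℝ}
    (hF : MemLp (Function.uncurry F) 2 (ν.prod ν)) (hsym : ∀ x y, F x y = F y x)
    (h0 : ∫ e, F e.1 e.2 ∂(ν.prod ν) = 0) :
    ∫ x : ι → E, pairSum F x ^ 2 ∂(Measure.pi fun _ : ι => ν)
      ≤ 2 * (Fintype.card ι : ℝ) ^ 2 * ∫ e, F e.1 e.2 ^ 2 ∂(ν.prod ν)
        + 4 * (Fintype.card ι : ℝ) ^ 3 * ∫ t, (∫ s, F t s ∂ν) ^ 2 ∂ν := by
  set A := ∫ e, F e.1 e.2 ^ 2 ∂(ν.prod ν) with hA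
  set B := ∫ t, (∫ s, F t s ∂ν) ^ 2 ∂ν with hB
  have hA0 : 0 ≤ A := integral_nonneg fun _ => sq_nonneg _
  have hB0 : 0 ≤ B := integral_nonneg fun _ => sq_nonneg _
  have hsq : ∀ {i j : ι}, i ≠ j →
      ∫ x : ι → E, F (x i) (x j) * F (x i) (x j) ∂(Measure.pi fun _ : ι => ν) = A := by
    intro i j hij
    simp_rw [← sq]
    exact integral_pair hij (F := fun e => F e.1 e.2 ^ 2) (hF.1.pow 2)
  -- Sums of indicators overcount the overlap patterns. This is harmless because `A` and `B` are
  -- nonnegative, and it makes the double sum explicit.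
  let c : ι × ι → ι × ι → ℝ := fun q r =>
    A * ((if q.1 = r.1 ∧ q.2 = r.2 then 1 else 0) + (if q.1 = r.2 ∧ q.2 = r.1 then 1 else 0))
    + B * ((if q.1 = r.1 then 1 else 0) + (if q.1 = r.2 then 1 else 0)
        + (if q.2 = r.1 then 1 else 0) + (if q.2 = r.2 then 1 else 0))
  have hc0 : ∀ q r, 0 ≤ c q r := by
    intro q r
    have h01 : ∀ (p : Prop) [Decidable p], (0 : ℝ) ≤ if p then 1 else 0 := by
      intro p _; split_ifs <;> norm_num
    dsimp only [c]
    apply_rules [add_nonneg, mul_nonneg, h01]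
  have hle : ∀ q ∈ (Finset.univ : Finset ι).offDiag, ∀ r ∈ (Finset.univ : Finset ι).offDiag,
      ∫ x : ι → E, F (x q.1) (x q.2) * F (x r.1) (x r.2) ∂(Measure.pi fun _ : ι => ν)
        ≤ c q r := by
    rintro ⟨i, j⟩ hq ⟨k, l⟩ hr
    have hij : i ≠ j := by simpa using hq
    have hkl : k ≠ l := by simpa using hr
    dsimp only
    by_cases hik : i = k
    · subst hik
      by_cases hjl : j = l
      · subst hjl
        rw [hsq hij]
        simp only [c, hij, hij.symm]
        simp
        linarith
      · rw [integral_mul_pair_share hF hij hkl hjl]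
        simp only [c, hjl, hij.symm, hkl]
        simp [← hB]
    by_cases hil : i = l
    · subst hil
      by_cases hjk : j = k
      · subst hjk
        have : ∀ x : ι → E, F (x j) (x i) = F (x i) (x j) := fun x => hsym _ _
        simp_rw [this]
        rw [hsq hij]
        simp only [c, hij, hij.symm]
        simp
        linarith
      · have : ∀ x : ι → E, F (x k) (x i) = F (x i) (x k) := fun x => hsym _ _
        simp_rw [this]
        rw [integral_mul_pair_share hF hij (Ne.symm hkl) hjk]
        simp only [c, hjk, hik, hij.symm]
        simp [← hB]
    by_cases hjk : j = k
    · subst hjk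
      have : ∀ x : ι → E, F (x i) (x j) = F (x j) (x i) := fun x => hsym _ _
      simp_rw [this]
      rw [integral_mul_pair_share hF hij.symm hkl hil]
      simp only [c, hij, hil, hkl]
      simp [← hB]
    by_cases hjl : j = l
    · subst hjl
      have : ∀ x : ι → E, F (x i) (x j) * F (x k) (x j) = F (x j) (x i) * F (x j) (x k) :=
        fun x => by rw [hsym (x i), hsym (x k)]
      simp_rw [this]
      rw [integral_mul_pair_share hF hij.symm (Ne.symm hkl) hik]
      simp only [c, hij, hik, hjk]
      simp [← hB]
    rw [integral_mul_pair_eq_zero hF h0 hij hkl hik hil hjk hjl]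
    exact hc0 _ _
  have h1 := integral_sq_sum_le (P := Measure.pi fun _ : ι => ν)
    (Finset.univ : Finset ι).offDiag (Y := fun q x => F (x q.1) (x q.2)) (c := c)
    (fun q hq r hr => integrable_mul_pair hF (by simpa using hq) (by simpa using hr)) hle
  refine h1.trans ?_
  calc _ ≤ ∑ q : ι × ι, ∑ r : ι × ι, c q r := by
        refine (Finset.sum_le_sum fun q _ => Finset.sum_le_univ_sum_of_nonneg (hc0 q)).trans ?_
        exact Finset.sum_le_univ_sum_of_nonneg fun q => Finset.sum_nonneg fun r _ => hc0 q r
    _ = _ := by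
        have e1 : ∀ a : ι, ∑ r : ι × ι, (if a = r.1 then (1 : ℝ) else 0) = Fintype.card ι := by
          intro a; rw [Fintype.sum_prod_type_right]; simp
        have e2 : ∀ a : ι, ∑ r : ι × ι, (if a = r.2 then (1 : ℝ) else 0) = Fintype.card ι := by
          intro a; rw [Fintype.sum_prod_type]; simp
        have e3 : ∀ a b : ι, ∑ r : ι × ι, (if a = r.1 ∧ b = r.2 then (1 : ℝ) else 0) = 1 := by
          intro a b; simp [Fintype.sum_prod_type, ite_and]
        have e4 : ∀ a b : ι, ∑ r : ι × ι, (if a = r.2 ∧ b = r.1 then (1 : ℝ) else 0) = 1 := by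
          intro a b; simp [Fintype.sum_prod_type_right, ite_and]
        have e5 : ∀ q : ι × ι, ∑ r : ι × ι, c q r = A * 2 + B * (4 * Fintype.card ι) := by
          intro q
          simp only [c, Finset.sum_add_distrib, ← Finset.mul_sum, e1, e2, e3, e4]
          ring
        simp_rw [e5, Finset.sum_const, Finset.card_univ, Fintype.card_prod, nsmul_eq_mul]
        push_cast
        ring

end PairSums

/-! ### Degenerate kernels: moments of the row sums -/

section Degenerate

theorem memLp_two_mul {Ω : Type*} [MeasurableSpace Ω] {P : Measure Ω} [IsFiniteMeasure P]
    {f g : Ω → ℝ} (hf : MemLp f 4 P) (hg : MemLp g 4 P) : MemLp (fun ω => f ω * g ω) 2 P := by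
  have hf4 : Integrable (fun ω => f ω ^ 4) P :=
    MemLp.integrable_pow_of_le (m := 4) (by exact_mod_cast hf) le_rfl
  have hg4 : Integrable (fun ω => g ω ^ 4) P :=
    MemLp.integrable_pow_of_le (m := 4) (by exact_mod_cast hg) le_rfl
  rw [memLp_two_iff_integrable_sq (f := fun ω => f ω * g ω) (hf.1.mul hg.1)]
  refine (hf4.add hg4).mono ((hf.1.mul hg.1).pow 2) (ae_of_all _ fun ω => ?_)
  simp only [Pi.add_apply, Real.norm_eq_abs]
  rw [abs_of_nonneg (by positivity), abs_of_nonneg (by positivity)]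
  nlinarith [sq_nonneg (f ω ^ 2 - g ω ^ 2), sq_nonneg (f ω ^ 2), sq_nonneg (g ω ^ 2)]

variable {ι E : Type*} [Fintype ι] [DecidableEq ι] [MeasurableSpace E]
  {ν : Measure E} [IsProbabilityMeasure ν]

/-- The sum of the kernel over all pairs with first index `k`. -/
def rowSum (h : E → E → ℝ) (k : ι) (x : ι → E) : ℝ :=
  ∑ j ∈ Finset.univ.erase k, h (x k) (x j)

/-- The kernel of the squared integral operator. -/
noncomputable def kernelSq (ν : Measure E) (h : E → E → ℝ) (s t : E) : ℝ := ∫ u, h u s * h u t ∂ν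

/-- Given the value `t` of coordinate `k`, the row sum is a sum of i.i.d. variables, centred by
degeneracy, so the even-moment bound applies conditionally. -/
theorem integral_rowSum_pow_four_le {h : E → E → ℝ} (hm : Measurable (Function.uncurry h))
    (hh : MemLp (Function.uncurry h) 4 (ν.prod ν)) (hdeg : ∀ x, ∫ y, h x y ∂ν = 0) (k : ι) :
    ∫ x : ι → E, rowSum h k x ^ 4 ∂(Measure.pi fun _ : ι => ν)
      ≤ momentConst 2 * (Fintype.card ι : ℝ) ^ 2 * ∫ e, h e.1 e.2 ^ 4 ∂(ν.prod ν) := by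
  have hL : MemLp (fun x : ι → E => rowSum h k x) 4 (Measure.pi fun _ : ι => ν) :=
    memLp_finsetSum _ fun j hj => memLp_pair hh (Finset.ne_of_mem_erase hj).symm
  have hint : Integrable (fun x : ι → E => rowSum h k x ^ 4) (Measure.pi fun _ : ι => ν) :=
    MemLp.integrable_pow_of_le (m := 4) (by exact_mod_cast hL) le_rfl
  have h4 : Integrable (fun e => Function.uncurry h e ^ 4) (ν.prod ν) :=
    MemLp.integrable_pow_of_le (m := 4) (by exact_mod_cast hh) le_rfl
  rw [integral_update_swap hint k]
  have h4' : ∫ e, h e.1 e.2 ^ 4 ∂(ν.prod ν) = ∫ t, ∫ s, h t s ^ 4 ∂ν ∂ν := integral_prod _ h4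
  rw [h4', ← integral_const_mul]
  refine integral_mono_of_nonneg (ae_of_all _ fun t => integral_nonneg fun x => by positivity)
    (h4.integral_prod_left.const_mul _) ?_
  filter_upwards [h4.prod_right_ae] with t ht
  have hmt : Measurable (h t) := hm.comp measurable_prodMk_left
  have hLt : MemLp (h t) ((2 * 2 : ℕ) : ℝ≥0∞) ν :=
    memLp_of_integrable_even_pow hmt.aestronglyMeasurable (r := 2) ht
  have e : ∀ x : ι → E, rowSum h k (Function.update x k t)
      = ∑ j ∈ Finset.univ.erase k, h t (x j) := by
    intro x
    refine Finset.sum_congr rfl fun j hj => ?_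
    rw [Function.update_self, Function.update_of_ne (Finset.ne_of_mem_erase hj)]
  simp_rw [e]
  set w := ∫ s, h t s ^ 4 ∂ν with hw
  have hw0 : 0 ≤ w := integral_nonneg fun s => by positivity
  have hind : iIndepFun (fun (j : ι) (x : ι → E) => h t (x j)) (Measure.pi fun _ => ν) :=
    iIndepFun_pi (X := fun _ => h t) fun _ => hmt.aemeasurable
  have hpow : ∀ (j : ι) (m : ℕ), ∫ x : ι → E, h t (x j) ^ m ∂(Measure.pi fun _ : ι => ν)
      = ∫ s, h t s ^ m ∂ν := fun j m =>
    integral_coord j (F := fun s => h t s ^ m) (hmt.pow_const m).aestronglyMeasurable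
  have h2 : ∫ s, h t s ^ 2 ∂ν ≤ √w := by
    apply Real.le_sqrt_of_sq_le
    have hL2 : MemLp (fun s => h t s ^ 2) 2 ν := by
      rw [memLp_two_iff_integrable_sq (hmt.pow_const 2).aestronglyMeasurable]
      refine ht.congr (ae_of_all _ fun s => ?_)
      simp only [Function.uncurry_apply_pair]; ring
    refine (sq_integral_le_integral_sq hL2).trans (le_of_eq ?_)
    rw [hw]; congr 1; ext s; ring
  -- The variance proxy is `√w`, with `w` the conditional fourth moment. It dominates the variance
  -- by Jensen's inequality, and its square is `w`, so `κ = 1` is admissible.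
  have key := integral_sum_even_pow_le hind (fun j => hmt.comp (measurable_pi_apply j))
    (fun j => by simpa [hdeg] using hpow j 1) (v := fun _ => √w) (fun _ => Real.sqrt_nonneg _)
    (κ := 1) le_rfl 2
    (fun j => hLt.comp_measurePreserving (measurePreserving_eval (fun _ : ι => ν) j))
    (by
      intro j m hm2
      rw [hpow]
      interval_cases m
      · simp
      · simpa using h2
      · rw [Real.sq_sqrt hw0]; simp [hw])
    (Finset.univ.erase k)
  refine key.trans ?_
  rw [one_pow, mul_one, Finset.sum_const, nsmul_eq_mul, mul_pow, Real.sq_sqrt hw0, ← mul_assoc]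
  have hC := momentConst_pos 2
  gcongr
  exact Finset.card_le_univ _

/-- The four factors form the cycle `k, i, k', j`. Integrating out the opposite vertices `k` and
`k'` gives the squared kernel at `(x i, x j)` twice. -/
theorem integral_mul_four_eq {h : E → E → ℝ} (hm : Measurable (Function.uncurry h))
    (hh : MemLp (Function.uncurry h) 4 (ν.prod ν)) {k k' i j : ι} (hij : i ≠ j) (hki : k ≠ i)
    (hkj : k ≠ j) (hki' : k' ≠ i) (hkj' : k' ≠ j) (hkk : k ≠ k') :
    ∫ x : ι → E, (h (x k) (x i) * h (x k) (x j)) * (h (x k') (x i) * h (x k') (x j))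
        ∂(Measure.pi fun _ : ι => ν)
      = ∫ e, kernelSq ν h e.1 e.2 ^ 2 ∂(ν.prod ν) := by
  have hint : Integrable (fun x : ι → E =>
      (h (x k) (x i) * h (x k) (x j)) * (h (x k') (x i) * h (x k') (x j)))
      (Measure.pi fun _ : ι => ν) :=
    (memLp_two_mul (memLp_pair hh hki) (memLp_pair hh hkj)).integrable_mul
      (memLp_two_mul (memLp_pair hh hki') (memLp_pair hh hkj'))
  rw [integral_update hint k, integral_update (integrable_integral_update hint k) k']
  have e : ∀ (x : ι → E) t s,
      (h (Function.update (Function.update x k' t) k s k)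
          (Function.update (Function.update x k' t) k s i)
        * h (Function.update (Function.update x k' t) k s k)
          (Function.update (Function.update x k' t) k s j))
      * (h (Function.update (Function.update x k' t) k s k')
          (Function.update (Function.update x k' t) k s i)
        * h (Function.update (Function.update x k' t) k s k')
          (Function.update (Function.update x k' t) k s j))
      = (h s (x i) * h s (x j)) * (h t (x i) * h t (x j)) := by
    intro x t s
    simp [hki.symm, hkj.symm, hki'.symm, hkj'.symm, hkk.symm]
  simp_rw [e, integral_mul_const, integral_const_mul]
  have hmG : Measurable (fun e : E × E => kernelSq ν h e.1 e.2) := by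
    have : Measurable (fun q : (E × E) × E => h q.2 q.1.1 * h q.2 q.1.2) :=
      (hm.comp (measurable_snd.prodMk (measurable_fst.comp measurable_fst))).mul
        (hm.comp (measurable_snd.prodMk (measurable_snd.comp measurable_fst)))
    exact (this.stronglyMeasurable.integral_prod_right).measurable
  rw [← integral_pair hij (F := fun e => kernelSq ν h e.1 e.2 ^ 2)
    (hmG.pow_const 2).aestronglyMeasurable]
  congr 1; ext x; simp only [kernelSq]; ring

/-- Ordered triples of pairwise distinct indices. -/
def triples (ι : Type*) [Fintype ι] [DecidableEq ι] : Finset (ι × ι × ι) :=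
  Finset.univ.filter fun τ => τ.1 ≠ τ.2.1 ∧ τ.1 ≠ τ.2.2 ∧ τ.2.1 ≠ τ.2.2

/-- `∑ h(x_k, x_i) h(x_k, x_j)` over distinct `k, i, j`. -/
def tripleSum (h : E → E → ℝ) (x : ι → E) : ℝ :=
  ∑ τ ∈ triples ι, h (x τ.1) (x τ.2.1) * h (x τ.1) (x τ.2.2)

/-- A triple is a path with centre `k` and leaves `i`, `j`. By degeneracy a product of two such
terms has nonzero mean only if every leaf occurs in the other triple. If the centre `k` does too,
all of `k, i, j` are among the other three indices, which leaves order `N³` products, each bounded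
through fourth moments. Otherwise the leaves coincide and the paths close up to a four-cycle: order
`N⁴` products, each equal to the squared norm of `kernelSq`. -/
theorem integral_tripleSum_sq_le {h : E → E → ℝ} (hm : Measurable (Function.uncurry h))
    (hh : MemLp (Function.uncurry h) 4 (ν.prod ν)) (hdeg : ∀ x, ∫ y, h x y ∂ν = 0) :
    ∫ x : ι → E, tripleSum h x ^ 2 ∂(Measure.pi fun _ : ι => ν)
      ≤ 27 * (Fintype.card ι : ℝ) ^ 3 * ∫ e, h e.1 e.2 ^ 4 ∂(ν.prod ν)
        + 2 * (Fintype.card ι : ℝ) ^ 4 * ∫ e, kernelSq ν h e.1 e.2 ^ 2 ∂(ν.prod ν) := by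
  set B := ∫ e, h e.1 e.2 ^ 4 ∂(ν.prod ν) with hB
  set C := ∫ e, kernelSq ν h e.1 e.2 ^ 2 ∂(ν.prod ν) with hC
  have hB0 : 0 ≤ B := integral_nonneg fun _ => by positivity
  have hC0 : 0 ≤ C := integral_nonneg fun _ => by positivity
  have h01 : ∀ (p : Prop) [Decidable p], (0 : ℝ) ≤ if p then 1 else 0 := by
    intro p _; split_ifs <;> norm_num
  have h4 : Integrable (fun e => Function.uncurry h e ^ 4) (ν.prod ν) :=
    MemLp.integrable_pow_of_le (m := 4) (by exact_mod_cast hh) le_rfl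
  -- Counts the occurrences of `a` in `τ`; a product of three such counts dominates the indicator
  -- that three indices all occur in `τ`.
  let m : ι → ι × ι × ι → ℝ := fun a τ =>
    (if a = τ.1 then 1 else 0) + (if a = τ.2.1 then 1 else 0) + (if a = τ.2.2 then 1 else 0)
  have hm0 : ∀ a τ, 0 ≤ m a τ := fun a τ => by
    dsimp only [m]; apply_rules [add_nonneg, h01]
  have hm1 : ∀ a (τ : ι × ι × ι), (a = τ.1 ∨ a = τ.2.1 ∨ a = τ.2.2) → 1 ≤ m a τ := by
    intro a τ h
    have h1 := h01 (a = τ.1); have h2 := h01 (a = τ.2.1); have h3 := h01 (a = τ.2.2)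
    dsimp only [m]
    rcases h with h | h | h
    · rw [if_pos h]; linarith
    · rw [if_pos h]; linarith
    · rw [if_pos h]; linarith
  let c : ι × ι × ι → ι × ι × ι → ℝ := fun τ σ =>
    B * (m τ.1 σ * m τ.2.1 σ * m τ.2.2 σ)
    + C * ((if τ.2.1 = σ.2.1 ∧ τ.2.2 = σ.2.2 then 1 else 0)
      + (if τ.2.1 = σ.2.2 ∧ τ.2.2 = σ.2.1 then 1 else 0))
  have hc0 : ∀ τ σ, 0 ≤ c τ σ := by
    intro τ σ
    dsimp only [c]
    apply_rules [add_nonneg, mul_nonneg, h01]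
  let Y : ι × ι × ι → (ι → E) → ℝ := fun τ x => h (x τ.1) (x τ.2.1) * h (x τ.1) (x τ.2.2)
  have hYL : ∀ τ ∈ triples ι, MemLp (Y τ) 2 (Measure.pi fun _ : ι => ν) := by
    intro τ hτ
    simp only [triples, Finset.mem_filter, Finset.mem_univ, true_and] at hτ
    exact memLp_two_mul (memLp_pair hh hτ.1) (memLp_pair hh hτ.2.1)
  have hle : ∀ τ ∈ triples ι, ∀ σ ∈ triples ι,
      ∫ x, Y τ x * Y σ x ∂(Measure.pi fun _ : ι => ν) ≤ c τ σ := by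
    rintro ⟨k, i, j⟩ hτ ⟨k', i', j'⟩ hσ
    simp only [triples, Finset.mem_filter, Finset.mem_univ, true_and] at hτ hσ
    obtain ⟨hki, hkj, hij⟩ := hτ
    obtain ⟨hki', hkj', hij'⟩ := hσ
    -- An index occurring in only one of the four factors makes the expectation vanish.
    have zero : ∀ (a b : ι) (F : (ι → E) → ℝ), a ≠ b →
        (∀ x t, F (Function.update x a t) = F x) →
        ∫ x, h (x b) (x a) * F x ∂(Measure.pi fun _ : ι => ν) = 0 := by
      intro a b F hab hF
      refine integral_eq_zero_of_update a fun x => ?_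
      simp_rw [hF, integral_mul_const, Function.update_self, Function.update_of_ne hab.symm,
        hdeg, zero_mul]
    have hY : ∀ x, Y (k, i, j) x * Y (k', i', j') x
        = (h (x k) (x i) * h (x k) (x j)) * (h (x k') (x i') * h (x k') (x j')) := fun x => rfl
    simp_rw [hY]
    -- Each of the four leaves is tested in turn; an unmatched leaf disposes of the product.
    by_cases h1 : i = k' ∨ i = i' ∨ i = j'
    swap
    · push Not at h1
      rw [integral_congr_ae (g := fun x => h (x k) (x i) *
        (h (x k) (x j) * (h (x k') (x i') * h (x k') (x j'))))
        (ae_of_all _ fun x => by ring), zero i k _ hki.symm]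
      · exact hc0 _ _
      · intro x t
        simp [hki, hij.symm, h1.1.symm, h1.2.1.symm, h1.2.2.symm]
    by_cases h2 : j = k' ∨ j = i' ∨ j = j'
    swap
    · push Not at h2
      rw [integral_congr_ae (g := fun x => h (x k) (x j) *
        (h (x k) (x i) * (h (x k') (x i') * h (x k') (x j'))))
        (ae_of_all _ fun x => by ring), zero j k _ hkj.symm]
      · exact hc0 _ _
      · intro x t
        simp [hkj, hij, h2.1.symm, h2.2.1.symm, h2.2.2.symm]
    by_cases h3 : i' = k ∨ i' = i ∨ i' = j
    swap
    · push Not at h3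
      rw [integral_congr_ae (g := fun x => h (x k') (x i') *
        (h (x k') (x j') * (h (x k) (x i) * h (x k) (x j))))
        (ae_of_all _ fun x => by ring), zero i' k' _ hki'.symm]
      · exact hc0 _ _
      · intro x t
        simp [hki', hij'.symm, h3.1.symm, h3.2.1.symm, h3.2.2.symm]
    by_cases h5 : j' = k ∨ j' = i ∨ j' = j
    swap
    · push Not at h5
      rw [integral_congr_ae (g := fun x => h (x k') (x j') *
        (h (x k') (x i') * (h (x k) (x i) * h (x k) (x j))))
        (ae_of_all _ fun x => by ring), zero j' k' _ hkj'.symm]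
      · exact hc0 _ _
      · intro x t
        simp [hkj', hij', h5.1.symm, h5.2.1.symm, h5.2.2.symm]
    by_cases h6 : k = k' ∨ k = i' ∨ k = j'
    -- The centre is matched as well. The product of four factors is at most the mean of their
    -- fourth powers, each of which integrates to `B`.
    · have b1 : ∀ {a b : ι}, a ≠ b → Integrable (fun x : ι → E => h (x a) (x b) ^ 4)
          (Measure.pi fun _ : ι => ν) := fun hab =>
        integrable_pair hab (F := fun e => h e.1 e.2 ^ 4) h4
      have b2 : ∀ {a b : ι}, a ≠ b → ∫ x : ι → E, h (x a) (x b) ^ 4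
          ∂(Measure.pi fun _ : ι => ν) = B := fun hab =>
        integral_pair hab (F := fun e => h e.1 e.2 ^ 4) h4.1
      have b3 : ∫ x : ι → E, (h (x k) (x i) * h (x k) (x j)) * (h (x k') (x i') * h (x k') (x j'))
          ∂(Measure.pi fun _ : ι => ν) ≤ B := by
        have s1 : Integrable (fun x : ι → E => h (x k) (x i) ^ 4 + h (x k) (x j) ^ 4)
          (Measure.pi fun _ : ι => ν) := (b1 hki).add (b1 hkj)
        have s2 : Integrable (fun x : ι → E => h (x k') (x i') ^ 4 + h (x k') (x j') ^ 4)
          (Measure.pi fun _ : ι => ν) := (b1 hki').add (b1 hkj')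
        have s3 : Integrable (fun x : ι → E => 4⁻¹ * ((h (x k) (x i) ^ 4 + h (x k) (x j) ^ 4)
            + (h (x k') (x i') ^ 4 + h (x k') (x j') ^ 4))) (Measure.pi fun _ : ι => ν) :=
          (s1.add s2).const_mul _
        refine (integral_mono ((hYL (k, i, j) (by simp [triples, *])).integrable_mul
          (hYL (k', i', j') (by simp [triples, *]))) s3 fun x => ?_).trans (le_of_eq ?_)
        · simp only [Pi.mul_apply, Y]
          generalize h (x k) (x i) = a
          generalize h (x k) (x j) = b
          generalize h (x k') (x i') = d
          generalize h (x k') (x j') = e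
          nlinarith [sq_nonneg (a * b - d * e), sq_nonneg (a ^ 2 - b ^ 2),
            sq_nonneg (d ^ 2 - e ^ 2)]
        · rw [integral_const_mul, integral_add s1 s2, integral_add (b1 hki) (b1 hkj),
            integral_add (b1 hki') (b1 hkj'), b2 hki, b2 hkj, b2 hki', b2 hkj']
          ring
      refine b3.trans ?_
      have c1 := hm1 k (k', i', j') h6
      have c2 := hm1 i (k', i', j') h1
      have c3 := hm1 j (k', i', j') h2
      have c4 : 1 ≤ m k (k', i', j') * m i (k', i', j') * m j (k', i', j') :=
        one_le_mul_of_one_le_of_one_le (one_le_mul_of_one_le_of_one_le c1 c2) c3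
      have c5 : 0 ≤ C * ((if i = i' ∧ j = j' then (1 : ℝ) else 0)
          + (if i = j' ∧ j = i' then 1 else 0)) := by
        apply_rules [add_nonneg, mul_nonneg, h01]
      have : B * 1 ≤ B * (m k (k', i', j') * m i (k', i', j') * m j (k', i', j')) := by gcongr
      simp only [c]
      linarith
    · push Not at h6
      have d1 : 0 ≤ B * (m k (k', i', j') * m i (k', i', j') * m j (k', i', j')) := by
        apply_rules [mul_nonneg]
      -- With the centre `k` outside the other triple, the leaves `i'` and `j'` can only be matched
      -- by the leaves `i` and `j`.
      have d2 : (i = i' ∧ j = j') ∨ (i = j' ∧ j = i') := by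
        rcases h3 with h | h | h
        · exact absurd h.symm h6.2.1
        · rcases h5 with h' | h' | h'
          · exact absurd h'.symm h6.2.2
          · exact absurd (h.trans h'.symm) hij'
          · exact Or.inl ⟨h.symm, h'.symm⟩
        · rcases h5 with h' | h' | h'
          · exact absurd h'.symm h6.2.2
          · exact Or.inr ⟨h'.symm, h.symm⟩
          · exact absurd (h.trans h'.symm) hij'
      rcases d2 with ⟨rfl, rfl⟩ | ⟨rfl, rfl⟩
      · rw [integral_mul_four_eq hm hh hij hki hkj hki' hkj' h6.1]
        simp only [c, ← hC]
        have := mul_nonneg hC0 (h01 (i = j ∧ j = i))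
        simp only [and_self, if_true]
        linarith
      · rw [integral_congr_ae (g := fun x => (h (x k) (x i) * h (x k) (x j)) *
          (h (x k') (x i) * h (x k') (x j))) (ae_of_all _ fun x => by ring),
          integral_mul_four_eq hm hh hij hki hkj hkj' hki' h6.1]
        simp only [c, ← hC]
        have := mul_nonneg hC0 (h01 (i = j ∧ j = i))
        simp only [and_self, if_true]
        linarith
  have h1 := integral_sq_sum_le (P := Measure.pi fun _ : ι => ν) (triples ι) (Y := Y) (c := c)
    (fun τ hτ σ hσ => (hYL τ hτ).integrable_mul (hYL σ hσ)) hle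
  refine h1.trans ?_
  -- The triple product of counts therefore sums to `3³ = 27`.
  have hms : ∀ τ, ∑ a, m a τ = 3 := by
    intro τ
    simp only [m, Finset.sum_add_distrib, Finset.sum_ite_eq', Finset.mem_univ, if_true]
    norm_num
  calc _ ≤ ∑ τ : ι × ι × ι, ∑ σ : ι × ι × ι, c τ σ := by
        refine (Finset.sum_le_sum fun q _ => Finset.sum_le_univ_sum_of_nonneg (hc0 q)).trans ?_
        exact Finset.sum_le_univ_sum_of_nonneg fun q => Finset.sum_nonneg fun r _ => hc0 q r
    _ = ∑ σ : ι × ι × ι, ∑ τ : ι × ι × ι, c τ σ := Finset.sum_comm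
    _ = ∑ σ : ι × ι × ι, (B * 27 + C * (2 * Fintype.card ι)) := by
        refine Finset.sum_congr rfl fun σ _ => ?_
        simp only [c, Finset.sum_add_distrib, ← Finset.mul_sum]
        congr 2
        · simp_rw [Fintype.sum_prod_type, ← Finset.mul_sum, ← Finset.sum_mul, hms]
          simp_rw [← Finset.mul_sum, ← Finset.sum_mul, hms]
          norm_num
        · rw [Fintype.sum_prod_type, Fintype.sum_prod_type]
          simp [Fintype.sum_prod_type, ite_and]
          ring
    _ = _ := by
        rw [Finset.sum_const, Finset.card_univ, Fintype.card_prod, Fintype.card_prod,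
          nsmul_eq_mul]
        push_cast
        ring

end Degenerate

/-! ### A quantitative central limit theorem for degenerate kernels -/

section CharacteristicFunction

/-- For `|θ| ≤ 1` this is the quadratic Taylor estimate; otherwise the trivial bound `2 + |θ|` is
already below `3 θ²`. -/
theorem norm_cexp_sub_one_sub_le (θ : ℝ) :
    ‖Complex.exp (θ * Complex.I) - 1 - θ * Complex.I‖ ≤ 3 * θ ^ 2 := by
  have hn : ‖(θ : ℂ) * Complex.I‖ = |θ| := by simp
  rcases le_total |θ| 1 with h | h
  · have := Complex.norm_exp_sub_one_sub_id_le (x := (θ : ℂ) * Complex.I) (by rwa [hn])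
    rw [hn, sq_abs] at this
    nlinarith [sq_nonneg θ]
  · have h1 : ‖Complex.exp (θ * Complex.I) - 1 - θ * Complex.I‖ ≤ 1 + 1 + |θ| := by
      refine (norm_sub_le _ _).trans ?_
      rw [hn]
      gcongr
      refine (norm_sub_le _ _).trans ?_
      simp [Complex.norm_exp_ofReal_mul_I]
    nlinarith [sq_abs θ]

variable {ι E : Type*} [Fintype ι] [DecidableEq ι] [MeasurableSpace E]
  {ν : Measure E} [IsProbabilityMeasure ν]

theorem pairSum_eq_sum_rowSum (h : E → E → ℝ) (x : ι → E) :
    pairSum h x = ∑ k, rowSum h k x := by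
  simp only [pairSum, rowSum]
  rw [Finset.sum_sigma']
  refine Finset.sum_bij' (fun q _ => ⟨q.1, q.2⟩) (fun q _ => (q.1, q.2)) ?_ ?_ ?_ ?_ ?_ <;>
    simp +contextual [eq_comm]

/-- Squaring a row sum produces equal second indices (the pair sum of `h²`) and distinct ones (the
triples). The former carries the limiting variance, the latter is to be negligible. -/
theorem sum_rowSum_sq (h : E → E → ℝ) (x : ι → E) :
    ∑ k, rowSum h k x ^ 2 = pairSum (fun s t => h s t ^ 2) x + tripleSum h x := by
  rw [pairSum_eq_sum_rowSum]
  have : tripleSum h x = ∑ k, ∑ i ∈ Finset.univ.erase k, ∑ j ∈ (Finset.univ.erase k).erase i,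
      h (x k) (x i) * h (x k) (x j) := by
    rw [Finset.sum_sigma', Finset.sum_sigma']
    refine Finset.sum_bij' (fun q _ => ⟨⟨q.1, q.2.1⟩, q.2.2⟩) (fun q _ => (q.1.1, q.1.2, q.2))
      ?_ ?_ ?_ ?_ ?_ <;> simp +contextual [triples, eq_comm]
  rw [this, ← Finset.sum_add_distrib]
  refine Finset.sum_congr rfl fun k _ => ?_
  simp only [rowSum]
  rw [sq, Finset.sum_mul_sum, ← Finset.sum_add_distrib]
  refine Finset.sum_congr rfl fun i hi => ?_
  rw [← Finset.add_sum_erase _ _ hi, sq]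

/-- By symmetry the pairs containing `k` contribute the row sum twice, as first and as second index.
Removing both leaves a function that does not depend on coordinate `k`. -/
theorem pairSum_sub_rowSum_update {h : E → E → ℝ} (hsym : ∀ x y, h x y = h y x) (k : ι)
    (x : ι → E) (t : E) :
    pairSum h (Function.update x k t) - 2 * rowSum h k (Function.update x k t)
      = pairSum h x - 2 * rowSum h k x := by
  have key : ∀ x : ι → E, pairSum h x - 2 * rowSum h k x
      = ∑ i ∈ Finset.univ.erase k, ∑ j ∈ (Finset.univ.erase i).erase k, h (x i) (x j) := by
    intro x
    rw [pairSum_eq_sum_rowSum, ← Finset.add_sum_erase _ _ (Finset.mem_univ k)]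
    have e1 : ∑ i ∈ Finset.univ.erase k, rowSum h i x = ∑ i ∈ Finset.univ.erase k, h (x i) (x k)
        + ∑ i ∈ Finset.univ.erase k, ∑ j ∈ (Finset.univ.erase i).erase k, h (x i) (x j) := by
      rw [← Finset.sum_add_distrib]
      refine Finset.sum_congr rfl fun i hi => ?_
      have : k ∈ Finset.univ.erase i :=
        Finset.mem_erase.2 ⟨(Finset.ne_of_mem_erase hi).symm, Finset.mem_univ _⟩
      rw [rowSum, ← Finset.add_sum_erase _ _ this]
    have e2 : ∑ i ∈ Finset.univ.erase k, h (x i) (x k) = rowSum h k x :=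
      Finset.sum_congr rfl fun i _ => hsym _ _
    rw [e1, e2]; ring
  rw [key, key]
  refine Finset.sum_congr rfl fun i hi => Finset.sum_congr rfl fun j hj => ?_
  rw [Function.update_of_ne (Finset.ne_of_mem_erase hi),
    Function.update_of_ne (Finset.ne_of_mem_erase hj)]

theorem measurable_rowSum {h : E → E → ℝ} (hm : Measurable (Function.uncurry h)) (k : ι) :
    Measurable (rowSum h k) :=
  Finset.measurable_sum _ fun j _ =>
    Measurable.comp (f := fun x : ι → E => (x k, x j)) hm
      ((measurable_pi_apply k).prodMk (measurable_pi_apply j))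

theorem measurable_pairSum {h : E → E → ℝ} (hm : Measurable (Function.uncurry h)) :
    Measurable (pairSum (ι := ι) h) :=
  Finset.measurable_sum _ fun q _ =>
    Measurable.comp (f := fun x : ι → E => (x q.1, x q.2)) hm
      ((measurable_pi_apply q.1).prodMk (measurable_pi_apply q.2))

/-- The exponential is free of coordinate `k`, so resampling `k` averages each `h (x k) (x j)` to
zero by symmetry and degeneracy. -/
theorem integral_rowSum_mul_cexp_eq_zero {h : E → E → ℝ}
    (hm : Measurable (Function.uncurry h))
    (hh : MemLp (Function.uncurry h) 4 (ν.prod ν)) (hsym : ∀ x y, h x y = h y x)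
    (hdeg : ∀ x, ∫ y, h x y ∂ν = 0) (k : ι) (t : ℝ) :
    Integrable (fun x : ι → E => (rowSum h k x : ℂ) *
      Complex.exp ((t * (pairSum h x - 2 * rowSum h k x) : ℝ) * Complex.I))
      (Measure.pi fun _ : ι => ν) ∧
    ∫ x : ι → E, (rowSum h k x : ℂ) *
      Complex.exp ((t * (pairSum h x - 2 * rowSum h k x) : ℝ) * Complex.I)
      ∂(Measure.pi fun _ : ι => ν) = 0 := by
  have hmG : Measurable (fun x : ι → E =>
      Complex.exp ((t * (pairSum h x - 2 * rowSum h k x) : ℝ) * Complex.I)) := by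
    have h1 := measurable_pairSum (ι := ι) hm
    have h2 := measurable_rowSum hm k
    fun_prop
  have hint : ∀ j ∈ Finset.univ.erase k, Integrable (fun x : ι → E => (h (x k) (x j) : ℂ) *
      Complex.exp ((t * (pairSum h x - 2 * rowSum h k x) : ℝ) * Complex.I))
      (Measure.pi fun _ : ι => ν) := by
    intro j hj
    have h1 : Integrable (fun x : ι → E => (h (x k) (x j) : ℂ)) (Measure.pi fun _ : ι => ν) :=
      ((memLp_pair hh (Finset.ne_of_mem_erase hj).symm).integrable (by norm_num)).ofReal
    refine h1.mul_bdd (c := 1) hmG.aestronglyMeasurable (ae_of_all _ fun x => ?_)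
    rw [Complex.norm_exp_ofReal_mul_I]
  have e : ∀ x : ι → E, (rowSum h k x : ℂ) *
      Complex.exp ((t * (pairSum h x - 2 * rowSum h k x) : ℝ) * Complex.I)
      = ∑ j ∈ Finset.univ.erase k, (h (x k) (x j) : ℂ) *
      Complex.exp ((t * (pairSum h x - 2 * rowSum h k x) : ℝ) * Complex.I) := by
    intro x
    rw [← Finset.sum_mul]
    congr 1
    simp [rowSum]
  simp_rw [e]
  refine ⟨integrable_finsetSum _ hint, ?_⟩
  rw [integral_finsetSum _ hint]
  refine Finset.sum_eq_zero fun j hj => integral_eq_zero_of_update k fun x => ?_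
  simp_rw [pairSum_sub_rowSum_update hsym, integral_mul_const, Function.update_self,
    Function.update_of_ne (Finset.ne_of_mem_erase hj)]
  have : ∫ s, (h s (x j) : ℂ) ∂ν = 0 := by
    rw [integral_complex_ofReal]
    simp_rw [hsym _ (x j), hdeg]
    simp
  rw [this, zero_mul]

theorem hasDerivAt_integral_cexp {Ω : Type*} [MeasurableSpace Ω] {P : Measure Ω}
    [IsProbabilityMeasure P] {S : Ω → ℝ} (hm : Measurable S) (hS : Integrable S P) (t : ℝ) :
    HasDerivAt (fun t : ℝ => ∫ ω, Complex.exp ((t * S ω : ℝ) * Complex.I) ∂P)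
      (∫ ω, (S ω * Complex.I) * Complex.exp ((t * S ω : ℝ) * Complex.I) ∂P) t := by
  have hb : ∀ t : ℝ, Integrable (fun ω => Complex.exp ((t * S ω : ℝ) * Complex.I)) P := by
    intro t
    refine (integrable_const (1 : ℝ)).mono' (by fun_prop) (ae_of_all _ fun ω => ?_)
    rw [Complex.norm_exp_ofReal_mul_I]
  refine (hasDerivAt_integral_of_dominated_loc_of_deriv_le (bound := fun ω => |S ω|)
    (F' := fun t ω => (S ω * Complex.I) * Complex.exp ((t * S ω : ℝ) * Complex.I))
    (s := Set.univ) Filter.univ_mem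
    (Eventually.of_forall fun t => (hb t).1) (hb t) ?_ ?_ hS.abs ?_).2
  · exact Measurable.aestronglyMeasurable (by fun_prop)
  · refine ae_of_all _ fun ω s _ => ?_
    rw [norm_mul, Complex.norm_exp_ofReal_mul_I]
    simp
  · refine ae_of_all _ fun ω s _ => ?_
    have h1 : HasDerivAt (fun s : ℝ => ((s * S ω : ℝ) : ℂ) * Complex.I) (S ω * Complex.I) s := by
      have := (((hasDerivAt_id s).mul_const (S ω)).ofReal_comp).mul_const Complex.I
      simpa using this
    have := h1.cexp
    rwa [mul_comm] at this

/-- If a characteristic function almost satisfies the differential equation of the Gaussian one,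
then it is close to it. -/
theorem norm_sub_exp_le_of_deriv {φ φ' : ℝ → ℂ} {s a b : ℝ} (hs : 0 ≤ s) (ha : 0 ≤ a)
    (hb : 0 ≤ b) (h0 : φ 0 = 1) (hd : ∀ t, HasDerivAt φ (φ' t) t)
    (hle : ∀ t : ℝ, ‖φ' t + t * s * φ t‖ ≤ |t| * a + t ^ 2 * b) (t : ℝ) :
    ‖φ t - Complex.exp (-(s * t ^ 2 / 2 : ℝ))‖ ≤ |t| * (|t| * a + t ^ 2 * b) := by
  -- Integrating factor: the derivative of `φ e` is the defect of the equation times `e`.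
  let e : ℝ → ℂ := fun u => Complex.exp ((s * u ^ 2 / 2 : ℝ) : ℂ)
  have hed : ∀ u, HasDerivAt e (e u * (s * u : ℝ)) u := by
    intro u
    have h1 : HasDerivAt (fun u : ℝ => s * u ^ 2 / 2) (s * u) u := by
      refine (((hasDerivAt_pow 2 u).const_mul s).div_const 2).congr_deriv ?_
      norm_num; ring
    exact h1.ofReal_comp.cexp
  have hen : ∀ u, ‖e u‖ = Real.exp (s * u ^ 2 / 2) := by
    intro u
    simp only [e]
    rw [← Complex.ofReal_exp, Complex.norm_real, Real.norm_eq_abs, Real.abs_exp]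
  have hg : ∀ u, HasDerivAt (fun u => φ u * e u) ((φ' u + u * s * φ u) * e u) u := by
    intro u
    refine ((hd u).mul (hed u)).congr_deriv ?_
    push_cast; ring
  have hbd : ∀ u ∈ Set.Icc (-|t|) |t|,
      ‖(φ' u + u * s * φ u) * e u‖ ≤ (|t| * a + t ^ 2 * b) * Real.exp (s * t ^ 2 / 2) := by
    intro u hu
    have hu' : |u| ≤ |t| := abs_le.2 hu
    have hu2 : u ^ 2 ≤ t ^ 2 := sq_le_sq.2 hu'
    rw [norm_mul, hen]
    refine mul_le_mul ((hle u).trans ?_) (Real.exp_le_exp.2 ?_) (Real.exp_nonneg _) (by positivity)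
    · gcongr
    · gcongr
  -- The symmetric interval treats both signs of `t` at once. The factor `exp(s t² / 2)` in the
  -- bound is cancelled when `e t` is divided out.
  have hmv := (convex_Icc (-|t|) |t|).norm_image_sub_le_of_norm_hasDerivWithin_le
    (fun u _ => (hg u).hasDerivWithinAt) hbd (x := 0) (y := t)
    (by simp) ⟨neg_abs_le t, le_abs_self t⟩
  simp only [h0, one_mul, sub_zero, Real.norm_eq_abs] at hmv
  have he0 : e 0 = 1 := by simp [e]
  rw [he0] at hmv
  have hne : Complex.exp (-(s * t ^ 2 / 2 : ℝ)) * e t = 1 := by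
    simp only [e]
    rw [← Complex.exp_add]
    simp
  have hfac : φ t - Complex.exp (-(s * t ^ 2 / 2 : ℝ))
      = (φ t * e t - 1) * Complex.exp (-(s * t ^ 2 / 2 : ℝ)) := by
    linear_combination (-(φ t)) * hne
  have hn2 : ‖Complex.exp (-(s * t ^ 2 / 2 : ℝ))‖ = Real.exp (-(s * t ^ 2 / 2)) := by
    rw [← Complex.ofReal_neg, ← Complex.ofReal_exp, Complex.norm_real, Real.norm_eq_abs,
      Real.abs_exp]
  rw [hfac, norm_mul, hn2]
  calc _ ≤ ((|t| * a + t ^ 2 * b) * Real.exp (s * t ^ 2 / 2) * |t|)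
        * Real.exp (-(s * t ^ 2 / 2)) := by gcongr
    _ = |t| * (|t| * a + t ^ 2 * b) * (Real.exp (s * t ^ 2 / 2) * Real.exp (-(s * t ^ 2 / 2))) := by
        ring
    _ = _ := by rw [← Real.exp_add]; simp

/-- With `S = ∑ D_k`, the derivative of the characteristic function is `i ∑ E D_k exp(itS)`.
Subtracting the vanishing terms `E D_k exp(it(S - 2 D_k))` and expanding `exp(-2it D_k)` to first
order leaves `-2t ∑ D_k² exp(itS)`, with remainder at most `12 t² ∑ |D_k|³`. Replacing `2 ∑ D_k²` by
the constant `s` costs `|t| a`, and the perturbed Gaussian equation is then integrated. -/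
theorem norm_integral_cexp_pairSum_sub_le {h : E → E → ℝ}
    (hm : Measurable (Function.uncurry h))
    (hh : MemLp (Function.uncurry h) 4 (ν.prod ν)) (hsym : ∀ x y, h x y = h y x)
    (hdeg : ∀ x, ∫ y, h x y ∂ν = 0) {s a b : ℝ} (hs : 0 ≤ s)
    (ha : ∫ x : ι → E, |2 * ∑ k, rowSum h k x ^ 2 - s| ∂(Measure.pi fun _ : ι => ν) ≤ a)
    (hb : ∑ k : ι, ∫ x : ι → E, |rowSum h k x| ^ 3 ∂(Measure.pi fun _ : ι => ν) ≤ b) (t : ℝ) :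
    ‖(∫ x : ι → E, Complex.exp ((t * pairSum h x : ℝ) * Complex.I)
        ∂(Measure.pi fun _ : ι => ν)) - Complex.exp (-(s * t ^ 2 / 2 : ℝ))‖
      ≤ |t| * (|t| * a + t ^ 2 * (12 * b)) := by
  set μ := (Measure.pi fun _ : ι => ν) with hμ
  have hmS := measurable_pairSum (ι := ι) hm
  have hmD := fun k : ι => measurable_rowSum hm k
  have hLD : ∀ k : ι, MemLp (fun x : ι → E => rowSum h k x) 4 μ := fun k =>
    memLp_finsetSum _ fun j hj => memLp_pair hh (Finset.ne_of_mem_erase hj).symm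
  have hLD' : ∀ k : ι, MemLp (fun x : ι → E => rowSum h k x) (4 : ℕ) μ := fun k => by
    exact_mod_cast hLD k
  have hiS : Integrable (pairSum (ι := ι) h) μ := by
    refine integrable_finsetSum _ fun q hq => ?_
    exact (memLp_pair hh (by simpa using hq)).integrable (by norm_num)
  have ha0 : 0 ≤ a := le_trans (integral_nonneg fun _ => abs_nonneg _) ha
  have hb0 : 0 ≤ b :=
    le_trans (Finset.sum_nonneg fun k _ => integral_nonneg fun _ => by positivity) hb
  have hQ : Integrable (fun x : ι → E => ∑ k, rowSum h k x ^ 2) μ :=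
    integrable_finsetSum _ fun k _ => MemLp.integrable_pow_of_le (hLD' k) (by norm_num)
  have hD3 : ∀ k : ι, Integrable (fun x : ι → E => |rowSum h k x| ^ 3) μ := fun k => by
    have := (MemLp.integrable_pow_of_le (hLD' k) (show 3 ≤ 4 by norm_num)).abs
    simpa only [abs_pow] using this
  refine norm_sub_exp_le_of_deriv hs ha0 (by positivity) (by simp)
    (fun t => hasDerivAt_integral_cexp hmS hiS t) (fun t => ?_) t
  have hz := fun k : ι => integral_rowSum_mul_cexp_eq_zero (ν := ν) hm hh hsym hdeg k t
  have hie : Integrable (fun x : ι → E => Complex.exp ((t * pairSum h x : ℝ) * Complex.I)) μ := by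
    refine (integrable_const (1 : ℝ)).mono' (by fun_prop) (ae_of_all _ fun ω => ?_)
    rw [Complex.norm_exp_ofReal_mul_I]
  have hiSe : Integrable (fun x : ι → E => (pairSum h x * Complex.I)
      * Complex.exp ((t * pairSum h x : ℝ) * Complex.I)) μ := by
    refine (hiS.ofReal.mul_const Complex.I).mul_bdd (c := 1) (by fun_prop)
      (ae_of_all _ fun ω => ?_)
    rw [Complex.norm_exp_ofReal_mul_I]
  have hiZ : Integrable (fun x : ι → E => ∑ k, Complex.I * ((rowSum h k x : ℂ) *
      Complex.exp ((t * (pairSum h x - 2 * rowSum h k x) : ℝ) * Complex.I))) μ :=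
    integrable_finsetSum _ fun k _ => (hz k).1.const_mul _
  have hZ : ∫ x : ι → E, ∑ k, Complex.I * ((rowSum h k x : ℂ) *
      Complex.exp ((t * (pairSum h x - 2 * rowSum h k x) : ℝ) * Complex.I)) ∂μ = 0 := by
    rw [integral_finsetSum _ fun k _ => (hz k).1.const_mul _]
    refine Finset.sum_eq_zero fun k _ => ?_
    rw [integral_const_mul, (hz k).2, mul_zero]
  -- The subtracted sum has integral zero, so it may be inserted for free.
  have hsplit : (∫ x : ι → E, (pairSum h x * Complex.I)
        * Complex.exp ((t * pairSum h x : ℝ) * Complex.I) ∂μ)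
      + t * s * (∫ x : ι → E, Complex.exp ((t * pairSum h x : ℝ) * Complex.I) ∂μ)
      = ∫ x : ι → E, ((pairSum h x * Complex.I)
        * Complex.exp ((t * pairSum h x : ℝ) * Complex.I)
        - ∑ k, Complex.I * ((rowSum h k x : ℂ) *
      Complex.exp ((t * (pairSum h x - 2 * rowSum h k x) : ℝ) * Complex.I))
        + t * s * Complex.exp ((t * pairSum h x : ℝ) * Complex.I)) ∂μ := by
    have hi1 : Integrable (fun x : ι → E => (pairSum h x * Complex.I)
        * Complex.exp ((t * pairSum h x : ℝ) * Complex.I)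
        - ∑ k, Complex.I * ((rowSum h k x : ℂ) *
      Complex.exp ((t * (pairSum h x - 2 * rowSum h k x) : ℝ) * Complex.I))) μ := hiSe.sub hiZ
    rw [integral_add hi1 (hie.const_mul _), integral_sub hiSe hiZ, hZ, sub_zero,
      integral_const_mul]
  rw [hsplit]
  have hbound : ∀ x : ι → E, ‖(pairSum h x * Complex.I)
        * Complex.exp ((t * pairSum h x : ℝ) * Complex.I)
        - ∑ k, Complex.I * ((rowSum h k x : ℂ) *
      Complex.exp ((t * (pairSum h x - 2 * rowSum h k x) : ℝ) * Complex.I))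
        + t * s * Complex.exp ((t * pairSum h x : ℝ) * Complex.I)‖
      ≤ |t| * |2 * ∑ k, rowSum h k x ^ 2 - s| + ∑ k, 12 * t ^ 2 * |rowSum h k x| ^ 3 := by
    intro x
    set eS := Complex.exp ((t * pairSum h x : ℝ) * Complex.I) with heS
    have heSn : ‖eS‖ = 1 := Complex.norm_exp_ofReal_mul_I _
    have hek : ∀ k, Complex.exp ((t * (pairSum h x - 2 * rowSum h k x) : ℝ) * Complex.I)
        = eS * Complex.exp ((-(2 * t * rowSum h k x) : ℝ) * Complex.I) := by
      intro k
      rw [heS, ← Complex.exp_add]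
      congr 1; push_cast; ring
    -- Second-order Taylor remainder; the `12` is `3 · 2²` from the argument `2 t D_k`.
    let ρ : ι → ℂ := fun k => Complex.exp ((-(2 * t * rowSum h k x) : ℝ) * Complex.I) - 1
      - (-(2 * t * rowSum h k x) : ℝ) * Complex.I
    have hρ : ∀ k, ‖ρ k‖ ≤ 12 * t ^ 2 * rowSum h k x ^ 2 := by
      intro k
      refine (norm_cexp_sub_one_sub_le _).trans (le_of_eq ?_)
      ring
    have hid : (pairSum h x * Complex.I) * eS
        - ∑ k, Complex.I * ((rowSum h k x : ℂ) *
          Complex.exp ((t * (pairSum h x - 2 * rowSum h k x) : ℝ) * Complex.I))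
        + t * s * eS
        = -((t * (2 * ∑ k, rowSum h k x ^ 2 - s) : ℝ) : ℂ) * eS
          - ∑ k, Complex.I * rowSum h k x * eS * ρ k := by
      have e1 : ∀ k, Complex.I * ((rowSum h k x : ℂ) *
          Complex.exp ((t * (pairSum h x - 2 * rowSum h k x) : ℝ) * Complex.I))
          = Complex.I * rowSum h k x * eS * ρ k + (rowSum h k x) * (Complex.I * eS)
            + (rowSum h k x : ℂ) ^ 2 * (2 * t * eS) := by
        intro k
        rw [hek]
        simp only [ρ]
        push_cast
        linear_combination (-2 * t * (rowSum h k x : ℂ) ^ 2 * eS) * (Complex.I_sq)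
      simp_rw [e1, Finset.sum_add_distrib, ← Finset.sum_mul]
      rw [pairSum_eq_sum_rowSum]
      push_cast
      ring
    rw [hid]
    refine (norm_sub_le _ _).trans (add_le_add (le_of_eq ?_) ?_)
    · rw [norm_mul, norm_neg, heSn, mul_one, Complex.norm_real, Real.norm_eq_abs, abs_mul]
    · refine (norm_sum_le _ _).trans (Finset.sum_le_sum fun k _ => ?_)
      rw [norm_mul, norm_mul, norm_mul, heSn, Complex.norm_I, Complex.norm_real, one_mul, mul_one,
        Real.norm_eq_abs]
      calc |rowSum h k x| * ‖ρ k‖ ≤ |rowSum h k x| * (12 * t ^ 2 * rowSum h k x ^ 2) := by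
            gcongr; exact hρ k
        _ = _ := by rw [← sq_abs (rowSum h k x)]; ring
  have hi2 : Integrable (fun x : ι → E => |t| * |2 * ∑ k, rowSum h k x ^ 2 - s|) μ :=
    ((hQ.const_mul 2).sub (integrable_const s)).abs.const_mul _
  have hi3 : Integrable (fun x : ι → E => ∑ k, 12 * t ^ 2 * |rowSum h k x| ^ 3) μ :=
    integrable_finsetSum _ fun k _ => (hD3 k).const_mul _
  refine (norm_integral_le_of_norm_le (hi2.add hi3) (ae_of_all _ hbound)).trans ?_
  simp only [Pi.add_apply]
  rw [integral_add hi2 hi3, integral_const_mul,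
    integral_finsetSum _ fun k _ => (hD3 k).const_mul _]
  simp_rw [integral_const_mul]
  rw [← Finset.mul_sum]
  have : 12 * t ^ 2 * ∑ k : ι, ∫ x, |rowSum h k x| ^ 3 ∂μ ≤ 12 * t ^ 2 * b := by gcongr
  have h2 : |t| * ∫ x, |2 * ∑ k, rowSum h k x ^ 2 - s| ∂μ ≤ |t| * a := by gcongr
  linarith

end CharacteristicFunction

/-! ### Explicit error terms and the passage to the limit -/

section DegenerateCLT

theorem integral_abs_le_sqrt {Ω : Type*} [MeasurableSpace Ω] {P : Measure Ω}
    [IsProbabilityMeasure P] {f : Ω → ℝ} (hf : MemLp f 2 P) :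
    ∫ ω, |f ω| ∂P ≤ √(∫ ω, f ω ^ 2 ∂P) := by
  apply Real.le_sqrt_of_sq_le
  have := sq_integral_le_integral_sq hf.abs
  simpa only [Pi.abs_apply, sq_abs] using this

variable {ι E : Type*} [Fintype ι] [DecidableEq ι] [MeasurableSpace E]
  {ν : Measure E} [IsProbabilityMeasure ν]

theorem pairSum_sub_const (F : E → E → ℝ) (A : ℝ) (x : ι → E) :
    pairSum (fun s t => F s t - A) x
      = pairSum F x - Fintype.card ι * (Fintype.card ι - 1) * A := by
  simp only [pairSum, Finset.sum_sub_distrib, Finset.sum_const, Finset.offDiag_card,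
    Finset.card_univ, nsmul_eq_mul]
  rw [Nat.cast_sub (Nat.le_mul_self _)]
  push_cast; ring

theorem memLp_sq_of_memLp_four {Ω : Type*} [MeasurableSpace Ω] {P : Measure Ω}
    [IsFiniteMeasure P] {f : Ω → ℝ} (hf : MemLp f 4 P) : MemLp (fun ω => f ω ^ 2) 2 P := by
  simpa only [sq] using memLp_two_mul hf hf

/-- The fluctuation of `∑ D_k²` is the pair sum of the centred `h²` plus the triple sum; both are
controlled in `L²`, hence in `L¹`. The last summand is the deterministic error between the mean of
`2 ∑ D_k²` and `s`. -/
theorem integral_abs_sum_rowSum_sq_sub_le [Nonempty ι] {h : E → E → ℝ}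
    (hm : Measurable (Function.uncurry h))
    (hh : MemLp (Function.uncurry h) 4 (ν.prod ν)) (hsym : ∀ x y, h x y = h y x)
    (hdeg : ∀ x, ∫ y, h x y ∂ν = 0) (s : ℝ) :
    ∫ x : ι → E, |2 * ∑ k, rowSum h k x ^ 2 - s| ∂(Measure.pi fun _ : ι => ν)
      ≤ 2 * √(66 * (Fintype.card ι : ℝ) ^ 3 * ∫ e, h e.1 e.2 ^ 4 ∂(ν.prod ν)
          + 4 * (Fintype.card ι : ℝ) ^ 4 * ∫ e, kernelSq ν h e.1 e.2 ^ 2 ∂(ν.prod ν))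
        + |2 * (Fintype.card ι * (Fintype.card ι - 1) * ∫ e, h e.1 e.2 ^ 2 ∂(ν.prod ν)) - s| := by
  set μ := (Measure.pi fun _ : ι => ν) with hμ
  set N := (Fintype.card ι : ℝ) with hN
  have hN1 : 1 ≤ N := by rw [hN]; exact_mod_cast Fintype.card_pos
  set A := ∫ e, h e.1 e.2 ^ 2 ∂(ν.prod ν) with hA
  set B := ∫ e, h e.1 e.2 ^ 4 ∂(ν.prod ν) with hB
  set C := ∫ e, kernelSq ν h e.1 e.2 ^ 2 ∂(ν.prod ν) with hC
  have hB0 : 0 ≤ B := integral_nonneg fun _ => by positivity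
  let F : E → E → ℝ := fun s t => h s t ^ 2 - A
  have hsq2 : MemLp (fun e : E × E => h e.1 e.2 ^ 2) 2 (ν.prod ν) := memLp_sq_of_memLp_four hh
  have hF : MemLp (Function.uncurry F) 2 (ν.prod ν) := hsq2.sub (memLp_const A)
  have h4 : Integrable (fun e : E × E => h e.1 e.2 ^ 4) (ν.prod ν) :=
    MemLp.integrable_pow_of_le (m := 4) (f := Function.uncurry h) (by exact_mod_cast hh) le_rfl
  have hF0 : ∫ e, F e.1 e.2 ∂(ν.prod ν) = 0 := by
    simp only [F]
    rw [integral_sub (hsq2.integrable (by norm_num)) (integrable_const A)]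
    simp [hA]
  have hFB : ∫ e, F e.1 e.2 ^ 2 ∂(ν.prod ν) ≤ B := by
    have e : ∀ e : E × E, F e.1 e.2 ^ 2 = h e.1 e.2 ^ 4 - 2 * A * h e.1 e.2 ^ 2 + A ^ 2 := by
      intro e; simp only [F]; ring
    have i1 : Integrable (fun e : E × E => h e.1 e.2 ^ 4 - 2 * A * h e.1 e.2 ^ 2) (ν.prod ν) :=
      h4.sub ((hsq2.integrable (by norm_num)).const_mul _)
    simp_rw [e]
    rw [integral_add i1 (integrable_const _),
      integral_sub h4 ((hsq2.integrable (by norm_num)).const_mul _), integral_const_mul, ← hA,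
      ← hB]
    simp only [integral_const, probReal_univ, one_smul]
    nlinarith [sq_nonneg A]
  have hF1 := integral_sq_integral_le hF
  have hP := integral_pairSum_sq_le (ι := ι) hF (fun x y => by simp only [F]; rw [hsym x y]) hF0
  have hT := integral_tripleSum_sq_le (ι := ι) hm hh hdeg
  rw [← hμ, ← hN] at hP hT
  rw [← hB, ← hC] at hT
  have hPL : MemLp (pairSum (ι := ι) F) 2 μ :=
    memLp_finsetSum _ fun q hq => memLp_pair hF (by simpa using hq)
  have hTL : MemLp (tripleSum (ι := ι) h) 2 μ := by
    refine memLp_finsetSum _ fun τ hτ => ?_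
    simp only [triples, Finset.mem_filter, Finset.mem_univ, true_and] at hτ
    exact memLp_two_mul (memLp_pair hh hτ.1) (memLp_pair hh hτ.2.1)
  have hid : ∀ x : ι → E, ∑ k, rowSum h k x ^ 2 - N * (N - 1) * A = pairSum F x + tripleSum h x := by
    intro x
    rw [sum_rowSum_sq, pairSum_sub_const (fun s t => h s t ^ 2) A x]
    ring
  have hL : MemLp (fun x : ι → E => pairSum F x + tripleSum h x) 2 μ := hPL.add hTL
  have hE : ∫ x : ι → E, (pairSum F x + tripleSum h x) ^ 2 ∂μ
      ≤ 66 * N ^ 3 * B + 4 * N ^ 4 * C := by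
    have i1 : Integrable (fun x : ι → E => 2 * pairSum F x ^ 2) μ := hPL.integrable_sq.const_mul 2
    have i2 : Integrable (fun x : ι → E => 2 * tripleSum h x ^ 2) μ :=
      hTL.integrable_sq.const_mul 2
    calc _ ≤ ∫ x : ι → E, (2 * pairSum F x ^ 2 + 2 * tripleSum h x ^ 2) ∂μ :=
          integral_mono hL.integrable_sq (i1.add i2) fun x => by
            simp only; nlinarith [sq_nonneg (pairSum F x - tripleSum h x)]
      _ = 2 * ∫ x : ι → E, pairSum F x ^ 2 ∂μ + 2 * ∫ x : ι → E, tripleSum h x ^ 2 ∂μ := by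
          rw [integral_add i1 i2, integral_const_mul, integral_const_mul]
      -- With `N² ≤ N³` the coefficients `4 + 8 + 54` add up to the `66` of the statement.
      _ ≤ 2 * (2 * N ^ 2 * B + 4 * N ^ 3 * B) + 2 * (27 * N ^ 3 * B + 2 * N ^ 4 * C) := by
          gcongr
          refine hP.trans ?_
          have hF2 : 0 ≤ ∫ e, F e.1 e.2 ^ 2 ∂(ν.prod ν) := integral_nonneg fun _ => sq_nonneg _
          gcongr
          exact hF1.trans hFB
      _ ≤ _ := by
          have : N ^ 2 * B ≤ N ^ 3 * B := by
            gcongr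
            · norm_num
          nlinarith
  have hi : Integrable (fun x : ι → E => |pairSum F x + tripleSum h x|) μ :=
    (hL.integrable (by norm_num)).abs
  have hsplit : ∀ x : ι → E, |2 * ∑ k, rowSum h k x ^ 2 - s|
      ≤ 2 * |pairSum F x + tripleSum h x| + |2 * (N * (N - 1) * A) - s| := by
    intro x
    rw [← hid]
    calc _ = |2 * (∑ k, rowSum h k x ^ 2 - N * (N - 1) * A) + (2 * (N * (N - 1) * A) - s)| := by
          congr 1; ring
      _ ≤ _ := (abs_add_le _ _).trans (by rw [abs_mul, abs_two])
  refine (integral_mono_of_nonneg (ae_of_all _ fun x => abs_nonneg _)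
    ((hi.const_mul 2).add (integrable_const _)) (ae_of_all _ hsplit)).trans ?_
  simp only [Pi.add_apply]
  rw [integral_add (hi.const_mul 2) (integrable_const _), integral_const_mul]
  simp only [integral_const, probReal_univ, one_smul]
  gcongr
  exact (integral_abs_le_sqrt hL).trans (Real.sqrt_le_sqrt hE)

/-- The pointwise inequality `y³ ≤ δ y² + δ⁻¹ y⁴` for `y ≥ 0` interpolates the third moment between
the second and the fourth, with a free parameter to be balanced later. -/
theorem integral_abs_rowSum_cube_le {h : E → E → ℝ} (hm : Measurable (Function.uncurry h))
    (hh : MemLp (Function.uncurry h) 4 (ν.prod ν)) (hdeg : ∀ x, ∫ y, h x y ∂ν = 0) (k : ι)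
    {u δ : ℝ} (hδ : 0 < δ)
    (hu : momentConst 2 * (Fintype.card ι : ℝ) ^ 2 * ∫ e, h e.1 e.2 ^ 4 ∂(ν.prod ν) ≤ u) :
    ∫ x : ι → E, |rowSum h k x| ^ 3 ∂(Measure.pi fun _ : ι => ν) ≤ δ * √u + δ⁻¹ * u := by
  set μ := (Measure.pi fun _ : ι => ν) with hμ
  have hL : MemLp (fun x : ι → E => rowSum h k x) 4 μ :=
    memLp_finsetSum _ fun j hj => memLp_pair hh (Finset.ne_of_mem_erase hj).symm
  have h4 : Integrable (fun x : ι → E => rowSum h k x ^ 4) μ :=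
    MemLp.integrable_pow_of_le (m := 4) (by exact_mod_cast hL) le_rfl
  have hL2 := memLp_sq_of_memLp_four hL
  have h2 : Integrable (fun x : ι → E => rowSum h k x ^ 2) μ := hL2.integrable (by norm_num)
  have hE4 : ∫ x : ι → E, rowSum h k x ^ 4 ∂μ ≤ u :=
    (integral_rowSum_pow_four_le hm hh hdeg k).trans hu
  have hE2 : ∫ x : ι → E, rowSum h k x ^ 2 ∂μ ≤ √u := by
    apply Real.le_sqrt_of_sq_le
    refine (sq_integral_le_integral_sq hL2).trans (le_trans (le_of_eq ?_) hE4)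
    congr 1; ext x; ring
  refine (integral_mono_of_nonneg (ae_of_all _ fun x => by positivity)
    ((h2.const_mul δ).add (h4.const_mul δ⁻¹)) (ae_of_all _ fun x => ?_)).trans ?_
  · simp only [Pi.add_apply]
    have e2 : rowSum h k x ^ 2 = |rowSum h k x| ^ 2 := (sq_abs _).symm
    have e4 : rowSum h k x ^ 4 = |rowSum h k x| ^ 4 := by rw [Even.pow_abs (by decide)]
    rw [e2, e4]
    generalize hy : |rowSum h k x| = y
    have hy0 : 0 ≤ y := hy ▸ abs_nonneg _
    have : δ * y ^ 2 + δ⁻¹ * y ^ 4 - y ^ 3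
        = δ⁻¹ * y ^ 2 * ((δ - y / 2) ^ 2 + 3 / 4 * y ^ 2) := by
      field_simp; ring
    have h3 : 0 ≤ δ⁻¹ * y ^ 2 * ((δ - y / 2) ^ 2 + 3 / 4 * y ^ 2) := by positivity
    linarith
  · simp only [Pi.add_apply]
    rw [integral_add (h2.const_mul δ) (h4.const_mul δ⁻¹), integral_const_mul, integral_const_mul]
    gcongr

/-- **Central limit theorem for degenerate quadratic statistics** of triangular arrays, in terms of
characteristic functions. -/
theorem tendsto_integral_cexp_pairSum {E : ℕ → Type*} [∀ n, MeasurableSpace (E n)]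
    {ν : ∀ n, Measure (E n)} [∀ n, IsProbabilityMeasure (ν n)] {h : ∀ n, E n → E n → ℝ}
    (hm : ∀ n, Measurable (Function.uncurry (h n)))
    (hh : ∀ n, MemLp (Function.uncurry (h n)) 4 ((ν n).prod (ν n)))
    (hsym : ∀ n x y, h n x y = h n y x) (hdeg : ∀ n x, ∫ y, h n x y ∂(ν n) = 0) {s b : ℝ}
    (hs : 0 ≤ s)
    (hB : ∀ᶠ n : ℕ in atTop, (n : ℝ) ^ 4 * ∫ e, h n e.1 e.2 ^ 4 ∂((ν n).prod (ν n)) ≤ b)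
    (hC : Tendsto (fun n : ℕ => (n : ℝ) ^ 4 *
      ∫ e, kernelSq (ν n) (h n) e.1 e.2 ^ 2 ∂((ν n).prod (ν n))) atTop (𝓝 0))
    (hA : Tendsto (fun n : ℕ => 2 * ((n : ℝ) * (n - 1) *
      ∫ e, h n e.1 e.2 ^ 2 ∂((ν n).prod (ν n)))) atTop (𝓝 s)) (t : ℝ) :
    Tendsto (fun n : ℕ => ∫ x : Fin n → E n, Complex.exp ((t * pairSum (h n) x : ℝ) * Complex.I)
      ∂(Measure.pi fun _ => ν n)) atTop (𝓝 (Complex.exp (-(s * t ^ 2 / 2 : ℝ)))) := by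
  rw [tendsto_iff_norm_sub_tendsto_zero]
  let κ := momentConst 2 * b
  have hbound : ∀ᶠ n : ℕ in atTop, ‖(∫ x : Fin n → E n,
      Complex.exp ((t * pairSum (h n) x : ℝ) * Complex.I) ∂(Measure.pi fun _ => ν n))
        - Complex.exp (-(s * t ^ 2 / 2 : ℝ))‖
      ≤ |t| * (|t| * (2 * √(66 * b * (n : ℝ)⁻¹ + 4 * ((n : ℝ) ^ 4 *
          ∫ e, kernelSq (ν n) (h n) e.1 e.2 ^ 2 ∂((ν n).prod (ν n))))
        + |2 * ((n : ℝ) * (n - 1) * ∫ e, h n e.1 e.2 ^ 2 ∂((ν n).prod (ν n))) - s|)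
        + t ^ 2 * (12 * ((√κ + κ) * √((n : ℝ)⁻¹)))) := by
    filter_upwards [hB, eventually_gt_atTop 0] with n hn hn0
    have hn0' : (0 : ℝ) < n := by exact_mod_cast hn0
    have : Nonempty (Fin n) := ⟨⟨0, hn0⟩⟩
    set B := ∫ e, h n e.1 e.2 ^ 4 ∂((ν n).prod (ν n)) with hBdef
    have hB0 : 0 ≤ B := integral_nonneg fun _ => by positivity
    have hb0 : 0 ≤ b := le_trans (by positivity) hn
    have h1 := integral_abs_sum_rowSum_sq_sub_le (ι := Fin n) (hm n) (hh n) (hsym n) (hdeg n) s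
    rw [Fintype.card_fin] at h1
    have hu : momentConst 2 * (Fintype.card (Fin n) : ℝ) ^ 2 * B ≤ κ * (n : ℝ)⁻¹ ^ 2 := by
      rw [Fintype.card_fin]
      have hC := momentConst_pos 2
      calc momentConst 2 * (n : ℝ) ^ 2 * B = momentConst 2 * (n ^ 4 * B) * (n : ℝ)⁻¹ ^ 2 := by
            field_simp
        _ ≤ _ := mul_le_mul_of_nonneg_right (mul_le_mul_of_nonneg_left hn hC.le) (by positivity)
    -- The fourth moment of a row sum is of order `n⁻²`, so `δ = n^(-1/2)` makes both parts of the
    -- cubic bound of order `n^(-3/2)`; summing over `n` rows leaves `n^(-1/2)`.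
    have hδ : 0 < √((n : ℝ)⁻¹) := Real.sqrt_pos.2 (by positivity)
    have h2 : ∑ k : Fin n, ∫ x : Fin n → E n, |rowSum (h n) k x| ^ 3
        ∂(Measure.pi fun _ : Fin n => ν n) ≤ (√κ + κ) * √((n : ℝ)⁻¹) := by
      refine (Finset.sum_le_sum fun k _ =>
        integral_abs_rowSum_cube_le (hm n) (hh n) (hdeg n) k hδ hu).trans (le_of_eq ?_)
      rw [Finset.sum_const, Finset.card_univ, Fintype.card_fin, nsmul_eq_mul]
      have hκ0 : 0 ≤ κ := mul_nonneg (momentConst_pos 2).le hb0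
      rw [Real.sqrt_mul hκ0, Real.sqrt_sq (by positivity)]
      have e1 : (√((n : ℝ)⁻¹))⁻¹ * (n : ℝ)⁻¹ = √((n : ℝ)⁻¹) := by
        rw [inv_mul_eq_iff_eq_mul₀ hδ.ne']
        exact (Real.mul_self_sqrt (by positivity)).symm
      have e2 : (n : ℝ) * (n : ℝ)⁻¹ = 1 := mul_inv_cancel₀ hn0'.ne'
      linear_combination (√((n : ℝ)⁻¹) * √κ + κ * ((√((n : ℝ)⁻¹))⁻¹ * (n : ℝ)⁻¹)) * e2 + κ * e1
    refine (norm_integral_cexp_pairSum_sub_le (hm n) (hh n) (hsym n) (hdeg n) hs h1 h2 t).trans ?_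
    have e3 : 66 * (n : ℝ) ^ 3 * B ≤ 66 * b * (n : ℝ)⁻¹ := by
      calc 66 * (n : ℝ) ^ 3 * B = 66 * (n ^ 4 * B) * (n : ℝ)⁻¹ := by field_simp
        _ ≤ _ := by gcongr
    gcongr |t| * (|t| * (2 * √(?_) + _) + _)
    rw [← mul_assoc 4]
    linarith
  have hinv : Tendsto (fun n : ℕ => (n : ℝ)⁻¹) atTop (𝓝 0) := tendsto_inv_atTop_nhds_zero_nat
  have hlim : Tendsto (fun n : ℕ => |t| * (|t| * (2 * √(66 * b * (n : ℝ)⁻¹ + 4 * ((n : ℝ) ^ 4 *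
          ∫ e, kernelSq (ν n) (h n) e.1 e.2 ^ 2 ∂((ν n).prod (ν n))))
        + |2 * ((n : ℝ) * (n - 1) * ∫ e, h n e.1 e.2 ^ 2 ∂((ν n).prod (ν n))) - s|)
        + t ^ 2 * (12 * ((√κ + κ) * √((n : ℝ)⁻¹))))) atTop (𝓝 0) := by
    have l1 := (Real.continuous_sqrt.tendsto _).comp
      ((hinv.const_mul (66 * b)).add (hC.const_mul 4))
    have l2 := (hA.sub_const s).abs
    have l3 := (Real.continuous_sqrt.tendsto _).comp hinv
    have := (((l1.const_mul 2).add l2).const_mul |t|).add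
      (((l3.const_mul (√κ + κ)).const_mul 12).const_mul (t ^ 2))
    have := this.const_mul |t|
    simpa using this
  exact squeeze_zero' (Eventually.of_forall fun _ => norm_nonneg _) hbound hlim

end DegenerateCLT

/-! ### Linear, bilinear and quadratic forms in independent standardized variables -/

section Forms

/-- The square of the Frobenius norm. -/
def frobSq {m n : Type*} [Fintype m] [Fintype n] (A : Matrix m n ℝ) : ℝ := ∑ i, ∑ j, A i j ^ 2

theorem frobSq_nonneg {m n : Type*} [Fintype m] [Fintype n] (A : Matrix m n ℝ) : 0 ≤ frobSq A :=
  Finset.sum_nonneg fun _ _ => Finset.sum_nonneg fun _ _ => sq_nonneg _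

theorem memLp_mul_prod {α β : Type*} [MeasurableSpace α] [MeasurableSpace β] {μ : Measure α}
    {ν : Measure β} [IsFiniteMeasure μ] [IsFiniteMeasure ν] {f : α → ℝ} {g : β → ℝ} {r : ℕ}
    (hf : MemLp f ((2 * r : ℕ) : ℝ≥0∞) μ) (hg : MemLp g ((2 * r : ℕ) : ℝ≥0∞) ν) :
    MemLp (fun e : α × β => f e.1 * g e.2) ((2 * r : ℕ) : ℝ≥0∞) (μ.prod ν) := by
  refine memLp_of_integrable_even_pow (hf.1.comp_fst.mul hg.1.comp_snd) ?_
  have := (MemLp.integrable_pow_of_le hf le_rfl).mul_prod (MemLp.integrable_pow_of_le hg le_rfl)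
  refine this.congr (ae_of_all _ fun e => ?_)
  simp only [Pi.mul_apply, mul_pow]

variable {ι : Type*} [Fintype ι] [DecidableEq ι] {ρ : Measure ℝ} [IsProbabilityMeasure ρ]

/-- The even moments of order at most `2 * r` are finite and at most `κ`; the mean vanishes. -/
structure MomentBound (ρ : Measure ℝ) (r : ℕ) (κ : ℝ) : Prop where
  one_le : 1 ≤ κ
  memLp : MemLp (fun x : ℝ => x) ((2 * r : ℕ) : ℝ≥0∞) ρ
  mean : ∫ x, x ∂ρ = 0
  moment : ∀ k ≤ r, ∫ x, x ^ (2 * k) ∂ρ ≤ κ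

/-- The constant in the moment bounds for linear forms. -/
def formConst (r : ℕ) (κ : ℝ) : ℝ := momentConst r * κ ^ r

theorem MomentBound.formConst_pos {r : ℕ} {κ : ℝ} (h : MomentBound ρ r κ) :
    0 < formConst r κ :=
  mul_pos (momentConst_pos r) (pow_pos (by linarith [h.one_le]) r)

theorem MomentBound.memLp_coord {r : ℕ} {κ : ℝ} (h : MomentBound ρ r κ) (a : ι) :
    MemLp (fun z : ι → ℝ => z a) ((2 * r : ℕ) : ℝ≥0∞) (Measure.pi fun _ : ι => ρ) :=
  h.memLp.comp_measurePreserving (measurePreserving_eval (fun _ : ι => ρ) a)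

theorem MomentBound.memLp_dotProduct {r : ℕ} {κ : ℝ} (h : MomentBound ρ r κ) (u : ι → ℝ) :
    MemLp (fun z : ι → ℝ => u ⬝ᵥ z) ((2 * r : ℕ) : ℝ≥0∞) (Measure.pi fun _ : ι => ρ) :=
  memLp_finsetSum _ fun a _ => (h.memLp_coord a).const_mul (u a)

/-- The even-moment bound with variance proxies `u a ^ 2`: the estimate depends on the coefficients
only through their Euclidean norm. -/
theorem MomentBound.integral_dotProduct_pow_le {r : ℕ} {κ : ℝ} (h : MomentBound ρ r κ)
    (u : ι → ℝ) :
    ∫ z : ι → ℝ, (u ⬝ᵥ z) ^ (2 * r) ∂(Measure.pi fun _ : ι => ρ)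
      ≤ formConst r κ * (∑ a, u a ^ 2) ^ r := by
  have hind : iIndepFun (fun (a : ι) (z : ι → ℝ) => u a * z a) (Measure.pi fun _ => ρ) :=
    iIndepFun_pi (X := fun a x => u a * x) fun a => (measurable_const_mul _).aemeasurable
  have hpow : ∀ (a : ι) (m : ℕ), ∫ z : ι → ℝ, (u a * z a) ^ m ∂(Measure.pi fun _ : ι => ρ)
      = u a ^ m * ∫ x, x ^ m ∂ρ := fun a m => by
    simp_rw [mul_pow, integral_const_mul]
    rw [integral_coord a (F := fun x : ℝ => x ^ m) (by fun_prop)]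
  have := integral_sum_even_pow_le hind (fun a => by fun_prop)
    (fun a => by simpa [h.mean] using hpow a 1) (v := fun a => u a ^ 2) (fun a => sq_nonneg _)
    h.one_le r (fun a => (h.memLp_coord a).const_mul _)
    (fun a k hk => by
      rw [hpow, ← pow_mul, mul_comm]
      gcongr
      · rw [pow_mul]; positivity
      · exact h.moment k hk) Finset.univ
  exact this

theorem MomentBound.integrable_sum_mulVec_sq_pow {m : Type*} [Fintype m] {r : ℕ} {κ : ℝ}
    (h : MomentBound ρ r κ) (N : Matrix m ι ℝ) :
    Integrable (fun z : ι → ℝ => (∑ a, (N *ᵥ z) a ^ 2) ^ r) (Measure.pi fun _ : ι => ρ) := by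
  rcases Nat.eq_zero_or_pos r with rfl | hr
  · simp
  obtain ⟨k, rfl⟩ : ∃ k, r = k + 1 := ⟨r - 1, by omega⟩
  have hm : AEStronglyMeasurable (fun z : ι → ℝ => (∑ a, (N *ᵥ z) a ^ 2) ^ (k + 1))
      (Measure.pi fun _ : ι => ρ) := by
    simp only [mulVec, dotProduct]
    exact Measurable.aestronglyMeasurable (by fun_prop)
  have hi : Integrable (fun z : ι → ℝ => (Fintype.card m : ℝ) ^ k *
      ∑ a, ((N *ᵥ z) a ^ 2) ^ (k + 1)) (Measure.pi fun _ : ι => ρ) := by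
    refine (integrable_finsetSum _ fun a _ => ?_).const_mul _
    simp_rw [← pow_mul]
    exact MemLp.integrable_pow_of_le (h.memLp_dotProduct (N a)) le_rfl
  refine hi.mono hm (ae_of_all _ fun z => ?_)
  rw [Real.norm_of_nonneg (by positivity), Real.norm_of_nonneg (by positivity)]

  -- The factor depending on the number of rows is harmless here, since only integrability is at
  -- stake.
  have h2 := pow_sum_div_card_le_sum_pow (s := (Finset.univ : Finset m))
    (f := fun a => (N *ᵥ z) a ^ 2) (fun a _ => sq_nonneg _) k
  rcases isEmpty_or_nonempty m with hE | hE
  · simp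
  · rw [div_le_iff₀ (by rw [Finset.card_univ]; positivity), Finset.card_univ] at h2
    linarith

/-- Jensen's inequality is applied with the squared row norms `n a / S` as weights. Each normalized
row has moment at most `formConst r κ`, so no factor depending on the number of rows appears. Zero
rows contribute zero on both sides. -/
theorem MomentBound.integral_sum_mulVec_sq_pow_le {m : Type*} [Fintype m] {r : ℕ} {κ : ℝ}
    (h : MomentBound ρ r κ) (N : Matrix m ι ℝ) :
    ∫ z : ι → ℝ, (∑ a, (N *ᵥ z) a ^ 2) ^ r ∂(Measure.pi fun _ : ι => ρ)
      ≤ formConst r κ * frobSq N ^ r := by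
  have hC := h.formConst_pos
  let n : m → ℝ := fun a => ∑ b, N a b ^ 2
  have hn : ∀ a, 0 ≤ n a := fun a => Finset.sum_nonneg fun _ _ => sq_nonneg _
  have hnz : ∀ a (z : ι → ℝ), n a = 0 → (N *ᵥ z) a = 0 := by
    intro a z ha
    have h0 : ∀ b, N a b = 0 := by
      intro b
      have := (Finset.sum_eq_zero_iff_of_nonneg (fun b _ => sq_nonneg (N a b))).1 ha b
        (Finset.mem_univ b)
      exact pow_eq_zero_iff (two_ne_zero) |>.1 this
    simp [mulVec, dotProduct, h0]
  set S := frobSq N with hS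
  have hSn : S = ∑ a, n a := rfl
  rcases (frobSq_nonneg N).eq_or_lt with h0 | h0
  · have hna : ∀ a, n a = 0 := fun a =>
      (Finset.sum_eq_zero_iff_of_nonneg (fun a _ => hn a)).1 (h0.symm : ∑ a, n a = 0) a
        (Finset.mem_univ a)
    rw [← hS] at h0
    simp_rw [fun z a => hnz a z (hna a), ← h0]
    rcases Nat.eq_zero_or_pos r with rfl | hr
    · simp [formConst, momentConst]
    · simp [hr.ne']
  · rw [← hS] at h0
    have hpt : ∀ z : ι → ℝ, (∑ a, (N *ᵥ z) a ^ 2) ^ r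
        ≤ S ^ r * ∑ a, n a / S * ((n a)⁻¹ ^ r * (N *ᵥ z) a ^ (2 * r)) := by
      intro z
      have hJ := Real.pow_arith_mean_le_arith_mean_pow Finset.univ (fun a => n a / S)
        (fun a => (n a)⁻¹ * (N *ᵥ z) a ^ 2) (fun a _ => div_nonneg (hn a) h0.le)
        (by rw [← Finset.sum_div, ← hSn, div_self h0.ne'])
        (fun a _ => mul_nonneg (inv_nonneg.2 (hn a)) (sq_nonneg _)) r
      have e1 : ∑ a, (N *ᵥ z) a ^ 2 = S * ∑ a, n a / S * ((n a)⁻¹ * (N *ᵥ z) a ^ 2) := by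
        rw [Finset.mul_sum]
        refine Finset.sum_congr rfl fun a _ => ?_
        rcases eq_or_ne (n a) 0 with ha | ha
        · simp [hnz a z ha]
        · field_simp
      rw [e1, mul_pow]
      refine mul_le_mul_of_nonneg_left (hJ.trans (le_of_eq ?_)) (by positivity)
      refine Finset.sum_congr rfl fun a _ => ?_
      rw [mul_pow, ← pow_mul]
    have hi : ∀ a, Integrable (fun z : ι → ℝ => n a / S * ((n a)⁻¹ ^ r * (N *ᵥ z) a ^ (2 * r)))
        (Measure.pi fun _ : ι => ρ) := fun a =>
      ((MemLp.integrable_pow_of_le (h.memLp_dotProduct (N a)) le_rfl).const_mul _).const_mul _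
    refine (integral_mono (h.integrable_sum_mulVec_sq_pow N)
      ((integrable_finsetSum _ fun a _ => hi a).const_mul _) hpt).trans ?_
    rw [integral_const_mul, integral_finsetSum _ fun a _ => hi a]
    simp_rw [integral_const_mul]
    calc _ ≤ S ^ r * ∑ a, n a / S * formConst r κ := by
          refine mul_le_mul_of_nonneg_left (Finset.sum_le_sum fun a _ => ?_) (by positivity)
          refine mul_le_mul_of_nonneg_left ?_ (div_nonneg (hn a) h0.le)
          have := h.integral_dotProduct_pow_le (N a)
          calc _ ≤ (n a)⁻¹ ^ r * (formConst r κ * n a ^ r) :=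
                mul_le_mul_of_nonneg_left this (pow_nonneg (inv_nonneg.2 (hn a)) _)
            _ = formConst r κ * ((n a)⁻¹ * n a) ^ r := by rw [mul_pow]; ring
            _ ≤ formConst r κ * 1 := by
                gcongr
                exact pow_le_one₀ (mul_nonneg (inv_nonneg.2 (hn a)) (hn a)) (inv_mul_le_one)
            _ = _ := mul_one _
      _ = formConst r κ * S ^ r := by
          rw [← Finset.sum_mul, ← Finset.sum_div, ← hSn, div_self h0.ne']; ring

theorem MomentBound.memLp_bilinear {r : ℕ} {κ : ℝ} (h : MomentBound ρ r κ)
    (N : Matrix ι ι ℝ) :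
    MemLp (fun e : (ι → ℝ) × (ι → ℝ) => (N *ᵥ e.2) ⬝ᵥ e.1) ((2 * r : ℕ) : ℝ≥0∞)
      ((Measure.pi fun _ : ι => ρ).prod (Measure.pi fun _ : ι => ρ)) := by
  refine memLp_finsetSum _ fun a _ => ?_
  have := memLp_mul_prod (h.memLp_coord a) (h.memLp_dotProduct (N a))
  exact this.ae_eq (ae_of_all _ fun e => mul_comm _ _)

/-- With the second vector frozen this is a linear form with coefficient vector `N z'`; averaging
the powers of `|N z'|²` then costs a second factor `formConst`. -/
theorem MomentBound.integral_bilinear_pow_le {r : ℕ} {κ : ℝ} (h : MomentBound ρ r κ)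
    (N : Matrix ι ι ℝ) :
    ∫ e : (ι → ℝ) × (ι → ℝ), ((N *ᵥ e.2) ⬝ᵥ e.1) ^ (2 * r)
      ∂((Measure.pi fun _ : ι => ρ).prod (Measure.pi fun _ : ι => ρ))
      ≤ formConst r κ ^ 2 * frobSq N ^ r := by
  have hC := h.formConst_pos
  have hi := MemLp.integrable_pow_of_le (h.memLp_bilinear N) le_rfl
  rw [integral_prod_symm _ hi]
  calc _ ≤ ∫ z' : ι → ℝ, formConst r κ * (∑ a, (N *ᵥ z') a ^ 2) ^ r
        ∂(Measure.pi fun _ : ι => ρ) := by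
        refine integral_mono_of_nonneg (ae_of_all _ fun z' => integral_nonneg fun z => ?_)
          ((h.integrable_sum_mulVec_sq_pow N).const_mul _) (ae_of_all _ fun z' => ?_)
        · simp only [pow_mul]; positivity
        · exact h.integral_dotProduct_pow_le (N *ᵥ z')
    _ ≤ _ := by
        rw [integral_const_mul, sq, mul_assoc]
        exact mul_le_mul_of_nonneg_left (h.integral_sum_mulVec_sq_pow_le N) hC.le

/-- The entries of `z zᵀ - 1`. -/
def centredSq (z : ι → ℝ) (a b : ι) : ℝ := z a * z b - if a = b then 1 else 0

/-- The covariances of the entries of `z zᵀ - 1`, when `m` is the fourth moment. -/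
def centredSqCov (m : ℝ) (a b c d : ι) : ℝ :=
  if a = b then (if c = a ∧ d = a then m - 1 else 0)
  else (if c = a ∧ d = b ∨ c = b ∧ d = a then 1 else 0)

theorem MomentBound.memLp_centredSq {κ : ℝ} (h : MomentBound ρ 2 κ) (a b : ι) :
    MemLp (fun z : ι → ℝ => centredSq z a b) 2 (Measure.pi fun _ : ι => ρ) := by
  have h4 : ∀ a : ι, MemLp (fun z : ι → ℝ => z a) 4 (Measure.pi fun _ : ι => ρ) := fun a => by
    have := h.memLp_coord a
    exact_mod_cast this
  exact (memLp_two_mul (h4 a) (h4 b)).sub (memLp_const _)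

/-- Unless the two index pairs agree up to order, some coordinate enters only through a factor of
mean zero, either `z e` or `z e ^ 2 - 1`, and resampling it gives zero. -/
theorem MomentBound.integral_centredSq_mul {κ : ℝ} (h : MomentBound ρ 2 κ)
    (hvar : ∫ x, x ^ 2 ∂ρ = 1) (a b c d : ι) :
    ∫ z : ι → ℝ, centredSq z a b * centredSq z c d ∂(Measure.pi fun _ : ι => ρ)
      = centredSqCov (∫ x, x ^ 4 ∂ρ) a b c d := by
  have hL : MemLp (fun x : ℝ => x) (4 : ℕ) ρ := h.memLp
  have i2 : Integrable (fun x : ℝ => x ^ 2) ρ := MemLp.integrable_pow_of_le hL (by norm_num)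
  have i4 : Integrable (fun x : ℝ => x ^ 4) ρ := MemLp.integrable_pow_of_le hL (by norm_num)
  have hc0 : ∫ x, (x * x - 1) ∂ρ = 0 := by
    simp_rw [← sq]
    rw [integral_sub i2 (integrable_const _), hvar]; simp
  have zlin : ∀ (e f : ι) (G : (ι → ℝ) → ℝ), e ≠ f →
      (∀ z t, G (Function.update z e t) = G z) →
      ∫ z : ι → ℝ, (z e * z f) * G z ∂(Measure.pi fun _ : ι => ρ) = 0 := by
    intro e f G hef hG
    refine integral_eq_zero_of_update e fun z => ?_
    simp_rw [hG, Function.update_self, Function.update_of_ne hef.symm, integral_mul_const, h.mean,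
      zero_mul]
  have zsq : ∀ (e : ι) (G : (ι → ℝ) → ℝ), (∀ z t, G (Function.update z e t) = G z) →
      ∫ z : ι → ℝ, (z e * z e - 1) * G z ∂(Measure.pi fun _ : ι => ρ) = 0 := by
    intro e G hG
    refine integral_eq_zero_of_update e fun z => ?_
    simp_rw [hG, Function.update_self, integral_mul_const, hc0, zero_mul]
  have inv : ∀ (e c d : ι), c ≠ e → d ≠ e → ∀ (z : ι → ℝ) t,
      centredSq (Function.update z e t) c d = centredSq z c d := by
    intro e c d hc hd z t
    simp [centredSq, hc, hd]
  by_cases hab : a = b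
  · subst hab
    by_cases hca : c = a
    · subst hca
      by_cases hda : d = c
      · subst hda
        simp only [centredSq, centredSqCov, if_true, and_self]
        rw [integral_coord d (F := fun x : ℝ => (x * x - 1) * (x * x - 1)) (by fun_prop)]
        have e : ∀ x : ℝ, (x * x - 1) * (x * x - 1) = x ^ 4 - 2 * x ^ 2 + 1 := fun x => by ring
        have i3 : Integrable (fun x : ℝ => x ^ 4 - 2 * x ^ 2) ρ := i4.sub (i2.const_mul 2)
        simp_rw [e]
        rw [integral_add i3 (integrable_const _), integral_sub i4 (i2.const_mul 2),
          integral_const_mul, hvar]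
        simp only [integral_const, probReal_univ, one_smul]
        ring
      · simp only [centredSqCov, if_true, hda, and_false, if_false]
        have := zlin d c (fun z => centredSq z c c) hda (inv d c c (Ne.symm hda) (Ne.symm hda))
        rw [← this]
        congr 1; ext z
        simp only [centredSq, if_neg (Ne.symm hda)]; ring
    · simp only [centredSqCov, if_true, hca, false_and, if_false]
      by_cases hda : d = a
      · subst hda
        have := zlin c d (fun z => centredSq z d d) hca (inv c d d (Ne.symm hca) (Ne.symm hca))
        rw [← this]
        congr 1; ext z
        simp only [centredSq, if_neg hca]; ring
      · have := zsq a (fun z => centredSq z c d) (inv a c d hca hda)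
        rw [← this]
        congr 1; ext z
        simp only [centredSq, if_true]
  · have hM : ∀ z : ι → ℝ, centredSq z a b = z a * z b := fun z => by simp [centredSq, hab]
    simp only [centredSqCov, if_neg hab]
    by_cases h1 : c = a ∧ d = b ∨ c = b ∧ d = a
    · rw [if_pos h1]
      have e : ∀ z : ι → ℝ, centredSq z a b * centredSq z c d = z a ^ 2 * z b ^ 2 := by
        intro z
        rcases h1 with ⟨rfl, rfl⟩ | ⟨rfl, rfl⟩
        · rw [hM]; ring
        · simp only [centredSq, if_neg hab, if_neg (Ne.symm hab)]; ring
      simp_rw [e]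
      rw [integral_pair hab (F := fun e : ℝ × ℝ => e.1 ^ 2 * e.2 ^ 2) (by fun_prop),
        integral_prod_mul (fun x : ℝ => x ^ 2) (fun x : ℝ => x ^ 2), hvar, one_mul]
    · rw [if_neg h1]
      simp_rw [hM]
      by_cases ha : c ≠ a ∧ d ≠ a
      · exact zlin a b (fun z => centredSq z c d) hab (inv a c d ha.1 ha.2)
      -- The index `a` occurs among `c`, `d` but the pairs do not match, so the isolated coordinate
      -- is `b`.
      · have hb : c ≠ b ∧ d ≠ b := by
          constructor
          · rintro rfl
            exact ha ⟨Ne.symm hab, fun h => h1 (Or.inr ⟨rfl, h⟩)⟩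
          · rintro rfl
            exact ha ⟨fun h => h1 (Or.inl ⟨h, rfl⟩), Ne.symm hab⟩
        simp_rw [mul_comm (_ : ℝ) (centredSq _ c d), mul_comm (_ : ℝ) ((_ : ι → ℝ) b)]
        have := zlin b a (fun z => centredSq z c d) (Ne.symm hab) (inv b c d hb.1 hb.2)
        rw [← this]
        congr 1; ext z; ring

theorem one_le_fourth_moment {κ : ℝ} (h : MomentBound ρ 2 κ) (hvar : ∫ x, x ^ 2 ∂ρ = 1) :
    1 ≤ ∫ x, x ^ 4 ∂ρ := by
  have hL : MemLp (fun x : ℝ => x) 4 ρ := by exact_mod_cast h.memLp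
  have := sq_integral_le_integral_sq (memLp_sq_of_memLp_four hL)
  rw [hvar, one_pow] at this
  simpa only [← pow_mul] using this

/-- The variance of a quadratic form is controlled by the Frobenius norm of its matrix. -/
theorem MomentBound.integral_sum_mul_centredSq_sq_le {κ : ℝ} (h : MomentBound ρ 2 κ)
    (hvar : ∫ x, x ^ 2 ∂ρ = 1) (A : Matrix ι ι ℝ) :
    ∫ z : ι → ℝ, (∑ q : ι × ι, A q.1 q.2 * centredSq z q.1 q.2) ^ 2 ∂(Measure.pi fun _ : ι => ρ)
      ≤ ((∫ x, x ^ 4 ∂ρ) + 1) * frobSq A := by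
  set m := ∫ x, x ^ 4 ∂ρ with hm
  have hm1 : 1 ≤ m := one_le_fourth_moment h hvar
  have h1 := integral_sq_sum_le (P := Measure.pi fun _ : ι => ρ) (Finset.univ : Finset (ι × ι))
    (Y := fun q z => A q.1 q.2 * centredSq z q.1 q.2)
    (c := fun q r => A q.1 q.2 * A r.1 r.2 * centredSqCov m q.1 q.2 r.1 r.2)
    (fun q _ r _ => ((h.memLp_centredSq q.1 q.2).const_mul _).integrable_mul
      ((h.memLp_centredSq r.1 r.2).const_mul _))
    (fun q _ r _ => by
      have e : ∀ z : ι → ℝ, (A q.1 q.2 * centredSq z q.1 q.2) * (A r.1 r.2 * centredSq z r.1 r.2)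
        = (A q.1 q.2 * A r.1 r.2) * (centredSq z q.1 q.2 * centredSq z r.1 r.2) := fun z => by ring
      simp_rw [e]
      rw [integral_const_mul, h.integral_centredSq_mul hvar])
  refine h1.trans ?_
  -- An entry is correlated only with itself and its transpose; the mixed product `A a b * A b a` is
  -- split by the arithmetic–geometric mean inequality. The coefficients sum to `m + 1`.
  have h2 : ∀ q : ι × ι, ∑ r : ι × ι, A q.1 q.2 * A r.1 r.2 * centredSqCov m q.1 q.2 r.1 r.2
      ≤ (m - 1 + 2⁻¹ * 2) * A q.1 q.2 ^ 2 + 2⁻¹ * A q.1 q.2 ^ 2 + 2⁻¹ * A q.2 q.1 ^ 2 := by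
    rintro ⟨a, b⟩
    dsimp only
    by_cases hab : a = b
    · subst hab
      rw [Finset.sum_eq_single (a, a)]
      · simp only [centredSqCov, if_true, and_self]
        nlinarith [sq_nonneg (A a a)]
      · rintro ⟨c, d⟩ _ hne
        have : ¬(c = a ∧ d = a) := fun h => hne (by rw [h.1, h.2])
        simp [centredSqCov, this]
      · simp
    · have hne : (a, b) ≠ (b, a) := fun h => hab (congrArg Prod.fst h)
      rw [← Finset.sum_subset (Finset.subset_univ {(a, b), (b, a)})]
      · rw [Finset.sum_pair hne]
        simp only [centredSqCov, if_neg hab, true_and, and_true, true_or, or_true, if_true]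
        nlinarith [sq_nonneg (A a b - A b a), sq_nonneg (A a b)]
      · rintro ⟨c, d⟩ _ hnot
        simp only [Finset.mem_insert, Finset.mem_singleton, Prod.mk.injEq] at hnot
        simp [centredSqCov, hab, hnot]
  refine (Finset.sum_le_sum fun q _ => h2 q).trans (le_of_eq ?_)
  rw [Finset.sum_add_distrib, Finset.sum_add_distrib, ← Finset.mul_sum, ← Finset.mul_sum,
    ← Finset.mul_sum]
  have e1 : ∑ q : ι × ι, A q.1 q.2 ^ 2 = frobSq A := by rw [Fintype.sum_prod_type]; rfl
  have e2 : ∑ q : ι × ι, A q.2 q.1 ^ 2 = frobSq A := by rw [Fintype.sum_prod_type_right]; rfl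
  rw [e1, e2]; ring

end Forms

/-! ### The law of a single observation -/

section ObservationLaw

theorem measurePreserving_prodProdProdComm {α β γ δ : Type*} [MeasurableSpace α]
    [MeasurableSpace β] [MeasurableSpace γ] [MeasurableSpace δ] (a : Measure α) (b : Measure β)
    (c : Measure γ) (d : Measure δ) [SFinite a] [SFinite b] [SFinite c] [SFinite d] :
    MeasurePreserving (fun x : (α × β) × (γ × δ) => ((x.1.1, x.2.1), (x.1.2, x.2.2)))
      ((a.prod b).prod (c.prod d)) ((a.prod c).prod (b.prod d)) := by
  have h1 := measurePreserving_prodAssoc a b (c.prod d)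
  have h2 : MeasurePreserving (fun x : β × (γ × δ) => (x.2.1, (x.1, x.2.2)))
      (b.prod (c.prod d)) (c.prod (b.prod d)) :=
    (measurePreserving_prodAssoc c b d).comp
      (((Measure.measurePreserving_swap (μ := b) (ν := c)).prod (MeasurePreserving.id d)).comp
        ((measurePreserving_prodAssoc b c d).symm))
  have h3 := (MeasurePreserving.id a).prod h2
  have h4 := (measurePreserving_prodAssoc a c (b.prod d)).symm
  exact h4.comp (h3.comp h1)

instance discreteMeasurableSpace_perm (d : ℕ) : DiscreteMeasurableSpace (Equiv.Perm (Fin d)) :=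
  ⟨fun _ => trivial⟩

/-- The uniform distribution on permutations. -/
noncomputable def permLaw (d : ℕ) : Measure (Equiv.Perm (Fin d)) :=
  (PMF.uniformOfFintype (Equiv.Perm (Fin d))).toMeasure

instance (d : ℕ) : IsProbabilityMeasure (permLaw d) :=
  PMF.toMeasure.isProbabilityMeasure _

theorem integral_permLaw {d : ℕ} (f : Equiv.Perm (Fin d) → ℝ) :
    ∫ q, f q ∂(permLaw d) = (d.factorial : ℝ)⁻¹ * ∑ q, f q := by
  rw [permLaw, PMF.integral_eq_sum, Finset.mul_sum]
  refine Finset.sum_congr rfl fun q _ => ?_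
  simp [PMF.uniformOfFintype_apply, Fintype.card_perm]

/-- A scale, a vector of standardized variables, and a permutation of the coordinates. -/
abbrev Obs (d : ℕ) : Type := ℝ × (Fin d → ℝ) × Equiv.Perm (Fin d)

/-- The joint law of scale, standardized vector and permutation. -/
noncomputable def obsLaw (η ρ : Measure ℝ) (d : ℕ) : Measure (Obs d) :=
  η.prod ((Measure.pi fun _ => ρ).prod (permLaw d))

variable {η ρ : Measure ℝ} [IsProbabilityMeasure η] [IsProbabilityMeasure ρ] {d : ℕ}

instance : IsProbabilityMeasure (obsLaw η ρ d) := by unfold obsLaw; infer_instance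

/-- Two observations are rearranged into scales, vectors and permutations, so that each kind of
randomness can be integrated separately. -/
theorem measurePreserving_obs_regroup :
    MeasurePreserving (fun e : Obs d × Obs d =>
        ((e.1.1, e.2.1), ((e.1.2.1, e.2.2.1), (e.1.2.2, e.2.2.2))))
      ((obsLaw η ρ d).prod (obsLaw η ρ d))
      ((η.prod η).prod (((Measure.pi fun _ : Fin d => ρ).prod (Measure.pi fun _ : Fin d => ρ)).prod
        ((permLaw d).prod (permLaw d)))) :=
  ((MeasurePreserving.id _).prod (measurePreserving_prodProdProdComm _ _ _ _)).comp
    (measurePreserving_prodProdProdComm η _ η _)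

/-- A bilinear form in two scaled vectors, whose matrix depends on the two permutations. -/
def obsForm (N : Equiv.Perm (Fin d) → Equiv.Perm (Fin d) → Matrix (Fin d) (Fin d) ℝ)
    (x y : Obs d) : ℝ :=
  (x.1 * y.1) * ((N x.2.2 y.2.2 *ᵥ y.2.1) ⬝ᵥ x.2.1)

theorem measurable_mulVec_dotProduct
    (N : Equiv.Perm (Fin d) → Equiv.Perm (Fin d) → Matrix (Fin d) (Fin d) ℝ) :
    Measurable (fun u : ((Fin d → ℝ) × (Fin d → ℝ)) ×
      (Equiv.Perm (Fin d) × Equiv.Perm (Fin d)) => (N u.2.1 u.2.2 *ᵥ u.1.2) ⬝ᵥ u.1.1) := by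
  refine measurable_from_prod_countable_left fun q => ?_
  simp only [mulVec, dotProduct]
  fun_prop

theorem measurable_obsForm
    (N : Equiv.Perm (Fin d) → Equiv.Perm (Fin d) → Matrix (Fin d) (Fin d) ℝ) :
    Measurable (Function.uncurry (obsForm N)) := by
  -- Only the measurability of the regrouping map is used, so the Dirac masses are arbitrary
  -- choices.
  have h := (measurable_mulVec_dotProduct N).comp (measurable_snd.comp
    (measurePreserving_obs_regroup (η := Measure.dirac 0) (ρ := Measure.dirac 0)
      (d := d)).measurable)
  have h2 : Measurable (fun e : Obs d × Obs d => e.1.1 * e.2.1) := by fun_prop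
  exact h2.mul h

/-- The scale is bounded. -/
def ScaleBound (η : Measure ℝ) (b : ℝ) : Prop := 0 ≤ b ∧ ∀ᵐ w ∂η, w ^ 2 ≤ b

theorem ScaleBound.integrable_pow {b : ℝ} (h : ScaleBound η b) (k : ℕ) :
    Integrable (fun w : ℝ => w ^ (2 * k)) η := by
  refine (integrable_const (b ^ k)).mono' (by fun_prop) ?_
  filter_upwards [h.2] with w hw
  rw [Real.norm_of_nonneg (by rw [pow_mul]; positivity), pow_mul]
  gcongr

theorem ScaleBound.integral_pow_le {b : ℝ} (h : ScaleBound η b) (k : ℕ) :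
    ∫ w, w ^ (2 * k) ∂η ≤ b ^ k := by
  have : ∫ w, w ^ (2 * k) ∂η ≤ ∫ _, b ^ k ∂η := by
    refine integral_mono_ae (h.integrable_pow k) (integrable_const _) ?_
    filter_upwards [h.2] with w hw
    rw [pow_mul]
    gcongr
  simpa using this

/-- For fixed permutations this is a bilinear form with a deterministic matrix; the bound is uniform
over permutations because all Frobenius norms are at most `τ`. The scales factor out and contribute
powers of `b`. -/
theorem obsForm_bounds {r : ℕ} {κ b τ : ℝ} (hρ : MomentBound ρ r κ) (hη : ScaleBound η b)
    (N : Equiv.Perm (Fin d) → Equiv.Perm (Fin d) → Matrix (Fin d) (Fin d) ℝ)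
    (hN : ∀ q q', frobSq (N q q') ≤ τ) :
    MemLp (Function.uncurry (obsForm N)) ((2 * r : ℕ) : ℝ≥0∞)
      ((obsLaw η ρ d).prod (obsLaw η ρ d)) ∧
    ∫ e, obsForm N e.1 e.2 ^ (2 * r) ∂((obsLaw η ρ d).prod (obsLaw η ρ d))
      ≤ b ^ (2 * r) * (formConst r κ ^ 2 * τ ^ r) := by
  set γ := (Measure.pi fun _ : Fin d => ρ) with hγ
  let G : ((Fin d → ℝ) × (Fin d → ℝ)) × (Equiv.Perm (Fin d) × Equiv.Perm (Fin d)) → ℝ :=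
    fun u => ((N u.2.1 u.2.2 *ᵥ u.1.2) ⬝ᵥ u.1.1) ^ (2 * r)
  have hGm : Measurable G := (measurable_mulVec_dotProduct N).pow_const _
  have hG0 : ∀ u, 0 ≤ G u := fun u => by simp only [G, pow_mul]; positivity
  have hGi : Integrable G ((γ.prod γ).prod ((permLaw d).prod (permLaw d))) := by
    -- There are finitely many permutations, so the sum over all pairs of them is an integrable
    -- majorant that does not depend on the permutations.
    have h1 : Integrable (fun z : (Fin d → ℝ) × (Fin d → ℝ) =>
        ∑ q : Equiv.Perm (Fin d) × Equiv.Perm (Fin d),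
          ((N q.1 q.2 *ᵥ z.2) ⬝ᵥ z.1) ^ (2 * r)) (γ.prod γ) :=
      integrable_finsetSum _ fun q _ =>
        MemLp.integrable_pow_of_le (hρ.memLp_bilinear (N q.1 q.2)) le_rfl
    refine (h1.comp_fst ((permLaw d).prod (permLaw d))).mono hGm.aestronglyMeasurable
      (ae_of_all _ fun u => ?_)
    rw [Real.norm_of_nonneg (hG0 u), Real.norm_of_nonneg
      (Finset.sum_nonneg fun q _ => by rw [pow_mul]; positivity)]
    exact Finset.single_le_sum (f := fun q : Equiv.Perm (Fin d) × Equiv.Perm (Fin d) =>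
      ((N q.1 q.2 *ᵥ u.1.2) ⬝ᵥ u.1.1) ^ (2 * r))
      (fun q _ => by rw [pow_mul]; positivity) (Finset.mem_univ u.2)
  have hGle : ∫ u, G u ∂((γ.prod γ).prod ((permLaw d).prod (permLaw d)))
      ≤ formConst r κ ^ 2 * τ ^ r := by
    rw [integral_prod_symm _ hGi]
    have hle : ∀ q : Equiv.Perm (Fin d) × Equiv.Perm (Fin d),
        ∫ z, G (z, q) ∂(γ.prod γ) ≤ formConst r κ ^ 2 * τ ^ r := fun q => by
      refine (hρ.integral_bilinear_pow_le (N q.1 q.2)).trans ?_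
      have := frobSq_nonneg (N q.1 q.2)
      gcongr
      exact hN _ _
    refine (integral_mono hGi.integral_prod_right (integrable_const _) hle).trans ?_
    simp
  let W : ℝ × ℝ → ℝ := fun w => w.1 ^ (2 * r) * w.2 ^ (2 * r)
  have hWi : Integrable W (η.prod η) := (hη.integrable_pow r).mul_prod (hη.integrable_pow r)
  have hW : ∫ w, W w ∂(η.prod η) ≤ b ^ (2 * r) := by
    rw [integral_prod_mul (fun w : ℝ => w ^ (2 * r)) (fun w : ℝ => w ^ (2 * r)), two_mul r, pow_add]
    have h0 : 0 ≤ ∫ w, w ^ (2 * r) ∂η := integral_nonneg fun w => by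
      rw [pow_mul]; positivity
    have := hη.integral_pow_le r
    rw [two_mul] at this h0
    have hb := hη.1
    gcongr
  have hmp := measurePreserving_obs_regroup (η := η) (ρ := ρ) (d := d)
  have hfun : ∀ e : Obs d × Obs d, obsForm N e.1 e.2 ^ (2 * r)
      = (fun v : (ℝ × ℝ) × (((Fin d → ℝ) × (Fin d → ℝ)) ×
        (Equiv.Perm (Fin d) × Equiv.Perm (Fin d))) => W v.1 * G v.2)
        ((e.1.1, e.2.1), ((e.1.2.1, e.2.2.1), (e.1.2.2, e.2.2.2))) := by
    intro e; simp only [obsForm, W, G, mul_pow]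
  have hint : Integrable (fun v : (ℝ × ℝ) × (((Fin d → ℝ) × (Fin d → ℝ)) ×
        (Equiv.Perm (Fin d) × Equiv.Perm (Fin d))) => W v.1 * G v.2)
      ((η.prod η).prod ((γ.prod γ).prod ((permLaw d).prod (permLaw d)))) := hWi.mul_prod hGi
  constructor
  · refine memLp_of_integrable_even_pow (measurable_obsForm N).aestronglyMeasurable ?_
    exact (hmp.integrable_comp_of_integrable hint).congr (ae_of_all _ fun e => (hfun e).symm)
  · have hmap := integral_map hmp.measurable.aemeasurable (by rw [hmp.map_eq]; exact hint.1)
    rw [hmp.map_eq, integral_prod_mul W G] at hmap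
    simp_rw [hfun]
    refine le_trans (le_of_eq hmap.symm) ?_
    have : 0 ≤ ∫ u, G u ∂((γ.prod γ).prod ((permLaw d).prod (permLaw d))) :=
      integral_nonneg fun u => hG0 u
    have hb := hη.1
    gcongr

theorem integral_obs_mul {f : ℝ → ℝ} {g : Equiv.Perm (Fin d) → (Fin d → ℝ) → ℝ}
    (hg : ∀ q, Measurable (g q))
    (hi : ∀ q, Integrable (g q) (Measure.pi fun _ : Fin d => ρ)) :
    ∫ x, f x.1 * g x.2.2 x.2.1 ∂(obsLaw η ρ d)
      = (∫ w, f w ∂η) * ((d.factorial : ℝ)⁻¹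
        * ∑ q, ∫ z, g q z ∂(Measure.pi fun _ : Fin d => ρ)) := by
  rw [obsLaw, integral_prod_mul f (fun u : (Fin d → ℝ) × Equiv.Perm (Fin d) => g u.2 u.1),
    ← integral_permLaw]
  congr 1
  refine integral_prod_symm (fun u : (Fin d → ℝ) × Equiv.Perm (Fin d) => g u.2 u.1) ?_
  have hm : Measurable (fun u : (Fin d → ℝ) × Equiv.Perm (Fin d) => g u.2 u.1) :=
    measurable_from_prod_countable_left fun q => hg q
  have h1 : Integrable (fun z : Fin d → ℝ => ∑ q, |g q z|) (Measure.pi fun _ : Fin d => ρ) :=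
    integrable_finsetSum _ fun q _ => (hi q).abs
  refine (h1.comp_fst (permLaw d)).mono hm.aestronglyMeasurable (ae_of_all _ fun u => ?_)
  rw [Real.norm_eq_abs, Real.norm_of_nonneg (Finset.sum_nonneg fun q _ => abs_nonneg _)]
  exact Finset.single_le_sum (f := fun q => |g q u.1|) (fun q _ => abs_nonneg _)
    (Finset.mem_univ u.2)

theorem integrable_obs_mul {f : ℝ → ℝ} {g : Equiv.Perm (Fin d) → (Fin d → ℝ) → ℝ}
    (hf : Integrable f η) (hg : ∀ q, Measurable (g q))
    (hi : ∀ q, Integrable (g q) (Measure.pi fun _ : Fin d => ρ)) :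
    Integrable (fun x => f x.1 * g x.2.2 x.2.1) (obsLaw η ρ d) := by
  refine Integrable.mul_prod (g := fun u : (Fin d → ℝ) × Equiv.Perm (Fin d) => g u.2 u.1) hf ?_
  have hm : Measurable (fun u : (Fin d → ℝ) × Equiv.Perm (Fin d) => g u.2 u.1) :=
    measurable_from_prod_countable_left fun q => hg q
  have h1 : Integrable (fun z : Fin d → ℝ => ∑ q, |g q z|) (Measure.pi fun _ : Fin d => ρ) :=
    integrable_finsetSum _ fun q _ => (hi q).abs
  refine (h1.comp_fst (permLaw d)).mono hm.aestronglyMeasurable (ae_of_all _ fun u => ?_)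
  rw [Real.norm_eq_abs, Real.norm_of_nonneg (Finset.sum_nonneg fun q _ => abs_nonneg _)]
  exact Finset.single_le_sum (f := fun q => |g q u.1|) (fun q _ => abs_nonneg _)
    (Finset.mem_univ u.2)

end ObservationLaw

/-! ### The kernel of the test statistic -/

section Kernel

variable {η ρ : Measure ℝ} [IsProbabilityMeasure η] [IsProbabilityMeasure ρ] {d : ℕ}

theorem frobSq_eq_trace {m n : Type*} [Fintype m] [Fintype n] (A : Matrix m n ℝ) :
    frobSq A = (A * Aᵀ).trace := by
  simp only [frobSq, trace, diag_apply, mul_apply, transpose_apply, sq]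

/-- With `S = T * T` the left side is `∑ S a b * S (σ a) (σ b)`. Since simultaneous permutation
preserves the Frobenius norm, this is at most `‖S‖²`: permuting the coordinates never enlarges the
bound. -/
theorem frobSq_mul_submatrix_le {T : Matrix (Fin d) (Fin d) ℝ} (hT : Tᵀ = T)
    (σ : Equiv.Perm (Fin d)) : frobSq (Tᵀ * T.submatrix σ id) ≤ frobSq (T * T) := by
  have h1 : frobSq (Tᵀ * T.submatrix σ id) = ((T * T) * (T * T).submatrix σ σ).trace := by
    rw [frobSq_eq_trace, transpose_mul, transpose_transpose, hT, transpose_submatrix, hT]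
    have : T.submatrix σ id * T.submatrix id σ = (T * T).submatrix σ σ := by
      rw [submatrix_mul_equiv T T σ (Equiv.refl _) σ |>.symm]; rfl
    calc (T * T.submatrix σ id * (T.submatrix id σ * T)).trace
        = (T * ((T.submatrix σ id * T.submatrix id σ) * T)).trace := by
          simp only [Matrix.mul_assoc]
      _ = _ := by
          rw [this, trace_mul_comm, Matrix.mul_assoc, trace_mul_comm]
  have hsym : (T * T)ᵀ = T * T := by rw [transpose_mul, hT]
  rw [h1]
  have h2 : ((T * T) * (T * T).submatrix σ σ).trace
      = ∑ a, ∑ b, (T * T) a b * (T * T) (σ a) (σ b) := by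
    simp only [trace, diag_apply, mul_apply (M := T * T), submatrix_apply]
    refine Finset.sum_congr rfl fun a _ => Finset.sum_congr rfl fun b _ => ?_
    congr 1
    exact congrFun (congrFun hsym (σ a)) (σ b)
  have h3 : ∑ a, ∑ b, (T * T) (σ a) (σ b) ^ 2 = frobSq (T * T) := by
    rw [Equiv.sum_comp σ (fun a => ∑ b, (T * T) a (σ b) ^ 2)]
    exact Finset.sum_congr rfl fun a _ => Equiv.sum_comp σ (fun b => (T * T) a b ^ 2)
  rw [h2]
  calc _ ≤ ∑ a, ∑ b, (2⁻¹ * (T * T) a b ^ 2 + 2⁻¹ * (T * T) (σ a) (σ b) ^ 2) :=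
        Finset.sum_le_sum fun a _ => Finset.sum_le_sum fun b _ => by
          nlinarith [sq_nonneg ((T * T) a b - (T * T) (σ a) (σ b))]
    _ = 2⁻¹ * frobSq (T * T) + 2⁻¹ * frobSq (T * T) := by
        simp_rw [Finset.sum_add_distrib, ← Finset.mul_sum]
        rw [h3]; rfl
    _ = _ := by ring

/-- The observed vector. -/
def obsVec (T : Matrix (Fin d) (Fin d) ℝ) (x : Obs d) (a : Fin d) : ℝ := x.1 * (T *ᵥ x.2.1) a

/-- The kernel of the test statistic. -/
def obsKernel (T : Matrix (Fin d) (Fin d) ℝ) (x y : Obs d) : ℝ :=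
  (obsVec T x ⬝ᵥ obsVec T y) ^ 2
    - ((obsVec T x ∘ x.2.2) ⬝ᵥ (obsVec T y ∘ y.2.2)) ^ 2

theorem obsVec_dotProduct (T : Matrix (Fin d) (Fin d) ℝ) (x y : Obs d) :
    obsVec T x ⬝ᵥ obsVec T y = obsForm (fun _ _ => Tᵀ * T) x y := by
  have e : (Tᵀ * T) *ᵥ y.2.1 ⬝ᵥ x.2.1 = (T *ᵥ y.2.1) ⬝ᵥ (T *ᵥ x.2.1) := by
    rw [← mulVec_mulVec, mulVec_transpose, ← dotProduct_mulVec]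
  rw [obsForm, e]
  simp only [obsVec, dotProduct, Finset.mul_sum]
  exact Finset.sum_congr rfl fun a _ => by ring

theorem perm_apply_inv_apply (q : Equiv.Perm (Fin d)) (a : Fin d) : q (q⁻¹ a) = a := by simp

/-- Relabelling the sum by the permutation of `x` shows that only the quotient of the two
permutations matters, acting on the rows of one copy of `T`. -/
theorem obsVec_comp_dotProduct (T : Matrix (Fin d) (Fin d) ℝ) (x y : Obs d) :
    (obsVec T x ∘ x.2.2) ⬝ᵥ (obsVec T y ∘ y.2.2)
      = obsForm (fun q q' => Tᵀ * T.submatrix (q' * q⁻¹) id) x y := by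
  have e : (Tᵀ * T.submatrix (y.2.2 * x.2.2⁻¹) id) *ᵥ y.2.1 ⬝ᵥ x.2.1
      = (T.submatrix (y.2.2 * x.2.2⁻¹) id *ᵥ y.2.1) ⬝ᵥ (T *ᵥ x.2.1) := by
    rw [← mulVec_mulVec, mulVec_transpose, ← dotProduct_mulVec]
  rw [obsForm, e]
  simp only [obsVec, dotProduct, Finset.mul_sum, Function.comp_apply]
  rw [← Equiv.sum_comp x.2.2⁻¹]
  refine Finset.sum_congr rfl fun a _ => ?_
  have : (T.submatrix (y.2.2 * x.2.2⁻¹) id *ᵥ y.2.1) a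
      = (T *ᵥ y.2.1) (y.2.2 (x.2.2⁻¹ a)) := rfl
  rw [this]
  simp only [perm_apply_inv_apply]
  ring

theorem obsKernel_eq (T : Matrix (Fin d) (Fin d) ℝ) (x y : Obs d) :
    obsKernel T x y = obsForm (fun _ _ => Tᵀ * T) x y ^ 2
      - obsForm (fun q q' => Tᵀ * T.submatrix (q' * q⁻¹) id) x y ^ 2 := by
  rw [obsKernel, obsVec_dotProduct, obsVec_comp_dotProduct]

theorem obsKernel_symm (T : Matrix (Fin d) (Fin d) ℝ) (x y : Obs d) :
    obsKernel T x y = obsKernel T y x := by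
  rw [obsKernel, obsKernel, dotProduct_comm, dotProduct_comm (obsVec T x ∘ x.2.2)]

/-- Permuting coordinates preserves length; this is why the test statistic has no diagonal part. -/
theorem obsKernel_self (T : Matrix (Fin d) (Fin d) ℝ) (x : Obs d) : obsKernel T x x = 0 := by
  have : (obsVec T x ∘ x.2.2) ⬝ᵥ (obsVec T x ∘ x.2.2) = obsVec T x ⬝ᵥ obsVec T x :=
    Equiv.sum_comp x.2.2 (fun a => obsVec T x a * obsVec T x a)
  rw [obsKernel, this, sub_self]

theorem measurable_obsKernel (T : Matrix (Fin d) (Fin d) ℝ) :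
    Measurable (Function.uncurry (obsKernel T)) := by
  have : Function.uncurry (obsKernel T)
      = fun e => Function.uncurry (obsForm fun _ _ => Tᵀ * T) e ^ 2
        - Function.uncurry (obsForm fun q q' => Tᵀ * T.submatrix (q' * q⁻¹) id) e ^ 2 := by
    ext e; exact obsKernel_eq T e.1 e.2
  rw [this]
  exact ((measurable_obsForm _).pow_const 2).sub ((measurable_obsForm _).pow_const 2)

theorem memLp_sq_of_memLp {Ω : Type*} [MeasurableSpace Ω] {P : Measure Ω}
    [IsFiniteMeasure P] {f : Ω → ℝ} {s : ℕ} (hf : MemLp f ((2 * (2 * s) : ℕ) : ℝ≥0∞) P) :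
    MemLp (fun ω => f ω ^ 2) ((2 * s : ℕ) : ℝ≥0∞) P := by
  refine memLp_of_integrable_even_pow (hf.1.pow 2) ?_
  simpa only [Pi.pow_apply, ← pow_mul] using MemLp.integrable_pow_of_le hf le_rfl

theorem frobSq_transpose_mul_self {T : Matrix (Fin d) (Fin d) ℝ} (hT : Tᵀ = T) :
    frobSq (Tᵀ * T) = frobSq (T * T) := by rw [hT]

/-- The kernel is a difference of two nonnegative squares, hence at most the larger of them in
absolute value, and both bilinear forms obey the same bound. -/
theorem obsKernel_bounds {s : ℕ} {κ b : ℝ} (hρ : MomentBound ρ (2 * s) κ)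
    (hη : ScaleBound η b) {T : Matrix (Fin d) (Fin d) ℝ} (hT : Tᵀ = T) :
    MemLp (Function.uncurry (obsKernel T)) ((2 * s : ℕ) : ℝ≥0∞)
      ((obsLaw η ρ d).prod (obsLaw η ρ d)) ∧
    ∫ e, obsKernel T e.1 e.2 ^ (2 * s) ∂((obsLaw η ρ d).prod (obsLaw η ρ d))
      ≤ 2 * (b ^ (2 * (2 * s)) * (formConst (2 * s) κ ^ 2 * frobSq (T * T) ^ (2 * s))) := by
  obtain ⟨h1, h1'⟩ := obsForm_bounds hρ hη (fun _ _ => Tᵀ * T)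
    (fun _ _ => (frobSq_transpose_mul_self hT).le)
  obtain ⟨h2, h2'⟩ := obsForm_bounds hρ hη (fun q q' => Tᵀ * T.submatrix (q' * q⁻¹) id)
    (fun q q' => frobSq_mul_submatrix_le hT _)
  have hL : MemLp (Function.uncurry (obsKernel T)) ((2 * s : ℕ) : ℝ≥0∞)
      ((obsLaw η ρ d).prod (obsLaw η ρ d)) := by
    refine ((memLp_sq_of_memLp h1).sub (memLp_sq_of_memLp h2)).ae_eq (ae_of_all _ fun e => ?_)
    exact (obsKernel_eq T e.1 e.2).symm
  refine ⟨hL, ?_⟩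
  have i1 := MemLp.integrable_pow_of_le h1 le_rfl
  have i2 := MemLp.integrable_pow_of_le h2 le_rfl
  refine (integral_mono (MemLp.integrable_pow_of_le hL le_rfl) (i1.add i2) fun e => ?_).trans ?_
  · simp only [Pi.add_apply, Function.uncurry]
    rw [obsKernel_eq, pow_mul _ 2 (2 * s), pow_mul _ 2 (2 * s)]
    set A := obsForm (fun _ _ => Tᵀ * T) e.1 e.2 ^ 2
    set B := obsForm (fun q q' => Tᵀ * T.submatrix (q' * q⁻¹) id) e.1 e.2 ^ 2
    have hA : 0 ≤ A := sq_nonneg _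
    have hB : 0 ≤ B := sq_nonneg _
    have hA' : 0 ≤ A ^ (2 * s) := by positivity
    have hB' : 0 ≤ B ^ (2 * s) := by positivity
    rw [← Even.pow_abs (even_two_mul s) (A - B)]
    rcases le_total A B with h | h
    · have : |A - B| ≤ B := by rw [abs_le]; constructor <;> linarith
      have := pow_le_pow_left₀ (abs_nonneg _) this (2 * s)
      linarith
    · have : |A - B| ≤ A := by rw [abs_le]; constructor <;> linarith
      have := pow_le_pow_left₀ (abs_nonneg _) this (2 * s)
      linarith
  · simp only [Pi.add_apply]
    rw [integral_add i1 i2]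
    have e1 := h1'
    have e2 := h2'
    simp only [Function.uncurry]
    linarith

/-- The average of a matrix over simultaneous permutations of its rows and columns. -/
noncomputable def permAvg (S : Matrix (Fin d) (Fin d) ℝ) : Matrix (Fin d) (Fin d) ℝ :=
  Matrix.of fun a b => (d.factorial : ℝ)⁻¹ * ∑ σ : Equiv.Perm (Fin d), S (σ a) (σ b)

theorem permAvg_one : permAvg (1 : Matrix (Fin d) (Fin d) ℝ) = 1 := by
  ext a b
  have hd : (d.factorial : ℝ) ≠ 0 := by positivity
  by_cases hab : a = b
  · subst hab
    simp [permAvg, Fintype.card_perm, hd]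
  · simp [permAvg, hab]

theorem permAvg_apply_perm (S : Matrix (Fin d) (Fin d) ℝ) (τ : Equiv.Perm (Fin d)) (a b : Fin d) :
    permAvg S (τ a) (τ b) = permAvg S a b := by
  simp only [permAvg, of_apply]
  congr 1
  exact Fintype.sum_equiv (Equiv.mulRight τ) _ _ fun σ => rfl

theorem MomentBound.integrable_coord_mul {κ : ℝ} (h : MomentBound ρ 2 κ) (a b : Fin d) :
    Integrable (fun z : Fin d → ℝ => z a * z b) (Measure.pi fun _ : Fin d => ρ) := by
  have := ((h.memLp_centredSq a b).integrable (by norm_num)).add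
    (integrable_const (if a = b then (1 : ℝ) else 0))
  refine this.congr (ae_of_all _ fun z => ?_)
  simp [centredSq]

theorem MomentBound.integral_coord_mul {κ : ℝ} (h : MomentBound ρ 2 κ)
    (hvar : ∫ x, x ^ 2 ∂ρ = 1) (a b : Fin d) :
    ∫ z : Fin d → ℝ, z a * z b ∂(Measure.pi fun _ : Fin d => ρ) = if a = b then 1 else 0 := by
  by_cases hab : a = b
  · subst hab
    simp_rw [← sq, if_true]
    rw [integral_coord a (F := fun x : ℝ => x ^ 2) (by fun_prop), hvar]
  · rw [if_neg hab]
    refine integral_eq_zero_of_update a fun z => ?_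
    simp_rw [Function.update_self, Function.update_of_ne (Ne.symm hab), integral_mul_const, h.mean,
      zero_mul]

theorem MomentBound.integral_dotProduct_sq {κ : ℝ} (h : MomentBound ρ 2 κ)
    (hvar : ∫ x, x ^ 2 ∂ρ = 1) (v : Fin d → ℝ) :
    Integrable (fun z : Fin d → ℝ => (v ⬝ᵥ z) ^ 2) (Measure.pi fun _ : Fin d => ρ) ∧
    ∫ z : Fin d → ℝ, (v ⬝ᵥ z) ^ 2 ∂(Measure.pi fun _ : Fin d => ρ) = v ⬝ᵥ v := by
  have e : ∀ z : Fin d → ℝ, (v ⬝ᵥ z) ^ 2 = ∑ a, ∑ b, (v a * v b) * (z a * z b) := by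
    intro z
    rw [sq, dotProduct, Finset.sum_mul_sum]
    exact Finset.sum_congr rfl fun a _ => Finset.sum_congr rfl fun b _ => by ring
  have hi : ∀ a b, Integrable (fun z : Fin d → ℝ => (v a * v b) * (z a * z b))
      (Measure.pi fun _ : Fin d => ρ) := fun a b => (h.integrable_coord_mul a b).const_mul _
  simp_rw [e]
  refine ⟨integrable_finsetSum _ fun a _ => integrable_finsetSum _ fun b _ => hi a b, ?_⟩
  rw [integral_finsetSum _ fun a _ => integrable_finsetSum _ fun b _ => hi a b, dotProduct]
  refine Finset.sum_congr rfl fun a _ => ?_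
  rw [integral_finsetSum _ fun b _ => hi a b]
  simp_rw [integral_const_mul, h.integral_coord_mul hvar]
  simp

theorem transpose_mulVec_dotProduct_self (T : Matrix (Fin d) (Fin d) ℝ) (v : Fin d → ℝ) :
    (Tᵀ *ᵥ v) ⬝ᵥ (Tᵀ *ᵥ v) = ∑ a, ∑ b, (T * Tᵀ) a b * (v a * v b) := by
  have : (Tᵀ *ᵥ v) ⬝ᵥ (Tᵀ *ᵥ v) = v ⬝ᵥ ((T * Tᵀ) *ᵥ v) := by
    rw [← mulVec_mulVec, dotProduct_mulVec v T, mulVec_transpose]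
  rw [this]
  simp only [dotProduct, mulVec, Finset.mul_sum]
  exact Finset.sum_congr rfl fun a _ => Finset.sum_congr rfl fun b _ => by ring

/-- The difference between a covariance matrix and its permutation average. -/
noncomputable def covDefect (T : Matrix (Fin d) (Fin d) ℝ) : Matrix (Fin d) (Fin d) ℝ :=
  T * Tᵀ - permAvg (T * Tᵀ)

theorem covDefect_apply (T : Matrix (Fin d) (Fin d) ℝ) (a b : Fin d) :
    covDefect T a b = (T * Tᵀ) a b - (d.factorial : ℝ)⁻¹ *
      ∑ σ : Equiv.Perm (Fin d), (T * Tᵀ) (σ a) (σ b) := rfl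

/-- Integrating out the vector of `y` turns the two squares into quadratic forms of the covariance
matrix `T Tᵀ`. Integrating out its permutation replaces the second matrix by its average over the
group, so only the defect `covDefect T` remains. It vanishes for `T = 1`, which gives degeneracy
under the null hypothesis. -/
theorem integral_obsKernel_right {κ : ℝ} (h : MomentBound ρ 2 κ) (hvar : ∫ x, x ^ 2 ∂ρ = 1)
    (T : Matrix (Fin d) (Fin d) ℝ) (x : Obs d) :
    ∫ y, obsKernel T x y ∂(obsLaw η ρ d)
      = (∫ w, w ^ 2 ∂η) * (x.1 ^ 2 *
        ∑ a, ∑ b, covDefect T a b * ((T *ᵥ x.2.1) a * (T *ᵥ x.2.1) b)) := by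
  set u := T *ᵥ x.2.1 with hu
  -- The permutation of `y` is transferred to the fixed vector, so that the form becomes linear in
  -- the unpermuted `z`.
  let v : Equiv.Perm (Fin d) → Fin d → ℝ := fun q a => u (x.2.2 (q⁻¹ a))
  let g : Equiv.Perm (Fin d) → (Fin d → ℝ) → ℝ := fun q z =>
    x.1 ^ 2 * (((Tᵀ *ᵥ u) ⬝ᵥ z) ^ 2 - ((Tᵀ *ᵥ v q) ⬝ᵥ z) ^ 2)
  have e : ∀ y : Obs d, obsKernel T x y = y.1 ^ 2 * g y.2.2 y.2.1 := by
    intro y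
    have e1 : obsVec T x ⬝ᵥ obsVec T y = x.1 * y.1 * ((Tᵀ *ᵥ u) ⬝ᵥ y.2.1) := by
      rw [mulVec_transpose, ← dotProduct_mulVec]
      simp only [obsVec, dotProduct, Finset.mul_sum, hu]
      exact Finset.sum_congr rfl fun a _ => by ring
    have e2 : (obsVec T x ∘ x.2.2) ⬝ᵥ (obsVec T y ∘ y.2.2)
        = x.1 * y.1 * ((Tᵀ *ᵥ v y.2.2) ⬝ᵥ y.2.1) := by
      rw [mulVec_transpose, ← dotProduct_mulVec]
      simp only [obsVec, dotProduct, Finset.mul_sum, Function.comp_apply, v, hu]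
      rw [← Equiv.sum_comp y.2.2⁻¹]
      refine Finset.sum_congr rfl fun a _ => ?_
      simp only [perm_apply_inv_apply]
      ring
    rw [obsKernel, e1, e2]
    simp only [g]; ring
  have hd : (d.factorial : ℝ) ≠ 0 := by positivity
  have hg : ∀ q, ∫ z, g q z ∂(Measure.pi fun _ : Fin d => ρ)
      = x.1 ^ 2 * (∑ a, ∑ b, (T * Tᵀ) a b * (u a * u b)
        - ∑ a, ∑ b, (T * Tᵀ) a b * (v q a * v q b)) := by
    intro q
    simp only [g]
    rw [integral_const_mul, integral_sub (h.integral_dotProduct_sq hvar _).1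
      (h.integral_dotProduct_sq hvar _).1, (h.integral_dotProduct_sq hvar _).2,
      (h.integral_dotProduct_sq hvar _).2, transpose_mulVec_dotProduct_self,
      transpose_mulVec_dotProduct_self]
  have hv : ∑ q, ∑ a, ∑ b, (T * Tᵀ) a b * (v q a * v q b)
      = ∑ a, ∑ b, (∑ q : Equiv.Perm (Fin d), (T * Tᵀ) (q a) (q b)) * (u a * u b) := by
    have e3 : ∀ q : Equiv.Perm (Fin d), ∑ a, ∑ b, (T * Tᵀ) a b * (v q a * v q b)
        = ∑ a, ∑ b, (T * Tᵀ) ((q * x.2.2⁻¹) a) ((q * x.2.2⁻¹) b) * (u a * u b) := by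
      intro q
      rw [← Equiv.sum_comp (q * x.2.2⁻¹)]
      refine Finset.sum_congr rfl fun a _ => ?_
      rw [← Equiv.sum_comp (q * x.2.2⁻¹)]
      refine Finset.sum_congr rfl fun b _ => ?_
      simp [v]
    rw [Finset.sum_congr rfl fun q _ => e3 q]
    -- Translation by the permutation of `x` is a bijection of the group, so the result no longer
    -- depends on that permutation.
    have e4 : ∑ q : Equiv.Perm (Fin d), ∑ a, ∑ b,
        (T * Tᵀ) ((q * x.2.2⁻¹) a) ((q * x.2.2⁻¹) b) * (u a * u b)
        = ∑ q : Equiv.Perm (Fin d), ∑ a, ∑ b, (T * Tᵀ) (q a) (q b) * (u a * u b) :=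
      Fintype.sum_equiv (Equiv.mulRight (x.2.2⁻¹)) _ _ fun q => rfl
    rw [e4, Finset.sum_comm]
    refine Finset.sum_congr rfl fun a _ => ?_
    rw [Finset.sum_comm]
    simp_rw [Finset.sum_mul]
  have hgm : ∀ q, Measurable (g q) := fun q => by
    simp only [g, dotProduct]; fun_prop
  have hgi : ∀ q, Integrable (g q) (Measure.pi fun _ : Fin d => ρ) := fun q =>
    ((h.integral_dotProduct_sq hvar _).1.sub (h.integral_dotProduct_sq hvar _).1).const_mul _
  simp_rw [e]
  rw [integral_obs_mul (f := fun w => w ^ 2) hgm hgi]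
  simp_rw [hg]
  rw [← Finset.mul_sum, Finset.sum_sub_distrib, hv, Finset.sum_const, Finset.card_univ,
    Fintype.card_perm, Fintype.card_fin, nsmul_eq_mul]
  simp only [covDefect_apply, sub_mul, Finset.sum_sub_distrib]
  simp only [mul_assoc (d.factorial : ℝ)⁻¹, ← Finset.mul_sum]
  field_simp

end Kernel

/-! ### Kernels of finite rank -/

section FiniteRank

variable {E I : Type*} [MeasurableSpace E] [Fintype I] {ν : Measure E} [IsProbabilityMeasure ν]

theorem memLp_two_sum_mul_prod {f g : I → E → ℝ} (hf : ∀ i, MemLp (f i) 2 ν)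
    (hg : ∀ i, MemLp (g i) 2 ν) :
    MemLp (fun e : E × E => ∑ i, f i e.1 * g i e.2) 2 (ν.prod ν) := by
  refine memLp_finsetSum _ fun i _ => ?_
  have := memLp_mul_prod (r := 1) (μ := ν) (ν := ν) (f := f i) (g := g i)
    (by exact_mod_cast hf i) (by exact_mod_cast hg i)
  exact_mod_cast this

theorem integral_finiteRank_sq {ψ : I → E → ℝ} (hψ : ∀ i, MemLp (ψ i) 2 ν) (ε : I → ℝ) :
    ∫ e : E × E, (∑ i, ε i * ψ i e.1 * ψ i e.2) ^ 2 ∂(ν.prod ν)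
      = ∑ i, ∑ j, ε i * ε j * (∫ x, ψ i x * ψ j x ∂ν) ^ 2 := by
  have e : ∀ e : E × E, (∑ i, ε i * ψ i e.1 * ψ i e.2) ^ 2
      = ∑ i, ∑ j, (ε i * ε j) * ((ψ i e.1 * ψ j e.1) * (ψ i e.2 * ψ j e.2)) := by
    intro e
    rw [sq, Finset.sum_mul_sum]
    exact Finset.sum_congr rfl fun i _ => Finset.sum_congr rfl fun j _ => by ring
  have hi : ∀ i j, Integrable (fun e : E × E =>
      (ε i * ε j) * ((ψ i e.1 * ψ j e.1) * (ψ i e.2 * ψ j e.2))) (ν.prod ν) := fun i j =>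
    (((hψ i).integrable_mul (hψ j)).mul_prod ((hψ i).integrable_mul (hψ j))).const_mul _
  simp_rw [e]
  rw [integral_finsetSum _ fun i _ => integrable_finsetSum _ fun j _ => hi i j]
  refine Finset.sum_congr rfl fun i _ => ?_
  rw [integral_finsetSum _ fun j _ => hi i j]
  refine Finset.sum_congr rfl fun j _ => ?_
  rw [integral_const_mul, integral_prod_mul (fun x => ψ i x * ψ j x) (fun x => ψ i x * ψ j x), sq]

/-- Composing the Hilbert–Schmidt operator of `h` with itself costs at most its operator norm. That
norm is at most `K`: by `hB` the map from coefficients to `∑ v i * ψ i` has squared norm at most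
`K`, by duality so has its adjoint, and the signs are isometric. The adjoint bound is `hVle`, where
`V` collects the coefficients of `kernelSq` up to sign. -/
theorem integral_kernelSq_sq_le {ψ : I → E → ℝ} (hψ : ∀ i, MemLp (ψ i) 2 ν) {ε : I → ℝ}
    (hε : ∀ i, ε i ^ 2 = 1) {K : ℝ} (hK : 0 < K)
    (hB : ∀ v : I → ℝ, ∫ x, (∑ i, v i * ψ i x) ^ 2 ∂ν ≤ K * ∑ i, v i ^ 2) {h : E → E → ℝ}
    (hh : ∀ x y, h x y = ∑ i, ε i * ψ i x * ψ i y) :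
    ∫ e, kernelSq ν h e.1 e.2 ^ 2 ∂(ν.prod ν) ≤ K ^ 2 * ∫ e, h e.1 e.2 ^ 2 ∂(ν.prod ν) := by
  let V : I → E → ℝ := fun i s => ∑ j, (ε j * ∫ u, ψ j u * ψ i u ∂ν) * ψ j s
  have hVL : ∀ i, MemLp (V i) 2 ν := fun i => memLp_finsetSum _ fun j _ => (hψ j).const_mul _
  have hhL : ∀ s, MemLp (fun u => h u s) 2 ν := by
    intro s
    have : MemLp (fun u => ∑ i, (ε i * ψ i s) * ψ i u) 2 ν :=
      memLp_finsetSum _ fun i _ => (hψ i).const_mul _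
    refine this.ae_eq (ae_of_all _ fun u => ?_)
    simp only [hh]
    exact Finset.sum_congr rfl fun i _ => by ring
  have hV : ∀ i s, ∫ u, h u s * ψ i u ∂ν = V i s := by
    intro i s
    have e : ∀ u, h u s * ψ i u = ∑ j, (ε j * ψ j s) * (ψ j u * ψ i u) := by
      intro u; rw [hh, Finset.sum_mul]
      exact Finset.sum_congr rfl fun j _ => by ring
    have hi : ∀ j, Integrable (fun u => (ε j * ψ j s) * (ψ j u * ψ i u)) ν := fun j =>
      ((hψ j).integrable_mul (hψ i)).const_mul _
    simp_rw [e]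
    rw [integral_finsetSum _ fun j _ => hi j]
    simp_rw [integral_const_mul, V]
    exact Finset.sum_congr rfl fun j _ => by ring
  have hG : ∀ s t, kernelSq ν h s t = ∑ i, (ε i * V i s) * ψ i t := by
    intro s t
    have e : ∀ u, h u s * h u t = ∑ i, (ε i * ψ i t) * (h u s * ψ i u) := by
      intro u; rw [hh u t, Finset.mul_sum]
      exact Finset.sum_congr rfl fun j _ => by ring
    have hi : ∀ i, Integrable (fun u => (ε i * ψ i t) * (h u s * ψ i u)) ν := fun i =>
      ((hhL s).integrable_mul (hψ i)).const_mul _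
    rw [kernelSq]
    simp_rw [e]
    rw [integral_finsetSum _ fun i _ => hi i]
    simp_rw [integral_const_mul, hV]
    exact Finset.sum_congr rfl fun j _ => by ring
  have hVle : ∀ s, ∑ i, V i s ^ 2 ≤ K * ∫ u, h u s ^ 2 ∂ν := by
    intro s
    have hg : MemLp (fun u => ∑ i, V i s * ψ i u) 2 ν :=
      memLp_finsetSum _ fun i _ => (hψ i).const_mul _
    have e1 : ∑ i, V i s ^ 2 = ∫ u, h u s * ∑ i, V i s * ψ i u ∂ν := by
      have e : ∀ u, h u s * ∑ i, V i s * ψ i u = ∑ i, V i s * (h u s * ψ i u) := by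
        intro u; rw [Finset.mul_sum]
        exact Finset.sum_congr rfl fun j _ => by ring
      have hi : ∀ i, Integrable (fun u => V i s * (h u s * ψ i u)) ν := fun i =>
        ((hhL s).integrable_mul (hψ i)).const_mul _
      simp_rw [e]
      rw [integral_finsetSum _ fun i _ => hi i]
      simp_rw [integral_const_mul, hV, sq]
    -- Young's inequality with weight `K`: by `hB` the last term is at most half of `∑ V²` and is
    -- absorbed into the left side.
    have e2 : ∫ u, h u s * ∑ i, V i s * ψ i u ∂ν
        ≤ ∫ u, (K / 2 * h u s ^ 2 + (2 * K)⁻¹ * (∑ i, V i s * ψ i u) ^ 2) ∂ν := by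
      refine integral_mono ((hhL s).integrable_mul hg)
        (((hhL s).integrable_sq.const_mul _).add (hg.integrable_sq.const_mul _)) fun u => ?_
      generalize h u s = x
      generalize ∑ i, V i s * ψ i u = y
      have : K / 2 * x ^ 2 + (2 * K)⁻¹ * y ^ 2 - x * y = (2 * K)⁻¹ * (K * x - y) ^ 2 := by
        field_simp; ring
      have h2 : 0 ≤ (2 * K)⁻¹ * (K * x - y) ^ 2 := by positivity
      linarith
    rw [integral_add ((hhL s).integrable_sq.const_mul _) (hg.integrable_sq.const_mul _),
      integral_const_mul, integral_const_mul] at e2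
    have e3 := hB (fun i => V i s)
    have e4 : (2 * K)⁻¹ * ∫ u, (∑ i, V i s * ψ i u) ^ 2 ∂ν ≤ 2⁻¹ * ∑ i, V i s ^ 2 := by
      calc _ ≤ (2 * K)⁻¹ * (K * ∑ i, V i s ^ 2) := by gcongr
        _ = _ := by field_simp
    linarith
  have hGL : MemLp (fun e : E × E => kernelSq ν h e.1 e.2) 2 (ν.prod ν) := by
    simp_rw [hG]
    exact memLp_two_sum_mul_prod (fun i => (hVL i).const_mul (ε i)) hψ
  have hhL2 : MemLp (fun e : E × E => h e.1 e.2) 2 (ν.prod ν) := by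
    simp_rw [hh]
    exact memLp_two_sum_mul_prod (fun i => (hψ i).const_mul (ε i)) hψ
  rw [integral_prod _ hGL.integrable_sq, integral_prod_symm _ hhL2.integrable_sq,
    ← integral_const_mul]
  refine integral_mono hGL.integrable_sq.integral_prod_left
    (hhL2.integrable_sq.integral_prod_right.const_mul _) fun s => ?_
  simp only
  calc ∫ t, kernelSq ν h s t ^ 2 ∂ν = ∫ t, (∑ i, (ε i * V i s) * ψ i t) ^ 2 ∂ν := by
        simp_rw [hG]
    _ ≤ K * ∑ i, (ε i * V i s) ^ 2 := hB _
    _ = K * ∑ i, V i s ^ 2 := by simp_rw [mul_pow, hε, one_mul]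
    _ ≤ K * (K * ∫ u, h u s ^ 2 ∂ν) := by gcongr; exact hVle s
    _ = _ := by ring

end FiniteRank

/-! ### The kernel for the identity matrix -/

section Identity

variable {η ρ : Measure ℝ} [IsProbabilityMeasure η] [IsProbabilityMeasure ρ] {d : ℕ}

theorem MomentBound.mono {r s : ℕ} {κ : ℝ} (h : MomentBound ρ r κ) (hs : s ≤ r) :
    MomentBound ρ s κ where
  one_le := h.one_le
  memLp := h.memLp.mono_exponent (by norm_cast; omega)
  mean := h.mean
  moment k hk := h.moment k (hk.trans hs)

/-- The feature map of the kernel `obsKernel 1`. -/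
def nullFeature (i : Bool × Fin d × Fin d) (x : Obs d) : ℝ :=
  x.1 ^ 2 * (if i.1 then centredSq x.2.1 i.2.1 i.2.2
    else centredSq x.2.1 (x.2.2 i.2.1) (x.2.2 i.2.2))

/-- The signs of the kernel `obsKernel 1`. -/
def nullSign (i : Bool × Fin d × Fin d) : ℝ := if i.1 then 1 else -1

theorem nullSign_sq (i : Bool × Fin d × Fin d) : nullSign i ^ 2 = 1 := by
  unfold nullSign; split_ifs <;> norm_num

theorem sum_centredSq_mul (z z' : Fin d → ℝ) :
    ∑ a, ∑ b, centredSq z a b * centredSq z' a b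
      = (z ⬝ᵥ z') ^ 2 - z ⬝ᵥ z - z' ⬝ᵥ z' + d := by
  have e : ∀ a b, centredSq z a b * centredSq z' a b
      = (z a * z' a) * (z b * z' b) - (if a = b then z a * z b else 0)
        - (if a = b then z' a * z' b else 0) + (if a = b then 1 else 0) := by
    intro a b
    unfold centredSq
    split_ifs <;> ring
  simp_rw [e, Finset.sum_add_distrib, Finset.sum_sub_distrib, ← Finset.mul_sum, ← Finset.sum_mul]
  simp [dotProduct, sq]

theorem centredSq_perm (z : Fin d → ℝ) (q : Equiv.Perm (Fin d)) (a b : Fin d) :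
    centredSq z (q a) (q b) = centredSq (z ∘ q) a b := by
  simp [centredSq]

/-- Both squared inner products may be replaced by inner products of the centred matrices `z zᵀ -
1`: the correction terms involve only lengths, which permutations preserve, and so cancel in the
difference. -/
theorem obsKernel_one_eq (x y : Obs d) :
    obsKernel 1 x y = ∑ i, nullSign i * nullFeature i x * nullFeature i y := by
  rw [Fintype.sum_prod_type, Fintype.sum_bool]
  simp only [nullSign, nullFeature, if_true, Bool.false_eq_true, if_false, Fintype.sum_prod_type,
    centredSq_perm]
  have e1 : ∀ z z' : Fin d → ℝ, ∑ a, ∑ b, 1 * (x.1 ^ 2 * centredSq z a b)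
      * (y.1 ^ 2 * centredSq z' a b)
      = (x.1 ^ 2 * y.1 ^ 2) * ((z ⬝ᵥ z') ^ 2 - z ⬝ᵥ z - z' ⬝ᵥ z' + d) := by
    intro z z'
    rw [← sum_centredSq_mul, Finset.mul_sum]
    refine Finset.sum_congr rfl fun a _ => ?_
    rw [Finset.mul_sum]
    exact Finset.sum_congr rfl fun b _ => by ring
  have e2 : ∀ z z' : Fin d → ℝ, ∑ a, ∑ b, -1 * (x.1 ^ 2 * centredSq z a b)
      * (y.1 ^ 2 * centredSq z' a b)
      = -((x.1 ^ 2 * y.1 ^ 2) * ((z ⬝ᵥ z') ^ 2 - z ⬝ᵥ z - z' ⬝ᵥ z' + d)) := by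
    intro z z'
    rw [← e1, ← Finset.sum_neg_distrib]
    refine Finset.sum_congr rfl fun a _ => ?_
    rw [← Finset.sum_neg_distrib]
    exact Finset.sum_congr rfl fun b _ => by ring
  rw [e1, e2]
  have e3 : ∀ (z : Fin d → ℝ) (q : Equiv.Perm (Fin d)), (z ∘ q) ⬝ᵥ (z ∘ q) = z ⬝ᵥ z :=
    fun z q => Equiv.sum_comp q (fun a => z a * z a)
  rw [e3, e3]
  have e4 : obsVec 1 x ⬝ᵥ obsVec 1 y = x.1 * y.1 * (x.2.1 ⬝ᵥ y.2.1) := by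
    simp only [obsVec, one_mulVec, dotProduct, Finset.mul_sum]
    exact Finset.sum_congr rfl fun b _ => by ring
  have e5 : (obsVec 1 x ∘ x.2.2) ⬝ᵥ (obsVec 1 y ∘ y.2.2)
      = x.1 * y.1 * ((x.2.1 ∘ x.2.2) ⬝ᵥ (y.2.1 ∘ y.2.2)) := by
    simp only [obsVec, one_mulVec, dotProduct, Finset.mul_sum, Function.comp_apply]
    exact Finset.sum_congr rfl fun b _ => by ring
  rw [obsKernel, e4, e5]
  ring

theorem measurable_centredSq (a b : Fin d) : Measurable fun z : Fin d → ℝ => centredSq z a b := by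
  unfold centredSq; fun_prop

/-- The part of `nullFeature` depending on the permutation and on the vector. -/
def nullFeatureAux (i : Bool × Fin d × Fin d) (q : Equiv.Perm (Fin d)) (z : Fin d → ℝ) : ℝ :=
  if i.1 then centredSq z i.2.1 i.2.2 else centredSq z (q i.2.1) (q i.2.2)

theorem measurable_nullFeatureAux (i : Bool × Fin d × Fin d) (q : Equiv.Perm (Fin d)) :
    Measurable (nullFeatureAux i q) := by
  unfold nullFeatureAux
  split_ifs <;> exact measurable_centredSq _ _

theorem MomentBound.memLp_nullFeatureAux {κ : ℝ} (h : MomentBound ρ 2 κ)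
    (i : Bool × Fin d × Fin d) (q : Equiv.Perm (Fin d)) :
    MemLp (nullFeatureAux i q) 2 (Measure.pi fun _ : Fin d => ρ) := by
  unfold nullFeatureAux
  split_ifs <;> exact h.memLp_centredSq _ _

theorem memLp_nullFeature {κ b : ℝ} (h : MomentBound ρ 2 κ) (hη : ScaleBound η b)
    (i : Bool × Fin d × Fin d) : MemLp (nullFeature i) 2 (obsLaw η ρ d) := by
  have hm : Measurable (nullFeature i) := by
    have h1 : Measurable (fun u : (Fin d → ℝ) × Equiv.Perm (Fin d) => nullFeatureAux i u.2 u.1) :=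
      measurable_from_prod_countable_left fun q => measurable_nullFeatureAux i q
    exact (measurable_fst.pow_const 2).mul (h1.comp measurable_snd)
  rw [memLp_two_iff_integrable_sq hm.aestronglyMeasurable]
  have := integrable_obs_mul (η := η) (ρ := ρ) (f := fun w => w ^ (2 * 2))
    (g := fun q z => nullFeatureAux i q z ^ 2) (hη.integrable_pow 2)
    (fun q => (measurable_nullFeatureAux i q).pow_const 2)
    (fun q => (h.memLp_nullFeatureAux i q).integrable_sq)
  refine this.congr (ae_of_all _ fun x => ?_)
  simp only [nullFeature, nullFeatureAux]
  ring

theorem integral_nullFeature_mul {κ : ℝ} (h : MomentBound ρ 2 κ)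
    (i j : Bool × Fin d × Fin d) :
    ∫ x, nullFeature i x * nullFeature j x ∂(obsLaw η ρ d)
      = (∫ w, w ^ 4 ∂η) * ((d.factorial : ℝ)⁻¹ * ∑ q,
        ∫ z, nullFeatureAux i q z * nullFeatureAux j q z ∂(Measure.pi fun _ : Fin d => ρ)) := by
  rw [← integral_obs_mul (η := η) (f := fun w => w ^ 4)
    (g := fun q z => nullFeatureAux i q z * nullFeatureAux j q z)
    (fun q => (measurable_nullFeatureAux i q).mul (measurable_nullFeatureAux j q))
    (fun q => (h.memLp_nullFeatureAux i q).integrable_mul (h.memLp_nullFeatureAux j q))]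
  congr 1; ext x
  simp only [nullFeature, nullFeatureAux]
  ring

/-- The Gram operator bound needed in `integral_kernelSq_sq_le`, with a constant free of `d`. Moving
the permutation from the features to the coefficient matrix leaves the Frobenius norm unchanged, so
both halves reduce to the variance of a quadratic form. -/
theorem integral_sum_nullFeature_sq_le {κ b : ℝ} (h : MomentBound ρ 2 κ)
    (hvar : ∫ x, x ^ 2 ∂ρ = 1) (hη : ScaleBound η b) (v : Bool × Fin d × Fin d → ℝ) :
    ∫ x, (∑ i, v i * nullFeature i x) ^ 2 ∂(obsLaw η ρ d)
      ≤ (2 * b ^ 2 * ((∫ x, x ^ 4 ∂ρ) + 1)) * ∑ i, v i ^ 2 := by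
  have hm := one_le_fourth_moment h hvar
  set m := ∫ x, x ^ 4 ∂ρ with hmdef
  let A : Bool → Matrix (Fin d) (Fin d) ℝ := fun β => Matrix.of fun a b => v (β, a, b)
  let g : Equiv.Perm (Fin d) → (Fin d → ℝ) → ℝ := fun q z =>
    2 * (∑ r : Fin d × Fin d, A true r.1 r.2 * centredSq z r.1 r.2) ^ 2
    + 2 * (∑ r : Fin d × Fin d,
      (A false).submatrix (⇑(q⁻¹)) (⇑(q⁻¹)) r.1 r.2 * centredSq z r.1 r.2) ^ 2
  have hL : ∀ B : Matrix (Fin d) (Fin d) ℝ,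
      MemLp (fun z : Fin d → ℝ => ∑ r : Fin d × Fin d, B r.1 r.2 * centredSq z r.1 r.2) 2
        (Measure.pi fun _ : Fin d => ρ) := fun B =>
    memLp_finsetSum _ fun r _ => (h.memLp_centredSq r.1 r.2).const_mul _
  have hgm : ∀ q, Measurable (g q) := by
    intro q
    have := fun r : Fin d × Fin d => measurable_centredSq r.1 r.2
    simp only [g]
    fun_prop
  have hgi : ∀ q, Integrable (g q) (Measure.pi fun _ : Fin d => ρ) := fun q =>
    ((hL _).integrable_sq.const_mul 2).add ((hL _).integrable_sq.const_mul 2)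
  have hfrob : ∀ (B : Matrix (Fin d) (Fin d) ℝ) (q : Equiv.Perm (Fin d)),
      frobSq (B.submatrix q q) = frobSq B := by
    intro B q
    simp only [frobSq, submatrix_apply]
    rw [Equiv.sum_comp q (fun a => ∑ b, B a (q b) ^ 2)]
    exact Finset.sum_congr rfl fun a _ => Equiv.sum_comp q (fun b => B a b ^ 2)
  have hsum : frobSq (A true) + frobSq (A false) = ∑ i, v i ^ 2 := by
    rw [Fintype.sum_prod_type, Fintype.sum_bool, Fintype.sum_prod_type, Fintype.sum_prod_type]
    rfl
  have hgle : ∀ q, ∫ z, g q z ∂(Measure.pi fun _ : Fin d => ρ)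
      ≤ 2 * (m + 1) * ∑ i, v i ^ 2 := by
    intro q
    simp only [g]
    rw [integral_add ((hL _).integrable_sq.const_mul 2) ((hL _).integrable_sq.const_mul 2),
      integral_const_mul, integral_const_mul, ← hsum]
    have h1 := h.integral_sum_mul_centredSq_sq_le hvar (A true)
    have h2 := h.integral_sum_mul_centredSq_sq_le hvar
      ((A false).submatrix (⇑(q⁻¹)) (⇑(q⁻¹)))
    rw [hfrob] at h2
    linarith
  have hpt : ∀ x : Obs d, (∑ i, v i * nullFeature i x) ^ 2
      ≤ x.1 ^ (2 * 2) * g x.2.2 x.2.1 := by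
    intro x
    have e1 : ∑ i, v i * nullFeature i x = x.1 ^ 2 *
        ((∑ r : Fin d × Fin d, A true r.1 r.2 * centredSq x.2.1 r.1 r.2)
        + ∑ r : Fin d × Fin d, (A false).submatrix (⇑(x.2.2⁻¹)) (⇑(x.2.2⁻¹)) r.1 r.2
          * centredSq x.2.1 r.1 r.2) := by
      rw [Fintype.sum_prod_type, Fintype.sum_bool, mul_add, Finset.mul_sum, Finset.mul_sum]
      congr 1
      · refine Finset.sum_congr rfl fun r _ => ?_
        simp only [nullFeature, if_true, A, of_apply]; ring
      · rw [← Equiv.sum_comp (Equiv.prodCongr x.2.2 x.2.2)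
          (fun r => x.1 ^ 2 * ((A false).submatrix (⇑(x.2.2⁻¹)) (⇑(x.2.2⁻¹)) r.1 r.2
          * centredSq x.2.1 r.1 r.2))]
        refine Finset.sum_congr rfl fun r _ => ?_
        simp [nullFeature, A]; ring
    rw [e1]
    simp only [g]
    generalize (∑ r : Fin d × Fin d, A true r.1 r.2 * centredSq x.2.1 r.1 r.2) = s
    generalize (∑ r : Fin d × Fin d, (A false).submatrix (⇑(x.2.2⁻¹)) (⇑(x.2.2⁻¹)) r.1 r.2
          * centredSq x.2.1 r.1 r.2) = t
    have : x.1 ^ (2 * 2) * (2 * s ^ 2 + 2 * t ^ 2) - (x.1 ^ 2 * (s + t)) ^ 2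
        = (x.1 ^ 2 * (s - t)) ^ 2 := by ring
    nlinarith [sq_nonneg (x.1 ^ 2 * (s - t))]
  have hd : (0 : ℝ) < d.factorial := by positivity
  have hvn : 0 ≤ ∑ i, v i ^ 2 := Finset.sum_nonneg fun _ _ => sq_nonneg _
  refine (integral_mono_of_nonneg (ae_of_all _ fun x => sq_nonneg _)
    (integrable_obs_mul (f := fun w => w ^ (2 * 2)) (hη.integrable_pow 2) hgm hgi)
    (ae_of_all _ hpt)).trans ?_
  rw [integral_obs_mul (f := fun w => w ^ (2 * 2)) hgm hgi]
  have h3 : (d.factorial : ℝ)⁻¹ * ∑ q, ∫ z, g q z ∂(Measure.pi fun _ : Fin d => ρ)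
      ≤ 2 * (m + 1) * ∑ i, v i ^ 2 := by
    rw [inv_mul_le_iff₀ hd]
    refine (Finset.sum_le_sum fun q _ => hgle q).trans (le_of_eq ?_)
    rw [Finset.sum_const, Finset.card_univ, Fintype.card_perm, Fintype.card_fin, nsmul_eq_mul]
  have h4 : 0 ≤ ∫ w, w ^ (2 * 2) ∂η := integral_nonneg fun w => by rw [pow_mul]; positivity
  calc _ ≤ (∫ w, w ^ (2 * 2) ∂η) * (2 * (m + 1) * ∑ i, v i ^ 2) :=
        mul_le_mul_of_nonneg_left h3 h4
    _ ≤ b ^ 2 * (2 * (m + 1) * ∑ i, v i ^ 2) :=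
        mul_le_mul_of_nonneg_right (hη.integral_pow_le 2) (mul_nonneg (by linarith) hvn)
    _ = _ := by ring

end Identity

/-! ### The second moment of the kernel for the identity matrix -/

section IdentityGram

variable {d : ℕ}

/-- A fixed pair is correlated with at most two pairs. The function `φ` will be the identity and the
square. -/
theorem sum_comp_centredSqCov (φ : ℝ → ℝ) (h0 : φ 0 = 0) (m : ℝ) (a b : Fin d) :
    ∑ c, ∑ e, φ (centredSqCov m a b c e) = if a = b then φ (m - 1) else 2 * φ 1 := by
  by_cases hab : a = b
  · have e : ∀ c e : Fin d, φ (centredSqCov m a b c e)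
        = if c = a then (if e = a then φ (m - 1) else 0) else 0 := by
      intro c e
      simp only [centredSqCov, hab, if_true]
      by_cases h1 : c = b <;> by_cases h2 : e = b <;> simp [h1, h2, h0]
    simp_rw [e]
    simp [hab]
  · have e : ∀ c e : Fin d, φ (centredSqCov m a b c e)
        = (if c = a then (if e = b then φ 1 else 0) else 0)
          + if c = b then (if e = a then φ 1 else 0) else 0 := by
      intro c e
      simp only [centredSqCov, hab, if_false]
      by_cases h1 : c = a
      · subst h1
        by_cases h2 : e = b <;> simp [hab, h2, h0]
      · by_cases h3 : c = b
        · subst h3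
          by_cases h2 : e = a <;> simp [h1, h2, h0]
        · simp [h1, h3, h0]
    simp_rw [e, Finset.sum_add_distrib]
    simp [hab]
    ring

theorem centredSqCov_perm (m : ℝ) (q : Equiv.Perm (Fin d)) (a b c e : Fin d) :
    centredSqCov m (q a) (q b) (q c) (q e) = centredSqCov m a b c e := by
  simp [centredSqCov]

theorem centredSqCov_nonneg {m : ℝ} (hm : 1 ≤ m) (a b c e : Fin d) :
    0 ≤ centredSqCov m a b c e := by
  unfold centredSqCov; split_ifs <;> linarith

theorem centredSqCov_le {m : ℝ} (hm : 1 ≤ m) (a b c e : Fin d) :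
    centredSqCov m a b c e ≤ m * ((if c = a then 1 else 0) + if c = b then 1 else 0) := by
  unfold centredSqCov
  by_cases hab : a = b
  · subst hab
    by_cases h : c = a
    · simp [h]; split_ifs <;> linarith
    · simp [h]
  · by_cases h1 : c = a
    · subst h1; simp [hab]; split_ifs <;> linarith
    · by_cases h2 : c = b
      · subst h2; simp [h1]; split_ifs <;> linarith
      · simp [h1, h2, hab]

/-- The image of a point under a uniform permutation is uniform: composing with a transposition
shows that all target points have equally many permutations. -/
theorem sum_perm_ite_eq (a c : Fin d) :
    (d : ℝ) * ∑ q : Equiv.Perm (Fin d), (if q c = a then (1 : ℝ) else 0) = d.factorial := by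
  have h1 : ∀ a' : Fin d, ∑ q : Equiv.Perm (Fin d), (if q c = a' then (1 : ℝ) else 0)
      = ∑ q : Equiv.Perm (Fin d), (if q c = a then (1 : ℝ) else 0) := by
    intro a'
    refine Fintype.sum_equiv (Equiv.mulLeft (Equiv.swap a' a)) _ _ fun q => ?_
    have : (Equiv.swap a' a) (q c) = a ↔ q c = a' := by
      rw [Equiv.swap_apply_eq_iff, Equiv.swap_apply_right]
    simp only [Equiv.coe_mulLeft, Equiv.Perm.coe_mul, Function.comp_apply, this]
  have h2 : ∑ a' : Fin d, ∑ q : Equiv.Perm (Fin d), (if q c = a' then (1 : ℝ) else 0)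
      = d.factorial := by
    rw [Finset.sum_comm]
    simp [Fintype.card_perm]
  rw [← h2, Finset.sum_congr rfl fun a' _ => h1 a']
  simp

/-- The covariances averaged over the permutations of one of the index pairs. -/
noncomputable def avgCov (m : ℝ) (a b c e : Fin d) : ℝ :=
  (d.factorial : ℝ)⁻¹ * ∑ q : Equiv.Perm (Fin d), centredSqCov m a b (q c) (q e)

theorem avgCov_nonneg {m : ℝ} (hm : 1 ≤ m) (a b c e : Fin d) : 0 ≤ avgCov m a b c e :=
  mul_nonneg (by positivity) (Finset.sum_nonneg fun _ _ => centredSqCov_nonneg hm _ _ _ _)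

/-- A nonzero covariance requires the random image of `c` to hit `a` or `b`, which has probability
at most `2 / d`. -/
theorem avgCov_le {m : ℝ} (hm : 1 ≤ m) (a b c e : Fin d) : d * avgCov m a b c e ≤ 2 * m := by
  have hd : (0 : ℝ) < d.factorial := by positivity
  have h1 : ∑ q : Equiv.Perm (Fin d), centredSqCov m a b (q c) (q e)
      ≤ m * (∑ q : Equiv.Perm (Fin d), (if q c = a then (1 : ℝ) else 0)
        + ∑ q : Equiv.Perm (Fin d), (if q c = b then (1 : ℝ) else 0)) := by
    rw [← Finset.sum_add_distrib, Finset.mul_sum]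
    exact Finset.sum_le_sum fun q _ => centredSqCov_le hm _ _ _ _
  calc (d : ℝ) * avgCov m a b c e
      = (d.factorial : ℝ)⁻¹ * (d * ∑ q : Equiv.Perm (Fin d), centredSqCov m a b (q c) (q e)) := by
        rw [avgCov]; ring
    _ ≤ (d.factorial : ℝ)⁻¹ * (d * (m * (∑ q : Equiv.Perm (Fin d), (if q c = a then (1 : ℝ) else 0)
        + ∑ q : Equiv.Perm (Fin d), (if q c = b then (1 : ℝ) else 0)))) := by gcongr
    _ = (d.factorial : ℝ)⁻¹ * (m * (d * ∑ q : Equiv.Perm (Fin d), (if q c = a then (1 : ℝ) else 0)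
        + d * ∑ q : Equiv.Perm (Fin d), (if q c = b then (1 : ℝ) else 0))) := by ring
    _ = 2 * m := by
        rw [sum_perm_ite_eq, sum_perm_ite_eq]
        field_simp; ring

theorem sum_avgCov_le {m : ℝ} (hm : 1 ≤ m) (a b : Fin d) :
    ∑ c, ∑ e, avgCov m a b c e ≤ m + 1 := by
  have hd : (0 : ℝ) < d.factorial := by positivity
  have h1 : ∀ q : Equiv.Perm (Fin d), ∑ c, ∑ e, centredSqCov m a b (q c) (q e) ≤ m + 1 := by
    intro q
    rw [Equiv.sum_comp q (fun c => ∑ e, centredSqCov m a b c (q e))]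
    have : ∀ c, ∑ e, centredSqCov m a b c (q e) = ∑ e, centredSqCov m a b c e := fun c =>
      Equiv.sum_comp q (fun e => centredSqCov m a b c e)
    simp_rw [this]
    have := sum_comp_centredSqCov (fun x => x) rfl m a b
    rw [this]
    split_ifs <;> linarith
  have e1 : ∑ c, ∑ e, avgCov m a b c e = (d.factorial : ℝ)⁻¹ *
      ∑ q : Equiv.Perm (Fin d), ∑ c, ∑ e, centredSqCov m a b (q c) (q e) := by
    simp only [avgCov, ← Finset.mul_sum]
    congr 1
    conv_rhs => rw [Finset.sum_comm]
    refine Finset.sum_congr rfl fun c _ => ?_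
    rw [Finset.sum_comm]
  rw [e1, inv_mul_le_iff₀ hd]
  refine (Finset.sum_le_sum fun q _ => h1 q).trans (le_of_eq ?_)
  rw [Finset.sum_const, Finset.card_univ, Fintype.card_perm, Fintype.card_fin, nsmul_eq_mul]

/-- Supremum times sum: every entry is of order `1 / d`, and each of the `d²` rows has bounded sum.
The total is of order `d`, negligible against the main term of order `d²`. -/
theorem sum_avgCov_sq_le {m : ℝ} (hm : 1 ≤ m) :
    ∑ a : Fin d, ∑ b : Fin d, ∑ c, ∑ e, avgCov m a b c e ^ 2 ≤ 2 * m * (m + 1) * d := by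
  rcases Nat.eq_zero_or_pos d with rfl | hd
  · simp
  have hd' : (0 : ℝ) < d := by exact_mod_cast hd
  have h1 : ∀ a b : Fin d, ∑ c, ∑ e, avgCov m a b c e ^ 2 ≤ 2 * m / d * (m + 1) := by
    intro a b
    calc ∑ c, ∑ e, avgCov m a b c e ^ 2 ≤ ∑ c, ∑ e, 2 * m / d * avgCov m a b c e := by
          refine Finset.sum_le_sum fun c _ => Finset.sum_le_sum fun e _ => ?_
          have h2 : avgCov m a b c e ≤ 2 * m / d := by
            rw [le_div_iff₀ hd', mul_comm]; exact avgCov_le hm a b c e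
          rw [sq]
          exact mul_le_mul_of_nonneg_right h2 (avgCov_nonneg hm a b c e)
      _ = 2 * m / d * ∑ c, ∑ e, avgCov m a b c e := by simp_rw [Finset.mul_sum]
      _ ≤ _ := by
          have : 0 ≤ m := by linarith
          gcongr; exact sum_avgCov_le hm a b
  refine (Finset.sum_le_sum fun a _ => Finset.sum_le_sum fun b _ => h1 a b).trans (le_of_eq ?_)
  simp only [Finset.sum_const, Finset.card_univ, Fintype.card_fin, nsmul_eq_mul]
  field_simp

theorem sum_centredSqCov_sq (m : ℝ) :
    ∑ a : Fin d, ∑ b : Fin d, ∑ c, ∑ e, centredSqCov m a b c e ^ 2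
      = 2 * d ^ 2 + ((m - 1) ^ 2 - 2) * d := by
  have h1 : ∀ a b : Fin d, ∑ c, ∑ e, centredSqCov m a b c e ^ 2
      = 2 + if a = b then (m - 1) ^ 2 - 2 else 0 := by
    intro a b
    rw [sum_comp_centredSqCov (fun x => x ^ 2) (by norm_num) m a b]
    split_ifs <;> ring
  simp_rw [h1, Finset.sum_add_distrib]
  simp
  ring

end IdentityGram

/-! ### Leading order of the second moment, and degeneracy -/

section IdentityMoments

variable {η ρ : Measure ℝ} [IsProbabilityMeasure η] [IsProbabilityMeasure ρ] {d : ℕ}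

/-- The Gram matrix of the features has two equal diagonal blocks, since the covariances are
invariant under simultaneous permutation. The mixed blocks involve the averaged covariances and
carry the sign `-1`. -/
theorem integral_obsKernel_one_sq {κ b : ℝ} (h : MomentBound ρ 2 κ)
    (hvar : ∫ x, x ^ 2 ∂ρ = 1) (hη : ScaleBound η b) :
    ∫ e, obsKernel 1 e.1 e.2 ^ 2 ∂((obsLaw η ρ d).prod (obsLaw η ρ d))
      = 2 * (∫ w, w ^ 4 ∂η) ^ 2 *
        (∑ a : Fin d, ∑ b : Fin d, ∑ c, ∑ e, centredSqCov (∫ x, x ^ 4 ∂ρ) a b c e ^ 2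
          - ∑ a : Fin d, ∑ b : Fin d, ∑ c, ∑ e, avgCov (∫ x, x ^ 4 ∂ρ) a b c e ^ 2) := by
  set m := ∫ x, x ^ 4 ∂ρ
  set M := ∫ w, w ^ 4 ∂η
  have hd : (d.factorial : ℝ) ≠ 0 := by positivity
  have htt : ∀ r s : Fin d × Fin d, ∫ x, nullFeature (true, r) x * nullFeature (true, s) x
      ∂(obsLaw η ρ d) = M * centredSqCov m r.1 r.2 s.1 s.2 := by
    intro r s
    rw [integral_nullFeature_mul h]
    simp only [nullFeatureAux, if_true, h.integral_centredSq_mul hvar, Finset.sum_const,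
      Finset.card_univ, Fintype.card_perm, Fintype.card_fin, nsmul_eq_mul]
    rw [inv_mul_cancel_left₀ hd]
  have hff : ∀ r s : Fin d × Fin d, ∫ x, nullFeature (false, r) x * nullFeature (false, s) x
      ∂(obsLaw η ρ d) = M * centredSqCov m r.1 r.2 s.1 s.2 := by
    intro r s
    rw [integral_nullFeature_mul h]
    simp only [nullFeatureAux, Bool.false_eq_true, if_false, h.integral_centredSq_mul hvar,
      centredSqCov_perm, Finset.sum_const,
      Finset.card_univ, Fintype.card_perm, Fintype.card_fin, nsmul_eq_mul]
    rw [inv_mul_cancel_left₀ hd]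
  have htf : ∀ r s : Fin d × Fin d, ∫ x, nullFeature (true, r) x * nullFeature (false, s) x
      ∂(obsLaw η ρ d) = M * avgCov m r.1 r.2 s.1 s.2 := by
    intro r s
    rw [integral_nullFeature_mul h]
    simp only [nullFeatureAux, Bool.false_eq_true, if_false, if_true,
      h.integral_centredSq_mul hvar]
    rfl
  have hft : ∀ r s : Fin d × Fin d, ∫ x, nullFeature (false, r) x * nullFeature (true, s) x
      ∂(obsLaw η ρ d) = M * avgCov m s.1 s.2 r.1 r.2 := by
    intro r s
    rw [← htf]
    simp_rw [mul_comm]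
  simp_rw [obsKernel_one_eq]
  rw [integral_finiteRank_sq (fun i => memLp_nullFeature h hη i)]
  simp_rw [Fintype.sum_prod_type (α₁ := Bool), Fintype.sum_bool, htt, hff, htf, hft]
  simp only [nullSign, if_true, Bool.false_eq_true, if_false, Finset.sum_add_distrib]
  have hswap : ∑ r : Fin d × Fin d, ∑ s : Fin d × Fin d,
      (-1 : ℝ) * 1 * (M * avgCov m s.1 s.2 r.1 r.2) ^ 2
      = ∑ r : Fin d × Fin d, ∑ s : Fin d × Fin d,
      (1 : ℝ) * -1 * (M * avgCov m r.1 r.2 s.1 s.2) ^ 2 := by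
    rw [Finset.sum_comm]; simp
  rw [hswap]
  simp only [mul_pow, Fintype.sum_prod_type, ← Finset.mul_sum, mul_neg, mul_one, one_mul, neg_mul,
    Finset.sum_neg_distrib]
  ring

theorem integral_obsKernel_one_right {κ : ℝ} (h : MomentBound ρ 2 κ) (hvar : ∫ x, x ^ 2 ∂ρ = 1)
    (x : Obs d) : ∫ y, obsKernel 1 x y ∂(obsLaw η ρ d) = 0 := by
  rw [integral_obsKernel_right h hvar]
  have : covDefect (1 : Matrix (Fin d) (Fin d) ℝ) = 0 := by
    simp [covDefect, permAvg_one]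
  simp [this]

/-- Each diagonal block contributes `2 d²` to leading order; the mixed blocks and the fourth-moment
correction on the diagonal are of order `d`. This is where the `8 = 2 · 4` in the limiting variance
comes from. -/
theorem abs_integral_obsKernel_one_sq_sub_le {κ b : ℝ} (h : MomentBound ρ 2 κ)
    (hvar : ∫ x, x ^ 2 ∂ρ = 1) (hη : ScaleBound η b) :
    |∫ e, obsKernel 1 e.1 e.2 ^ 2 ∂((obsLaw η ρ d).prod (obsLaw η ρ d))
      - 4 * (∫ w, w ^ 4 ∂η) ^ 2 * (d : ℝ) ^ 2|
      ≤ 2 * (∫ w, w ^ 4 ∂η) ^ 2 * (((∫ x, x ^ 4 ∂ρ) - 1) ^ 2 + 2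
        + 2 * (∫ x, x ^ 4 ∂ρ) * ((∫ x, x ^ 4 ∂ρ) + 1)) * d := by
  have hm := one_le_fourth_moment h hvar
  rw [integral_obsKernel_one_sq h hvar hη, sum_centredSqCov_sq]
  have hR := sum_avgCov_sq_le (d := d) hm
  have hR0 : 0 ≤ ∑ a : Fin d, ∑ b : Fin d, ∑ c, ∑ e, avgCov (∫ x, x ^ 4 ∂ρ) a b c e ^ 2 :=
    Finset.sum_nonneg fun _ _ => Finset.sum_nonneg fun _ _ => Finset.sum_nonneg fun _ _ =>
      Finset.sum_nonneg fun _ _ => sq_nonneg _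
  generalize ∑ a : Fin d, ∑ b : Fin d, ∑ c, ∑ e, avgCov (∫ x, x ^ 4 ∂ρ) a b c e ^ 2 = R at hR hR0 ⊢
  generalize ∫ x, x ^ 4 ∂ρ = m at *
  generalize ∫ w, w ^ 4 ∂η = M at *
  have hd : (0 : ℝ) ≤ d := Nat.cast_nonneg d
  have e : 2 * M ^ 2 * (2 * (d : ℝ) ^ 2 + ((m - 1) ^ 2 - 2) * d - R) - 4 * M ^ 2 * (d : ℝ) ^ 2
      = 2 * M ^ 2 * (((m - 1) ^ 2 - 2) * d - R) := by ring
  rw [e, abs_mul, abs_of_nonneg (by positivity : 0 ≤ 2 * M ^ 2),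
    mul_assoc (2 * M ^ 2) ((m - 1) ^ 2 + 2 + 2 * m * (m + 1))]
  refine mul_le_mul_of_nonneg_left ?_ (by positivity)
  have h1 : 0 ≤ (m - 1) ^ 2 * d := by positivity
  rw [abs_le]
  constructor
  · linarith
  · have : 0 ≤ 2 * m * (m + 1) * d := by positivity
    linarith

end IdentityMoments

/-! ### Asymptotic normality under the null hypothesis -/

section NullLimit

variable {η ρ : Measure ℝ} [IsProbabilityMeasure η] [IsProbabilityMeasure ρ]

theorem frobSq_one (d : ℕ) : frobSq (1 : Matrix (Fin d) (Fin d) ℝ) = d := by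
  simp [frobSq, one_apply]

/-- The kernel of the rescaled test statistic. -/
noncomputable def statKernel {d : ℕ} (n : ℕ) (T : Matrix (Fin d) (Fin d) ℝ) (x y : Obs d) : ℝ :=
  ((d : ℝ) * n)⁻¹ * obsKernel T x y

/-- After rescaling by `(p n)⁻¹` the fourth moment condition holds because the kernel has fourth
moment of order `p⁴`, and the squared operator contributes order `p⁻²` because its norm bound is
uniform in the dimension. -/
theorem tendsto_integral_cexp_statKernel {κ b : ℝ} (h : MomentBound ρ 4 κ)
    (hvar : ∫ x, x ^ 2 ∂ρ = 1) (hη : ScaleBound η b) {p : ℕ → ℕ} (hp : Tendsto p atTop atTop)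
    (t : ℝ) :
    Tendsto (fun n : ℕ => ∫ x : Fin n → Obs (p n),
      Complex.exp ((t * pairSum (statKernel n 1) x : ℝ) * Complex.I)
        ∂(Measure.pi fun _ => obsLaw η ρ (p n))) atTop
      (𝓝 (Complex.exp (-((8 * (∫ w, w ^ 4 ∂η) ^ 2) * t ^ 2 / 2 : ℝ)))) := by
  have h2 : MomentBound ρ 2 κ := h.mono (by norm_num)
  have hm := one_le_fourth_moment h2 hvar
  have hb := hη.1
  have hF := h.formConst_pos
  set M := ∫ w, w ^ 4 ∂η with hM
  set m := ∫ x, x ^ 4 ∂ρ with hmdef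
  set L := 2 * M ^ 2 * ((m - 1) ^ 2 + 2 + 2 * m * (m + 1)) with hL
  have hpos : ∀ᶠ n in atTop, 0 < p n := hp.eventually_gt_atTop 0
  have hpinv : Tendsto (fun n => ((p n : ℕ) : ℝ)⁻¹) atTop (𝓝 0) :=
    tendsto_inv_atTop_zero.comp (tendsto_natCast_atTop_atTop.comp hp)
  have hbd : ∀ d : ℕ, |∫ e, obsKernel 1 e.1 e.2 ^ 2 ∂((obsLaw η ρ d).prod (obsLaw η ρ d))
      - 4 * M ^ 2 * (d : ℝ) ^ 2| ≤ L * d := fun d =>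
    abs_integral_obsKernel_one_sq_sub_le h2 hvar hη
  have hratio : Tendsto (fun n => (∫ e, obsKernel 1 e.1 e.2 ^ 2
      ∂((obsLaw η ρ (p n)).prod (obsLaw η ρ (p n)))) / (p n : ℝ) ^ 2) atTop (𝓝 (4 * M ^ 2)) := by
    rw [tendsto_iff_norm_sub_tendsto_zero]
    have hz : Tendsto (fun n => L * ((p n : ℕ) : ℝ)⁻¹) atTop (𝓝 0) := by
      simpa using hpinv.const_mul L
    refine squeeze_zero' (Eventually.of_forall fun _ => norm_nonneg _) ?_ hz
    filter_upwards [hpos] with n hn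
    have hn' : (0 : ℝ) < p n := by exact_mod_cast hn
    have := hbd (p n)
    rw [Real.norm_eq_abs]
    have e : (∫ e, obsKernel 1 e.1 e.2 ^ 2
      ∂((obsLaw η ρ (p n)).prod (obsLaw η ρ (p n)))) / (p n : ℝ) ^ 2 - 4 * M ^ 2
      = ((∫ e, obsKernel 1 e.1 e.2 ^ 2
      ∂((obsLaw η ρ (p n)).prod (obsLaw η ρ (p n)))) - 4 * M ^ 2 * (p n : ℝ) ^ 2)
        / (p n : ℝ) ^ 2 := by field_simp
    rw [e, abs_div, abs_of_pos (by positivity : (0 : ℝ) < (p n : ℝ) ^ 2), div_le_iff₀ (by positivity)]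
    calc _ ≤ L * p n := this
      _ = _ := by field_simp
  refine tendsto_integral_cexp_pairSum (b := 2 * (b ^ 8 * formConst 4 κ ^ 2)) ?_ ?_ ?_ ?_
    (by positivity) ?_ ?_ ?_ t
  · intro n
    exact (measurable_obsKernel 1).const_mul _
  · intro n
    have := (obsKernel_bounds (s := 2) (d := p n) h hη (transpose_one)).1.const_mul
      (((p n : ℝ) * n)⁻¹)
    norm_num at this
    refine (congrArg (fun f => MemLp f 4 _) ?_).mp this
    ext e
    simp [statKernel, Function.uncurry]
  · intro n x y
    simp only [statKernel, obsKernel_symm 1 x y]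
  · intro n x
    simp only [statKernel]
    rw [integral_const_mul, integral_obsKernel_one_right h2 hvar, mul_zero]
  · filter_upwards [hpos, eventually_gt_atTop 0] with n hn hn0
    have hn' : (0 : ℝ) < p n := by exact_mod_cast hn
    have hn0' : (0 : ℝ) < n := by exact_mod_cast hn0
    simp only [statKernel, mul_pow]
    rw [integral_const_mul]
    have := (obsKernel_bounds (s := 2) (d := p n) h hη (transpose_one)).2
    rw [Matrix.mul_one, frobSq_one] at this
    norm_num at this
    calc _ = ((p n : ℝ) ^ 4)⁻¹ * ∫ e, obsKernel 1 e.1 e.2 ^ 4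
          ∂((obsLaw η ρ (p n)).prod (obsLaw η ρ (p n))) := by
          field_simp
      _ ≤ ((p n : ℝ) ^ 4)⁻¹ * (2 * (b ^ 8 * (formConst 4 κ ^ 2 * (p n : ℝ) ^ 4))) := by gcongr
      _ = _ := by field_simp
  -- The added `1` keeps the constant strictly positive even when `b = 0`.
  · have hK : 0 < 2 * b ^ 2 * (m + 1) + 1 := by positivity
    have hz : Tendsto (fun n => (2 * b ^ 2 * (m + 1) + 1) ^ 2 * (4 * M ^ 2 + L)
        * ((p n : ℕ) : ℝ)⁻¹ ^ 2) atTop (𝓝 0) := by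
      simpa using (hpinv.pow 2).const_mul ((2 * b ^ 2 * (m + 1) + 1) ^ 2 * (4 * M ^ 2 + L))
    refine squeeze_zero' (Eventually.of_forall fun n => ?_) ?_ hz
    · have : 0 ≤ ∫ e, kernelSq (obsLaw η ρ (p n)) (statKernel n 1) e.1 e.2 ^ 2
          ∂((obsLaw η ρ (p n)).prod (obsLaw η ρ (p n))) := integral_nonneg fun _ => sq_nonneg _
      positivity
    filter_upwards [hpos, eventually_gt_atTop 0] with n hn hn0
    have hn' : (1 : ℝ) ≤ p n := by exact_mod_cast hn
    have hn0' : (0 : ℝ) < n := by exact_mod_cast hn0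
    have e : ∀ x y : Obs (p n), kernelSq (obsLaw η ρ (p n)) (statKernel n 1) x y
        = (((p n : ℝ) * n)⁻¹ ^ 2) * kernelSq (obsLaw η ρ (p n)) (obsKernel 1) x y := by
      intro x y
      simp only [kernelSq, statKernel]
      rw [← integral_const_mul]
      congr 1; ext u; ring
    simp_rw [e, mul_pow]
    rw [integral_const_mul]
    have hk := integral_kernelSq_sq_le (ν := obsLaw η ρ (p n)) (ψ := nullFeature)
      (fun i => memLp_nullFeature h2 hη i) nullSign_sq hK
      (fun v => (integral_sum_nullFeature_sq_le h2 hvar hη v).trans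
        (mul_le_mul_of_nonneg_right (by linarith)
          (Finset.sum_nonneg fun _ _ => sq_nonneg _))) (h := obsKernel 1) obsKernel_one_eq
    have h3 := (abs_le.1 (hbd (p n))).2
    have hL0 : 0 ≤ L := by positivity
    have h4 : ∫ e, obsKernel 1 e.1 e.2 ^ 2 ∂((obsLaw η ρ (p n)).prod (obsLaw η ρ (p n)))
        ≤ (4 * M ^ 2 + L) * (p n : ℝ) ^ 2 := by
      have : L * (p n : ℝ) ≤ L * (p n : ℝ) ^ 2 := by gcongr; exact le_self_pow₀ hn' (by norm_num)
      linarith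
    calc _ = ((p n : ℝ) ^ 4)⁻¹ * ∫ e, kernelSq (obsLaw η ρ (p n)) (obsKernel 1) e.1 e.2 ^ 2
          ∂((obsLaw η ρ (p n)).prod (obsLaw η ρ (p n))) := by
          field_simp
      _ ≤ ((p n : ℝ) ^ 4)⁻¹ * ((2 * b ^ 2 * (m + 1) + 1) ^ 2 *
          ((4 * M ^ 2 + L) * (p n : ℝ) ^ 2)) := by
          gcongr
          exact hk.trans (mul_le_mul_of_nonneg_left h4 (by positivity))
      _ = _ := by field_simp
  · have hn1 : Tendsto (fun n : ℕ => 1 - (n : ℝ)⁻¹) atTop (𝓝 1) := by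
      simpa using (tendsto_const_nhds (x := (1 : ℝ))).sub
        (tendsto_inv_atTop_nhds_zero_nat (𝕜 := ℝ))
    have := (hn1.mul hratio).const_mul 2
    have e8 : 2 * (1 * (4 * M ^ 2)) = 8 * M ^ 2 := by ring
    rw [e8] at this
    refine this.congr' ?_
    filter_upwards [hpos, eventually_gt_atTop 0] with n hn hn0
    have hn' : (0 : ℝ) < p n := by exact_mod_cast hn
    have hn0' : (0 : ℝ) < n := by exact_mod_cast hn0
    simp only [statKernel, mul_pow]
    rw [integral_const_mul]
    field_simp

end NullLimit

/-! ### The empirical spectral moments -/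

section EmpiricalMoments

theorem integral_sum_sub_sq_le {ι E : Type*} [Fintype ι] [DecidableEq ι] [MeasurableSpace E]
    {ν : Measure E}
    [IsProbabilityMeasure ν] {f : E → ℝ} (hf : MemLp f 2 ν) :
    ∫ x : ι → E, (∑ i, f (x i) - Fintype.card ι * ∫ e, f e ∂ν) ^ 2 ∂(Measure.pi fun _ : ι => ν)
      ≤ Fintype.card ι * ∫ e, f e ^ 2 ∂ν := by
  have h1 := variance_sum_pi (μ := fun _ : ι => ν) (X := fun _ => f) fun _ => hf
  have hL : ∀ i : ι, MemLp (fun x : ι → E => f (x i)) 2 (Measure.pi fun _ : ι => ν) := fun i =>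
    hf.comp_measurePreserving (measurePreserving_eval (fun _ : ι => ν) i)
  have h2 : ∫ x : ι → E, (∑ i, fun ω : ι → E => f (ω i)) x ∂(Measure.pi fun _ : ι => ν)
      = Fintype.card ι * ∫ e, f e ∂ν := by
    simp_rw [Finset.sum_apply]
    rw [integral_finsetSum _ fun i _ => (hL i).integrable (by norm_num)]
    simp_rw [fun i : ι => integral_coord (ν := ν) i hf.1]
    simp
  rw [variance_eq_integral (Finset.aemeasurable_sum _ fun i _ => (hL i).1.aemeasurable), h2] at h1
  simp only [Finset.sum_apply, Finset.sum_const, Finset.card_univ, nsmul_eq_mul] at h1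
  rw [h1]
  have := variance_le_expectation_sq (X := f) (μ := ν) hf.1
  simp only [Pi.pow_apply] at this
  gcongr

variable {η ρ : Measure ℝ} [IsProbabilityMeasure η] [IsProbabilityMeasure ρ] {d : ℕ}

/-- The squared length of the observed vector. -/
def obsSq (T : Matrix (Fin d) (Fin d) ℝ) (x : Obs d) : ℝ := obsVec T x ⬝ᵥ obsVec T x

/-- The squared inner product of two observed vectors. -/
def sqKernel (T : Matrix (Fin d) (Fin d) ℝ) (x y : Obs d) : ℝ := (obsVec T x ⬝ᵥ obsVec T y) ^ 2

theorem obsSq_pow (T : Matrix (Fin d) (Fin d) ℝ) (x : Obs d) (r : ℕ) :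
    obsSq T x ^ r = x.1 ^ (2 * r) * (∑ a, (T *ᵥ x.2.1) a ^ 2) ^ r := by
  rw [pow_mul, ← mul_pow]
  congr 1
  simp only [obsSq, obsVec, dotProduct, Finset.mul_sum]
  exact Finset.sum_congr rfl fun a _ => by ring

theorem measurable_sum_mulVec_sq (T : Matrix (Fin d) (Fin d) ℝ) :
    Measurable fun z : Fin d → ℝ => ∑ a, (T *ᵥ z) a ^ 2 := by
  simp only [mulVec, dotProduct]; fun_prop

theorem measurable_obsSq (T : Matrix (Fin d) (Fin d) ℝ) : Measurable (obsSq T) := by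
  have : obsSq T = fun x => x.1 ^ 2 * ∑ a, (T *ᵥ x.2.1) a ^ 2 := by
    ext x; simpa using obsSq_pow T x 1
  rw [this]
  exact (measurable_fst.pow_const 2).mul
    ((measurable_sum_mulVec_sq T).comp (measurable_fst.comp measurable_snd))

theorem obsSq_moments {r : ℕ} {κ b : ℝ} (h : MomentBound ρ r κ) (hη : ScaleBound η b)
    (T : Matrix (Fin d) (Fin d) ℝ) :
    Integrable (fun x => obsSq T x ^ r) (obsLaw η ρ d) ∧
    ∫ x, obsSq T x ^ r ∂(obsLaw η ρ d) ≤ b ^ r * (formConst r κ * frobSq T ^ r) := by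
  have hgm : ∀ _ : Equiv.Perm (Fin d), Measurable fun z : Fin d → ℝ =>
      (∑ a, (T *ᵥ z) a ^ 2) ^ r := fun _ => (measurable_sum_mulVec_sq T).pow_const r
  have hgi : ∀ _ : Equiv.Perm (Fin d), Integrable (fun z : Fin d → ℝ =>
      (∑ a, (T *ᵥ z) a ^ 2) ^ r) (Measure.pi fun _ : Fin d => ρ) := fun _ =>
    h.integrable_sum_mulVec_sq_pow T
  have hd : (d.factorial : ℝ) ≠ 0 := by positivity
  simp_rw [obsSq_pow]
  refine ⟨integrable_obs_mul (f := fun w => w ^ (2 * r)) (hη.integrable_pow r) hgm hgi, ?_⟩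
  rw [integral_obs_mul (f := fun w => w ^ (2 * r)) hgm hgi, Finset.sum_const, Finset.card_univ,
    Fintype.card_perm, Fintype.card_fin, nsmul_eq_mul, inv_mul_cancel_left₀ hd]
  have h0 : 0 ≤ ∫ z : Fin d → ℝ, (∑ a, (T *ᵥ z) a ^ 2) ^ r ∂(Measure.pi fun _ : Fin d => ρ) :=
    integral_nonneg fun z => pow_nonneg (Finset.sum_nonneg fun _ _ => sq_nonneg _) _
  have hb := hη.1
  exact mul_le_mul (hη.integral_pow_le r) (h.integral_sum_mulVec_sq_pow_le T) h0 (by positivity)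

theorem memLp_obsSq_sq {κ b : ℝ} (h : MomentBound ρ 4 κ) (hη : ScaleBound η b)
    (T : Matrix (Fin d) (Fin d) ℝ) : MemLp (fun x => obsSq T x ^ 2) 2 (obsLaw η ρ d) := by
  rw [memLp_two_iff_integrable_sq ((measurable_obsSq T).pow_const 2).aestronglyMeasurable]
  simpa only [← pow_mul] using (obsSq_moments h hη T).1

theorem memLp_obsSq {κ b : ℝ} (h : MomentBound ρ 2 κ) (hη : ScaleBound η b)
    (T : Matrix (Fin d) (Fin d) ℝ) : MemLp (obsSq T) 2 (obsLaw η ρ d) := by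
  rw [memLp_two_iff_integrable_sq (measurable_obsSq T).aestronglyMeasurable]
  exact (obsSq_moments h hη T).1

theorem sqKernel_bounds {s : ℕ} {κ b : ℝ} (h : MomentBound ρ s κ) (hη : ScaleBound η b)
    (T : Matrix (Fin d) (Fin d) ℝ) :
    Integrable (fun e : Obs d × Obs d => sqKernel T e.1 e.2 ^ s)
      ((obsLaw η ρ d).prod (obsLaw η ρ d)) ∧
    ∫ e, sqKernel T e.1 e.2 ^ s ∂((obsLaw η ρ d).prod (obsLaw η ρ d))
      ≤ b ^ (2 * s) * (formConst s κ ^ 2 * frobSq (Tᵀ * T) ^ s) := by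
  obtain ⟨h1, h2⟩ := obsForm_bounds h hη (fun _ _ => Tᵀ * T) (fun _ _ => le_rfl)
  have e : ∀ x y, sqKernel T x y ^ s = obsForm (fun _ _ => Tᵀ * T) x y ^ (2 * s) := by
    intro x y; rw [sqKernel, obsVec_dotProduct, pow_mul]
  simp_rw [e]
  exact ⟨MemLp.integrable_pow_of_le h1 le_rfl, h2⟩

theorem measurable_sqKernel (T : Matrix (Fin d) (Fin d) ℝ) :
    Measurable (Function.uncurry (sqKernel T)) := by
  have : Function.uncurry (sqKernel T)
      = fun e => Function.uncurry (obsForm fun _ _ => Tᵀ * T) e ^ 2 := by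
    ext e; simp only [Function.uncurry, sqKernel, obsVec_dotProduct]
  rw [this]
  exact (measurable_obsForm _).pow_const 2

/-- The first empirical spectral moment. -/
noncomputable def fstMoment {n : ℕ} (T : Matrix (Fin d) (Fin d) ℝ) (x : Fin n → Obs d) : ℝ :=
  ((d : ℝ) * n)⁻¹ * ∑ i, obsSq T (x i)

/-- The contribution of the diagonal pairs to the second empirical spectral moment. -/
noncomputable def diagMoment {n : ℕ} (T : Matrix (Fin d) (Fin d) ℝ) (x : Fin n → Obs d) : ℝ :=
  ((d : ℝ) * n ^ 2)⁻¹ * ∑ i, obsSq T (x i) ^ 2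

/-- The contribution of the pairs of distinct indices to the second empirical spectral moment. -/
noncomputable def offDiagMoment {n : ℕ} (T : Matrix (Fin d) (Fin d) ℝ) (x : Fin n → Obs d) : ℝ :=
  ((d : ℝ) * n ^ 2)⁻¹ * pairSum (sqKernel T) x

theorem integral_obsSq_one {κ : ℝ} (h : MomentBound ρ 2 κ) (hvar : ∫ x, x ^ 2 ∂ρ = 1) :
    ∫ x, obsSq 1 x ∂(obsLaw η ρ d) = (∫ w, w ^ 2 ∂η) * d := by
  have e : ∀ x : Obs d, obsSq 1 x = x.1 ^ 2 * ∑ a, x.2.1 a * x.2.1 a := by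
    intro x
    simpa [sq] using obsSq_pow 1 x 1
  have hgi : ∀ _ : Equiv.Perm (Fin d), Integrable (fun z : Fin d → ℝ => ∑ a, z a * z a)
      (Measure.pi fun _ : Fin d => ρ) := fun _ =>
    integrable_finsetSum _ fun a _ => h.integrable_coord_mul a a
  have hd : (d.factorial : ℝ) ≠ 0 := by positivity
  simp_rw [e]
  rw [integral_obs_mul (f := fun w => w ^ 2) (g := fun _ z => ∑ a, z a * z a)
    (fun _ => by fun_prop) hgi, Finset.sum_const, Finset.card_univ,
    Fintype.card_perm, Fintype.card_fin, nsmul_eq_mul, inv_mul_cancel_left₀ hd,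
    integral_finsetSum _ fun a _ => h.integrable_coord_mul a a]
  simp_rw [h.integral_coord_mul hvar]
  simp

theorem integral_sqKernel_one {κ b : ℝ} (h : MomentBound ρ 2 κ) (hvar : ∫ x, x ^ 2 ∂ρ = 1)
    (hη : ScaleBound η b) :
    ∫ e : Obs d × Obs d, sqKernel 1 e.1 e.2 ∂((obsLaw η ρ d).prod (obsLaw η ρ d))
      = (∫ w, w ^ 2 ∂η) ^ 2 * d := by
  have hi : Integrable (fun e : Obs d × Obs d => sqKernel 1 e.1 e.2)
      ((obsLaw η ρ d).prod (obsLaw η ρ d)) := by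
    simpa using (sqKernel_bounds (h.mono one_le_two) hη (1 : Matrix (Fin d) (Fin d) ℝ)).1
  rw [integral_prod _ hi]
  have hd : (d.factorial : ℝ) ≠ 0 := by positivity
  have hr : ∀ x : Obs d, ∫ y, sqKernel 1 x y ∂(obsLaw η ρ d) = (∫ w, w ^ 2 ∂η) * obsSq 1 x := by
    intro x
    have e : ∀ y : Obs d, sqKernel 1 x y = y.1 ^ 2 * (obsVec 1 x ⬝ᵥ y.2.1) ^ 2 := by
      intro y
      rw [sqKernel, ← mul_pow]
      congr 1
      simp only [obsVec, one_mulVec, dotProduct, Finset.mul_sum]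
      exact Finset.sum_congr rfl fun a _ => by ring
    simp_rw [e]
    rw [integral_obs_mul (f := fun w => w ^ 2) (g := fun _ z => (obsVec 1 x ⬝ᵥ z) ^ 2)
      (fun _ => by simp only [dotProduct]; fun_prop)
      (fun _ => (h.integral_dotProduct_sq hvar _).1), Finset.sum_const, Finset.card_univ,
      Fintype.card_perm, Fintype.card_fin, nsmul_eq_mul, inv_mul_cancel_left₀ hd,
      (h.integral_dotProduct_sq hvar _).2]
    rfl
  simp_rw [hr]
  rw [integral_const_mul, integral_obsSq_one h hvar]
  ring

/-- The squared length of `z` is `d` plus the centred quadratic form `S` of the identity, whose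
variance is of order `d`; hence its second moment is `d² + O(d)`. -/
theorem integral_obsSq_one_sq {κ : ℝ} (h : MomentBound ρ 2 κ) (hvar : ∫ x, x ^ 2 ∂ρ = 1) :
    |∫ x, obsSq 1 x ^ 2 ∂(obsLaw η ρ d) - (∫ w, w ^ 4 ∂η) * (d : ℝ) ^ 2|
      ≤ (∫ w, w ^ 4 ∂η) * (((∫ x, x ^ 4 ∂ρ) + 1) * d) := by
  let S : (Fin d → ℝ) → ℝ := fun z =>
    ∑ q : Fin d × Fin d, (1 : Matrix (Fin d) (Fin d) ℝ) q.1 q.2 * centredSq z q.1 q.2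
  have hSL : MemLp S 2 (Measure.pi fun _ : Fin d => ρ) :=
    memLp_finsetSum _ fun q _ => (h.memLp_centredSq q.1 q.2).const_mul _
  have hSe : ∀ z, S z = ∑ a, z a * z a - d := by
    intro z
    simp only [S, Fintype.sum_prod_type, one_apply, ite_mul, zero_mul, one_mul]
    simp [centredSq]
  have hz : ∀ z : Fin d → ℝ, (∑ a, ((1 : Matrix (Fin d) (Fin d) ℝ) *ᵥ z) a ^ 2) ^ 2
      = S z ^ 2 + 2 * d * S z + (d : ℝ) ^ 2 := by
    intro z
    rw [hSe, one_mulVec]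
    simp only [← sq]
    ring
  have hS0 : ∫ z, S z ∂(Measure.pi fun _ : Fin d => ρ) = 0 := by
    simp_rw [hSe]
    rw [integral_sub (integrable_finsetSum _ fun a _ => h.integrable_coord_mul a a)
      (integrable_const _), integral_finsetSum _ fun a _ => h.integrable_coord_mul a a]
    simp_rw [h.integral_coord_mul hvar]
    simp
  have hI : ∫ z : Fin d → ℝ, (∑ a, ((1 : Matrix (Fin d) (Fin d) ℝ) *ᵥ z) a ^ 2) ^ 2
      ∂(Measure.pi fun _ : Fin d => ρ)
      = ∫ z, S z ^ 2 ∂(Measure.pi fun _ : Fin d => ρ) + (d : ℝ) ^ 2 := by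
    have i1 := hSL.integrable_sq
    have i2 := (hSL.integrable (by norm_num)).const_mul (2 * (d : ℝ))
    simp_rw [hz]
    have s1 := integral_add (i1.add i2)
      (integrable_const (μ := Measure.pi fun _ : Fin d => ρ) ((d : ℝ) ^ 2))
    simp only [Pi.add_apply] at s1
    rw [s1, integral_add i1 i2, integral_const_mul, hS0]
    simp
  have hd : (d.factorial : ℝ) ≠ 0 := by positivity
  simp_rw [obsSq_pow]
  rw [integral_obs_mul (f := fun w => w ^ (2 * 2))
    (g := fun _ z => (∑ a, ((1 : Matrix (Fin d) (Fin d) ℝ) *ᵥ z) a ^ 2) ^ 2)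
    (fun _ => (measurable_sum_mulVec_sq 1).pow_const 2)
    (fun _ => h.integrable_sum_mulVec_sq_pow 1), Finset.sum_const, Finset.card_univ,
    Fintype.card_perm, Fintype.card_fin, nsmul_eq_mul, inv_mul_cancel_left₀ hd, hI]
  have hS := h.integral_sum_mul_centredSq_sq_le hvar (1 : Matrix (Fin d) (Fin d) ℝ)
  rw [frobSq_one] at hS
  have hS' : 0 ≤ ∫ z, S z ^ 2 ∂(Measure.pi fun _ : Fin d => ρ) :=
    integral_nonneg fun _ => sq_nonneg _
  have hM : 0 ≤ ∫ w, w ^ 4 ∂η := integral_nonneg fun _ => by positivity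
  norm_num
  have e : (∫ w, w ^ 4 ∂η) * (∫ z, S z ^ 2 ∂(Measure.pi fun _ : Fin d => ρ) + (d : ℝ) ^ 2)
      - (∫ w, w ^ 4 ∂η) * (d : ℝ) ^ 2
      = (∫ w, w ^ 4 ∂η) * ∫ z, S z ^ 2 ∂(Measure.pi fun _ : Fin d => ρ) := by ring
  rw [e, abs_of_nonneg (by positivity)]
  gcongr

theorem integral_fstMoment_sub_sq_le {κ b : ℝ} (h : MomentBound ρ 2 κ)
    (hvar : ∫ x, x ^ 2 ∂ρ = 1) (hη : ScaleBound η b) (hd : 0 < d) {n : ℕ} (hn : 0 < n) :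
    MemLp (fun x : Fin n → Obs d => fstMoment 1 x - ∫ w, w ^ 2 ∂η) 2
      (Measure.pi fun _ => obsLaw η ρ d) ∧
    ∫ x : Fin n → Obs d, (fstMoment 1 x - ∫ w, w ^ 2 ∂η) ^ 2 ∂(Measure.pi fun _ => obsLaw η ρ d)
      ≤ (b ^ 2 * formConst 2 κ) * (n : ℝ)⁻¹ := by
  have hd' : (0 : ℝ) < d := by exact_mod_cast hd
  have hn' : (0 : ℝ) < n := by exact_mod_cast hn
  have hL := memLp_obsSq h hη (1 : Matrix (Fin d) (Fin d) ℝ)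
  have hLi : ∀ i : Fin n, MemLp (fun x : Fin n → Obs d => obsSq 1 (x i)) 2
      (Measure.pi fun _ => obsLaw η ρ d) := fun i =>
    hL.comp_measurePreserving (measurePreserving_eval (fun _ : Fin n => obsLaw η ρ d) i)
  refine ⟨((memLp_finsetSum _ fun i _ => hLi i).const_mul _).sub (memLp_const _), ?_⟩
  have h1 := integral_sum_sub_sq_le (ι := Fin n) hL
  rw [integral_obsSq_one h hvar, Fintype.card_fin] at h1
  have h2 := (obsSq_moments h hη (1 : Matrix (Fin d) (Fin d) ℝ)).2
  rw [frobSq_one] at h2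
  have e : ∀ x : Fin n → Obs d, (fstMoment 1 x - ∫ w, w ^ 2 ∂η) ^ 2
      = ((d : ℝ) * n)⁻¹ ^ 2 * (∑ i, obsSq 1 (x i) - n * ((∫ w, w ^ 2 ∂η) * d)) ^ 2 := by
    intro x
    rw [fstMoment, ← mul_pow]
    congr 1
    field_simp
  simp_rw [e]
  rw [integral_const_mul]
  calc _ ≤ ((d : ℝ) * n)⁻¹ ^ 2 * (n * (b ^ 2 * (formConst 2 κ * (d : ℝ) ^ 2))) := by
        gcongr
        exact h1.trans (by gcongr)
    _ = _ := by field_simp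

theorem integral_diagMoment_sub_sq_le {κ b : ℝ} (h : MomentBound ρ 4 κ) (hη : ScaleBound η b)
    (hd : 0 < d) {n : ℕ} (hn : 0 < n) :
    MemLp (fun x : Fin n → Obs d => diagMoment 1 x
      - ((d : ℝ) * n)⁻¹ * ∫ x, obsSq 1 x ^ 2 ∂(obsLaw η ρ d)) 2
      (Measure.pi fun _ => obsLaw η ρ d) ∧
    ∫ x : Fin n → Obs d, (diagMoment 1 x
      - ((d : ℝ) * n)⁻¹ * ∫ x, obsSq 1 x ^ 2 ∂(obsLaw η ρ d)) ^ 2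
        ∂(Measure.pi fun _ => obsLaw η ρ d)
      ≤ (b ^ 4 * formConst 4 κ) * ((d : ℝ) / n) ^ 2 * (n : ℝ)⁻¹ := by
  have hd' : (0 : ℝ) < d := by exact_mod_cast hd
  have hn' : (0 : ℝ) < n := by exact_mod_cast hn
  have hL := memLp_obsSq_sq h hη (1 : Matrix (Fin d) (Fin d) ℝ)
  have hLi : ∀ i : Fin n, MemLp (fun x : Fin n → Obs d => obsSq 1 (x i) ^ 2) 2
      (Measure.pi fun _ => obsLaw η ρ d) := fun i =>
    hL.comp_measurePreserving (measurePreserving_eval (fun _ : Fin n => obsLaw η ρ d) i)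
  refine ⟨((memLp_finsetSum _ fun i _ => hLi i).const_mul _).sub (memLp_const _), ?_⟩
  have h1 := integral_sum_sub_sq_le (ι := Fin n) hL
  rw [Fintype.card_fin] at h1
  have h2 := (obsSq_moments h hη (1 : Matrix (Fin d) (Fin d) ℝ)).2
  rw [frobSq_one] at h2
  simp only [← pow_mul] at h1
  norm_num at h1
  have e : ∀ x : Fin n → Obs d, (diagMoment 1 x
      - ((d : ℝ) * n)⁻¹ * ∫ x, obsSq 1 x ^ 2 ∂(obsLaw η ρ d)) ^ 2
      = ((d : ℝ) * n ^ 2)⁻¹ ^ 2 * (∑ i, obsSq 1 (x i) ^ 2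
        - n * ∫ x, obsSq 1 x ^ 2 ∂(obsLaw η ρ d)) ^ 2 := by
    intro x
    rw [diagMoment, ← mul_pow]
    congr 1
    field_simp
  simp_rw [e]
  rw [integral_const_mul]
  calc _ ≤ ((d : ℝ) * n ^ 2)⁻¹ ^ 2 * (n * (b ^ 4 * (formConst 4 κ * (d : ℝ) ^ 4))) := by
        gcongr
        exact h1.trans (by gcongr)
    _ = _ := by field_simp

/-- The pair-sum variance bound for the centred kernel. This kernel is not degenerate, so the
projection term of order `n³` dominates; the second moment of the kernel bounds both terms. -/
theorem integral_offDiagMoment_sub_sq_le {κ b : ℝ} (h : MomentBound ρ 2 κ)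
    (hvar : ∫ x, x ^ 2 ∂ρ = 1) (hη : ScaleBound η b) (hd : 0 < d) {n : ℕ} (hn : 0 < n) :
    MemLp (fun x : Fin n → Obs d => offDiagMoment 1 x
      - (1 - (n : ℝ)⁻¹) * (∫ w, w ^ 2 ∂η) ^ 2) 2 (Measure.pi fun _ => obsLaw η ρ d) ∧
    ∫ x : Fin n → Obs d, (offDiagMoment 1 x - (1 - (n : ℝ)⁻¹) * (∫ w, w ^ 2 ∂η) ^ 2) ^ 2
        ∂(Measure.pi fun _ => obsLaw η ρ d)
      ≤ 6 * (b ^ 4 * formConst 2 κ ^ 2) * (n : ℝ)⁻¹ := by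
  have hd' : (0 : ℝ) < d := by exact_mod_cast hd
  have hn' : (1 : ℝ) ≤ n := by exact_mod_cast hn
  set μ := obsLaw η ρ d with hμ
  set A := (∫ w, w ^ 2 ∂η) ^ 2 * d with hA
  have hK2 := sqKernel_bounds h hη (1 : Matrix (Fin d) (Fin d) ℝ)
  rw [transpose_one, Matrix.mul_one, frobSq_one] at hK2
  have hKL : MemLp (Function.uncurry (sqKernel (1 : Matrix (Fin d) (Fin d) ℝ))) 2 (μ.prod μ) := by
    rw [memLp_two_iff_integrable_sq (measurable_sqKernel _).aestronglyMeasurable]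
    exact hK2.1
  have hFL : MemLp (Function.uncurry fun x y => sqKernel (1 : Matrix (Fin d) (Fin d) ℝ) x y - A) 2
      (μ.prod μ) := hKL.sub (memLp_const A)
  have hmean : ∫ e : Obs d × Obs d, sqKernel 1 e.1 e.2 ∂(μ.prod μ) = A :=
    integral_sqKernel_one h hvar hη
  have hKi : Integrable (fun e : Obs d × Obs d => sqKernel 1 e.1 e.2) (μ.prod μ) :=
    hKL.integrable (by norm_num)
  have h0 : ∫ e : Obs d × Obs d, (sqKernel 1 e.1 e.2 - A) ∂(μ.prod μ) = 0 := by
    rw [integral_sub hKi (integrable_const _), hmean]; simp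
  have hF2 : ∫ e : Obs d × Obs d, (sqKernel 1 e.1 e.2 - A) ^ 2 ∂(μ.prod μ)
      ≤ b ^ 4 * (formConst 2 κ ^ 2 * (d : ℝ) ^ 2) := by
    have h1 : ∫ e : Obs d × Obs d, (sqKernel 1 e.1 e.2 - A) ^ 2 ∂(μ.prod μ)
        ≤ ∫ e : Obs d × Obs d, sqKernel 1 e.1 e.2 ^ 2 ∂(μ.prod μ) := by
      have h3 := variance_le_expectation_sq (X := fun e : Obs d × Obs d => sqKernel 1 e.1 e.2)
        (μ := μ.prod μ) hKL.1
      rw [variance_eq_integral (X := fun e : Obs d × Obs d => sqKernel 1 e.1 e.2)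
        hKL.1.aemeasurable, hmean] at h3
      exact h3
    exact h1.trans hK2.2
  have hps := integral_pairSum_sq_le (ι := Fin n) hFL (fun x y => by
    simp only [sqKernel, dotProduct_comm (obsVec 1 x)]) h0
  have hF1 := integral_sq_integral_le hFL
  rw [Fintype.card_fin] at hps
  have hB0 : 0 ≤ b ^ 4 * (formConst 2 κ ^ 2 * (d : ℝ) ^ 2) := by
    have := hη.1; positivity
  have hps' : ∫ x : Fin n → Obs d, pairSum (fun x y => sqKernel 1 x y - A) x ^ 2
      ∂(Measure.pi fun _ => μ) ≤ 6 * (n : ℝ) ^ 3 * (b ^ 4 * (formConst 2 κ ^ 2 * (d : ℝ) ^ 2)) := by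
    have hn23 : (n : ℝ) ^ 2 ≤ (n : ℝ) ^ 3 := pow_le_pow_right₀ hn' (by norm_num)
    calc _ ≤ _ := hps
      _ ≤ 2 * (n : ℝ) ^ 3 * (b ^ 4 * (formConst 2 κ ^ 2 * (d : ℝ) ^ 2))
          + 4 * (n : ℝ) ^ 3 * (b ^ 4 * (formConst 2 κ ^ 2 * (d : ℝ) ^ 2)) := by
          gcongr
          exact hF1.trans hF2
      _ = _ := by ring
  have e : ∀ x : Fin n → Obs d, offDiagMoment 1 x - (1 - (n : ℝ)⁻¹) * (∫ w, w ^ 2 ∂η) ^ 2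
      = ((d : ℝ) * n ^ 2)⁻¹ * pairSum (fun x y => sqKernel 1 x y - A) x := by
    intro x
    rw [pairSum_sub_const, offDiagMoment, Fintype.card_fin, hA]
    field_simp
  have hPL : MemLp (fun x : Fin n → Obs d => pairSum (fun x y => sqKernel 1 x y - A) x) 2
      (Measure.pi fun _ => μ) :=
    memLp_finsetSum _ fun q hq => memLp_pair hFL (Finset.mem_offDiag.1 hq).2.2
  simp_rw [e]
  refine ⟨hPL.const_mul _, ?_⟩
  simp_rw [mul_pow]
  rw [integral_const_mul]
  calc _ ≤ (((d : ℝ) * n ^ 2)⁻¹) ^ 2 *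
        (6 * (n : ℝ) ^ 3 * (b ^ 4 * (formConst 2 κ ^ 2 * (d : ℝ) ^ 2))) := by
        simp only [mul_pow, mul_inv] at *
        gcongr
    _ = _ := by field_simp

/-- The normalizing statistic. -/
noncomputable def normStat {n : ℕ} (T : Matrix (Fin d) (Fin d) ℝ) (x : Fin n → Obs d) : ℝ :=
  (diagMoment T x + offDiagMoment T x - fstMoment T x ^ 2) / ((d : ℝ) / n)

/-- In the second spectral moment the pairs of distinct indices contribute about `(E w²)²`, which
the squared first moment removes. What survives is the diagonal part, about `(d / n) E w⁴`, and
dividing by `d / n` leaves `E w⁴`. -/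
theorem integral_abs_normStat_sub_le {κ b : ℝ} (h : MomentBound ρ 4 κ)
    (hvar : ∫ x, x ^ 2 ∂ρ = 1) (hη : ScaleBound η b) (hd : 0 < d) {n : ℕ} (hn : 0 < n) :
    Integrable (fun x : Fin n → Obs d => normStat 1 x - ∫ w, w ^ 4 ∂η)
      (Measure.pi fun _ => obsLaw η ρ d) ∧
    ∫ x : Fin n → Obs d, |normStat 1 x - ∫ w, w ^ 4 ∂η| ∂(Measure.pi fun _ => obsLaw η ρ d)
      ≤ ((d : ℝ) / n)⁻¹ * (√((b ^ 4 * formConst 4 κ) * ((d : ℝ) / n) ^ 2 * (n : ℝ)⁻¹)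
        + √(6 * (b ^ 4 * formConst 2 κ ^ 2) * (n : ℝ)⁻¹)
        + (b ^ 2 * formConst 2 κ) * (n : ℝ)⁻¹
        + 2 * (∫ w, w ^ 2 ∂η) * √((b ^ 2 * formConst 2 κ) * (n : ℝ)⁻¹)
        + ((∫ w, w ^ 4 ∂η) * ((∫ x, x ^ 4 ∂ρ) + 1) + (∫ w, w ^ 2 ∂η) ^ 2) * (n : ℝ)⁻¹) := by
  have h2 : MomentBound ρ 2 κ := h.mono (by norm_num)
  have hd' : (0 : ℝ) < d := by exact_mod_cast hd
  have hn' : (0 : ℝ) < n := by exact_mod_cast hn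
  obtain ⟨hAL, hA⟩ := integral_fstMoment_sub_sq_le (η := η) h2 hvar hη hd hn
  obtain ⟨hBL, hB⟩ := integral_diagMoment_sub_sq_le (η := η) h hη hd hn
  obtain ⟨hCL, hC⟩ := integral_offDiagMoment_sub_sq_le (η := η) h2 hvar hη hd hn
  have hμ2 := integral_obsSq_one_sq (η := η) (d := d) h2 hvar
  have hm1 : 0 ≤ ∫ w, w ^ 2 ∂η := integral_nonneg fun _ => sq_nonneg _
  set m1 := ∫ w, w ^ 2 ∂η
  set M := ∫ w, w ^ 4 ∂η
  set m := ∫ x, x ^ 4 ∂ρ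
  set μ2 := ∫ x, obsSq 1 x ^ 2 ∂(obsLaw η ρ d)
  set R := (M * (m + 1) + m1 ^ 2) * (n : ℝ)⁻¹
  have hdet : |((d : ℝ) * n)⁻¹ * μ2 - M * ((d : ℝ) / n)| ≤ M * (m + 1) * (n : ℝ)⁻¹ := by
    have e : ((d : ℝ) * n)⁻¹ * μ2 - M * ((d : ℝ) / n) = ((d : ℝ) * n)⁻¹ * (μ2 - M * (d : ℝ) ^ 2) := by
      field_simp
    rw [e, abs_mul, abs_of_pos (by positivity : (0 : ℝ) < ((d : ℝ) * n)⁻¹)]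
    calc _ ≤ ((d : ℝ) * n)⁻¹ * (M * ((m + 1) * d)) := by gcongr
      _ = _ := by field_simp
  -- The squared first moment is expanded around `m1`, so that only the centred statistics and a
  -- deterministic remainder appear.
  have e : ∀ x : Fin n → Obs d, normStat 1 x - M = ((d : ℝ) / n)⁻¹ *
      ((diagMoment 1 x - ((d : ℝ) * n)⁻¹ * μ2)
      + (offDiagMoment 1 x - (1 - (n : ℝ)⁻¹) * m1 ^ 2)
      - (fstMoment 1 x - m1) ^ 2 - 2 * m1 * (fstMoment 1 x - m1)
      + (((d : ℝ) * n)⁻¹ * μ2 - M * ((d : ℝ) / n) - (n : ℝ)⁻¹ * m1 ^ 2)) := by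
    intro x
    rw [normStat]
    field_simp
    ring
  have iA := hAL.integrable (by norm_num)
  have iB := hBL.integrable (by norm_num)
  have iC := hCL.integrable (by norm_num)
  have iA2 := hAL.integrable_sq
  constructor
  · simp_rw [e]
    exact ((((iB.add iC).sub iA2).sub (iA.const_mul _)).add (integrable_const _)).const_mul _
  · have hpt : ∀ x : Fin n → Obs d, |normStat 1 x - M| ≤ ((d : ℝ) / n)⁻¹ *
        (|diagMoment 1 x - ((d : ℝ) * n)⁻¹ * μ2|
        + |offDiagMoment 1 x - (1 - (n : ℝ)⁻¹) * m1 ^ 2|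
        + (fstMoment 1 x - m1) ^ 2 + 2 * m1 * |fstMoment 1 x - m1| + R) := by
      intro x
      rw [e x, abs_mul, abs_of_pos (by positivity : (0 : ℝ) < ((d : ℝ) / n)⁻¹)]
      refine mul_le_mul_of_nonneg_left ?_ (by positivity)
      generalize diagMoment 1 x - ((d : ℝ) * n)⁻¹ * μ2 = u
      generalize offDiagMoment 1 x - (1 - (n : ℝ)⁻¹) * m1 ^ 2 = v
      generalize fstMoment 1 x - m1 = s
      have hr : |((d : ℝ) * n)⁻¹ * μ2 - M * ((d : ℝ) / n) - (n : ℝ)⁻¹ * m1 ^ 2| ≤ R := by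
        refine (abs_sub _ _).trans ?_
        rw [abs_of_nonneg (by positivity : (0 : ℝ) ≤ (n : ℝ)⁻¹ * m1 ^ 2)]
        simp only [R]
        linarith
      generalize ((d : ℝ) * n)⁻¹ * μ2 - M * ((d : ℝ) / n) - (n : ℝ)⁻¹ * m1 ^ 2 = r at hr
      have a1 := abs_add_le (u + v - s ^ 2 - 2 * m1 * s) r
      have a2 := abs_sub (u + v - s ^ 2) (2 * m1 * s)
      have a3 := abs_sub (u + v) (s ^ 2)
      have a4 := abs_add_le u v
      rw [abs_of_nonneg (sq_nonneg s)] at a3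
      rw [abs_mul (2 * m1), abs_of_nonneg (by positivity : 0 ≤ 2 * m1)] at a2
      linarith
    have j1 := (iB.abs.add iC.abs)
    have j2 := j1.add iA2
    have j3 := j2.add (iA.abs.const_mul (2 * m1))
    have j4 := j3.add (integrable_const (μ := Measure.pi fun _ : Fin n => obsLaw η ρ d) R)
    refine (integral_mono_of_nonneg (ae_of_all _ fun x => abs_nonneg _) (j4.const_mul _)
      (ae_of_all _ hpt)).trans ?_
    rw [integral_const_mul]
    refine mul_le_mul_of_nonneg_left ?_ (by positivity)
    have s1 := integral_add j3 (integrable_const (μ := Measure.pi fun _ : Fin n => obsLaw η ρ d) R)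
    have s2 := integral_add j2 (iA.abs.const_mul (2 * m1))
    have s3 := integral_add j1 iA2
    have s4 := integral_add iB.abs iC.abs
    have b1 := (integral_abs_le_sqrt hBL).trans (Real.sqrt_le_sqrt hB)
    have b2 := (integral_abs_le_sqrt hCL).trans (Real.sqrt_le_sqrt hC)
    have b3 := mul_le_mul_of_nonneg_left ((integral_abs_le_sqrt hAL).trans (Real.sqrt_le_sqrt hA))
      (by positivity : 0 ≤ 2 * m1)
    rw [← integral_const_mul] at b3
    simp only [Pi.add_apply] at s1 s2 s3 s4 ⊢
    rw [s1, s2, s3, s4]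
    simp only [integral_const, probReal_univ, one_smul]
    linarith

theorem tendsto_measure_normStat {κ b c : ℝ} (h : MomentBound ρ 4 κ)
    (hvar : ∫ x, x ^ 2 ∂ρ = 1) (hη : ScaleBound η b) {p : ℕ → ℕ} (hp : Tendsto p atTop atTop)
    (hc : 0 < c) (hpn : Tendsto (fun n : ℕ => (p n : ℝ) / (n : ℝ)) atTop (𝓝 c)) {ε : ℝ}
    (hε : 0 < ε) :
    Tendsto (fun n : ℕ => (Measure.pi fun _ : Fin n => obsLaw η ρ (p n))
      {x | ε ≤ |normStat 1 x - ∫ w, w ^ 4 ∂η|}) atTop (𝓝 0) := by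
  have hinv : Tendsto (fun n : ℕ => (n : ℝ)⁻¹) atTop (𝓝 0) := tendsto_inv_atTop_nhds_zero_nat
  have hlim : Tendsto (fun n : ℕ => ε⁻¹ * (((p n : ℝ) / n)⁻¹ *
      (√((b ^ 4 * formConst 4 κ) * ((p n : ℝ) / n) ^ 2 * (n : ℝ)⁻¹)
        + √(6 * (b ^ 4 * formConst 2 κ ^ 2) * (n : ℝ)⁻¹)
        + (b ^ 2 * formConst 2 κ) * (n : ℝ)⁻¹
        + 2 * (∫ w, w ^ 2 ∂η) * √((b ^ 2 * formConst 2 κ) * (n : ℝ)⁻¹)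
        + ((∫ w, w ^ 4 ∂η) * ((∫ x, x ^ 4 ∂ρ) + 1) + (∫ w, w ^ 2 ∂η) ^ 2) * (n : ℝ)⁻¹)))
      atTop (𝓝 (ε⁻¹ * (c⁻¹ * (√((b ^ 4 * formConst 4 κ) * c ^ 2 * 0)
        + √(6 * (b ^ 4 * formConst 2 κ ^ 2) * 0)
        + (b ^ 2 * formConst 2 κ) * 0
        + 2 * (∫ w, w ^ 2 ∂η) * √((b ^ 2 * formConst 2 κ) * 0)
        + ((∫ w, w ^ 4 ∂η) * ((∫ x, x ^ 4 ∂ρ) + 1) + (∫ w, w ^ 2 ∂η) ^ 2) * 0)))) := by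
    refine ((hpn.inv₀ hc.ne').mul (((((((hpn.pow 2).const_mul _).mul hinv).sqrt).add
      (hinv.const_mul _).sqrt).add (hinv.const_mul _)).add
      ((hinv.const_mul _).sqrt.const_mul _) |>.add (hinv.const_mul _))).const_mul _
  simp only [mul_zero, Real.sqrt_zero, add_zero] at hlim
  rw [← ENNReal.tendsto_toReal_iff (fun _ => measure_ne_top _ _) ENNReal.zero_ne_top]
  refine squeeze_zero' (Eventually.of_forall fun _ => ENNReal.toReal_nonneg) ?_ hlim
  filter_upwards [hp.eventually_gt_atTop 0, eventually_gt_atTop 0] with n hn1 hn2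
  obtain ⟨hi, hle⟩ := integral_abs_normStat_sub_le (η := η) h hvar hη hn1 hn2
  have := mul_meas_ge_le_integral_of_nonneg (ae_of_all _ fun x => abs_nonneg _) hi.abs ε
  rw [← div_eq_inv_mul, le_div_iff₀ hε, mul_comm]
  exact this.trans hle

end EmpiricalMoments

/-! ### Consistency under the alternative hypothesis -/

section Alternative

theorem integral_pairSum {ι E : Type*} [Fintype ι] [DecidableEq ι] [MeasurableSpace E]
    {ν : Measure E} [IsProbabilityMeasure ν] {F : E → E → ℝ}
    (hF : Integrable (Function.uncurry F) (ν.prod ν)) :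
    Integrable (fun x : ι → E => pairSum F x) (Measure.pi fun _ : ι => ν) ∧
    ∫ x : ι → E, pairSum F x ∂(Measure.pi fun _ : ι => ν)
      = Fintype.card ι * (Fintype.card ι - 1) * ∫ e, F e.1 e.2 ∂(ν.prod ν) := by
  have hi : ∀ q ∈ (Finset.univ : Finset ι).offDiag,
      Integrable (fun x : ι → E => F (x q.1) (x q.2)) (Measure.pi fun _ : ι => ν) := fun q hq =>
    integrable_pair (Finset.mem_offDiag.1 hq).2.2 hF
  refine ⟨integrable_finsetSum _ hi, ?_⟩
  simp only [pairSum]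
  have hq : ∀ q ∈ (Finset.univ : Finset ι).offDiag,
      ∫ x : ι → E, F (x q.1) (x q.2) ∂(Measure.pi fun _ : ι => ν)
        = ∫ e, Function.uncurry F e ∂(ν.prod ν) := fun q hq =>
    integral_pair (F := Function.uncurry F) (Finset.mem_offDiag.1 hq).2.2 hF.1
  rw [integral_finsetSum _ hi, Finset.sum_congr rfl hq, Finset.sum_const, Finset.offDiag_card,
    Finset.card_univ, nsmul_eq_mul, Nat.cast_sub (Nat.le_mul_self _)]
  push_cast
  simp only [Function.uncurry]
  ring

variable {d : ℕ}

/-- Averaging over the permutation group is an orthogonal projection for the Frobenius inner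
product. -/
theorem sum_permAvg_mul_self (S : Matrix (Fin d) (Fin d) ℝ) :
    ∑ a, ∑ b, permAvg S a b * S a b = ∑ a, ∑ b, permAvg S a b ^ 2 := by
  have hd : (d.factorial : ℝ) ≠ 0 := by positivity
  have h1 : ∀ σ : Equiv.Perm (Fin d), ∑ a, ∑ b, permAvg S a b * S (σ a) (σ b)
      = ∑ a, ∑ b, permAvg S a b * S a b := by
    intro σ
    have e : ∀ a b, permAvg S a b * S (σ a) (σ b) = permAvg S (σ a) (σ b) * S (σ a) (σ b) :=
      fun a b => by rw [permAvg_apply_perm]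
    simp_rw [e]
    rw [Equiv.sum_comp σ (fun a => ∑ b, permAvg S a (σ b) * S a (σ b))]
    exact Finset.sum_congr rfl fun a _ => Equiv.sum_comp σ (fun b => permAvg S a b * S a b)
  have h2 : ∑ a, ∑ b, permAvg S a b ^ 2 = (d.factorial : ℝ)⁻¹ *
      ∑ σ : Equiv.Perm (Fin d), ∑ a, ∑ b, permAvg S a b * S (σ a) (σ b) := by
    have e : ∑ σ : Equiv.Perm (Fin d), ∑ a, ∑ b, permAvg S a b * S (σ a) (σ b)
        = ∑ a, ∑ b, permAvg S a b * ∑ σ : Equiv.Perm (Fin d), S (σ a) (σ b) := by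
      rw [Finset.sum_comm]
      refine Finset.sum_congr rfl fun a _ => ?_
      rw [Finset.sum_comm]
      exact Finset.sum_congr rfl fun b _ => (Finset.mul_sum _ _ _).symm
    rw [e, Finset.mul_sum]
    refine Finset.sum_congr rfl fun a _ => ?_
    rw [Finset.mul_sum]
    refine Finset.sum_congr rfl fun b _ => ?_
    simp only [permAvg, of_apply]
    ring
  rw [h2, Finset.sum_congr rfl fun σ _ => h1 σ, Finset.sum_const, Finset.card_univ,
    Fintype.card_perm, Fintype.card_fin, nsmul_eq_mul, inv_mul_cancel_left₀ hd]

/-- The defect is the orthogonal complement part of `T Tᵀ`, so its inner product with `T Tᵀ` is its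
own squared norm. -/
theorem sum_covDefect_mul (T : Matrix (Fin d) (Fin d) ℝ) :
    ∑ a, ∑ b, covDefect T a b * (T * Tᵀ) a b = frobSq (covDefect T) := by
  have h := sum_permAvg_mul_self (T * Tᵀ)
  have e : ∀ a b, covDefect T a b * (T * Tᵀ) a b = covDefect T a b ^ 2
      + (permAvg (T * Tᵀ) a b * (T * Tᵀ) a b - permAvg (T * Tᵀ) a b ^ 2) := by
    intro a b
    simp only [covDefect, Matrix.sub_apply]
    ring
  simp_rw [e, Finset.sum_add_distrib, Finset.sum_sub_distrib, h]
  simp [frobSq]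

theorem transpose_covDefect (T : Matrix (Fin d) (Fin d) ℝ) : (covDefect T)ᵀ = covDefect T := by
  have hs : ∀ a b, (T * Tᵀ) a b = (T * Tᵀ) b a := fun a b => by
    simp only [mul_apply, transpose_apply]
    exact Finset.sum_congr rfl fun c _ => mul_comm _ _
  ext a b
  simp only [transpose_apply, covDefect_apply]
  rw [hs b a]
  simp_rw [hs (_ : Fin d) ((_ : Equiv.Perm (Fin d)) a)]

theorem frobSq_mul_le (A B : Matrix (Fin d) (Fin d) ℝ) :
    frobSq (A * B) ≤ frobSq A * frobSq B := by
  calc frobSq (A * B) ≤ ∑ a, ∑ b, (∑ c, A a c ^ 2) * ∑ c, B c b ^ 2 :=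
        Finset.sum_le_sum fun a _ => Finset.sum_le_sum fun b _ => by
          rw [mul_apply]; exact Finset.sum_mul_sq_le_sq_mul_sq _ _ _
    _ = frobSq A * ∑ b, ∑ c, B c b ^ 2 := by
        rw [frobSq, Finset.sum_mul]
        exact Finset.sum_congr rfl fun a _ => (Finset.mul_sum _ _ _).symm
    _ = _ := by rw [Finset.sum_comm]; rfl

theorem trace_mul_self_le_frobSq (A : Matrix (Fin d) (Fin d) ℝ) : (A * A).trace ≤ frobSq A := by
  have h1 : ∑ a, ∑ b, A b a ^ 2 = frobSq A := by rw [Finset.sum_comm]; rfl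
  simp only [trace, diag_apply, mul_apply]
  calc _ ≤ ∑ a, ∑ b, (2⁻¹ * A a b ^ 2 + 2⁻¹ * A b a ^ 2) :=
        Finset.sum_le_sum fun a _ => Finset.sum_le_sum fun b _ => by
          nlinarith [sq_nonneg (A a b - A b a)]
    _ = 2⁻¹ * frobSq A + 2⁻¹ * frobSq A := by
        simp_rw [Finset.sum_add_distrib, ← Finset.mul_sum]
        rw [h1]; rfl
    _ = _ := by ring

/-- Cyclicity rewrites the left side as the trace of the square of `A * (T * T)`, so only the
Frobenius norm of `T * T` enters and not the squared Frobenius norm of `T` itself. -/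
theorem frobSq_conj_le {T A : Matrix (Fin d) (Fin d) ℝ} (hT : Tᵀ = T) (hA : Aᵀ = A) :
    frobSq (Tᵀ * A * T) ≤ frobSq A * frobSq (T * T) := by
  have h : frobSq (Tᵀ * A * T) = ((A * (T * T)) * (A * (T * T))).trace := by
    rw [frobSq_eq_trace]
    simp only [transpose_mul, hT, hA]
    calc (T * A * T * (T * (A * T))).trace = (T * (A * T * T * A * T)).trace := by
          simp only [Matrix.mul_assoc]
      _ = _ := by rw [trace_mul_comm]; simp only [Matrix.mul_assoc]
  rw [h]
  exact (trace_mul_self_le_frobSq _).trans (frobSq_mul_le _ _)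

variable {η ρ : Measure ℝ} [IsProbabilityMeasure η] [IsProbabilityMeasure ρ]

theorem sum_mul_mulVec_eq (T A : Matrix (Fin d) (Fin d) ℝ) (z : Fin d → ℝ) :
    ∑ a, ∑ b, A a b * ((T *ᵥ z) a * (T *ᵥ z) b)
      = (∑ q : Fin d × Fin d, (Tᵀ * A * T) q.1 q.2 * centredSq z q.1 q.2)
        + (Tᵀ * A * T).trace := by
  have h1 : ∑ a, ∑ b, A a b * ((T *ᵥ z) a * (T *ᵥ z) b)
      = ∑ a, ∑ b, (Tᵀ * A * T) a b * (z a * z b) := by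
    have e : ∀ (B : Matrix (Fin d) (Fin d) ℝ) (v : Fin d → ℝ),
        ∑ a, ∑ b, B a b * (v a * v b) = v ⬝ᵥ (B *ᵥ v) := by
      intro B v
      simp only [dotProduct, mulVec, Finset.mul_sum]
      exact Finset.sum_congr rfl fun a _ => Finset.sum_congr rfl fun b _ => by ring
    rw [e, e, ← mulVec_mulVec, ← mulVec_mulVec, dotProduct_mulVec z Tᵀ, vecMul_transpose]
  rw [h1, Fintype.sum_prod_type]
  simp only [centredSq, mul_sub, Finset.sum_sub_distrib]
  simp [trace]

theorem trace_conj_eq (T A : Matrix (Fin d) (Fin d) ℝ) :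
    (Tᵀ * A * T).trace = ∑ a, ∑ b, A a b * (T * Tᵀ) a b := by
  rw [Matrix.mul_assoc, trace_mul_comm, Matrix.mul_assoc]
  simp only [trace, diag_apply, mul_apply (M := A)]
  refine Finset.sum_congr rfl fun a _ => Finset.sum_congr rfl fun b _ => ?_
  congr 1
  simp only [mul_apply, transpose_apply]
  exact Finset.sum_congr rfl fun c _ => mul_comm _ _

/-- The conditional mean given `x` is a scale factor times a quadratic form in `z` with matrix `Tᵀ *
covDefect T * T`. The trace of that matrix is the squared norm of the defect, which gives the mean;
the centred part has variance controlled by its Frobenius norm. -/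
theorem integral_obsKernel {κ b : ℝ} (h : MomentBound ρ 2 κ) (hvar : ∫ x, x ^ 2 ∂ρ = 1)
    (hη : ScaleBound η b) {T : Matrix (Fin d) (Fin d) ℝ} (hT : Tᵀ = T) :
    ∫ e, obsKernel T e.1 e.2 ∂((obsLaw η ρ d).prod (obsLaw η ρ d))
      = (∫ w, w ^ 2 ∂η) ^ 2 * frobSq (covDefect T) ∧
    ∫ x, (∫ y, obsKernel T x y ∂(obsLaw η ρ d)) ^ 2 ∂(obsLaw η ρ d)
      ≤ (∫ w, w ^ 2 ∂η) ^ 2 * (b ^ 2 * (2 * ((∫ x, x ^ 4 ∂ρ) + 1)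
        * (frobSq (covDefect T) * frobSq (T * T)) + 2 * frobSq (covDefect T) ^ 2)) := by
  have hm := one_le_fourth_moment h hvar
  set W := Tᵀ * covDefect T * T with hW
  let S : (Fin d → ℝ) → ℝ := fun z => ∑ q : Fin d × Fin d, W q.1 q.2 * centredSq z q.1 q.2
  have hSL : MemLp S 2 (Measure.pi fun _ : Fin d => ρ) :=
    memLp_finsetSum _ fun q _ => (h.memLp_centredSq q.1 q.2).const_mul _
  have hSm : Measurable S := by
    have := fun r : Fin d × Fin d => measurable_centredSq r.1 r.2
    simp only [S]
    fun_prop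
  have hS0 : ∫ z, S z ∂(Measure.pi fun _ : Fin d => ρ) = 0 := by
    simp only [S]
    rw [integral_finsetSum _ fun q _ =>
      ((h.memLp_centredSq q.1 q.2).integrable (by norm_num)).const_mul _]
    refine Finset.sum_eq_zero fun q _ => ?_
    simp only [centredSq]
    rw [integral_const_mul, integral_sub (h.integrable_coord_mul _ _) (integrable_const _),
      h.integral_coord_mul hvar]
    simp
  have htr : W.trace = frobSq (covDefect T) := by
    rw [hW, trace_conj_eq, sum_covDefect_mul]
  have hd : (d.factorial : ℝ) ≠ 0 := by positivity
  have hr : ∀ x : Obs d, ∫ y, obsKernel T x y ∂(obsLaw η ρ d)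
      = (∫ w, w ^ 2 ∂η) * (x.1 ^ 2 * (S x.2.1 + frobSq (covDefect T))) := by
    intro x
    rw [integral_obsKernel_right h hvar, sum_mul_mulVec_eq, htr]
  have hφ := frobSq_nonneg (covDefect T)
  set φ := frobSq (covDefect T)
  have hSi := hSL.integrable (by norm_num)
  constructor
  · have hi : Integrable (fun e : Obs d × Obs d => obsKernel T e.1 e.2)
        ((obsLaw η ρ d).prod (obsLaw η ρ d)) :=
      ((obsKernel_bounds (s := 1) h hη hT).1.integrable (by norm_num) :
        Integrable (Function.uncurry (obsKernel T)) _)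
    rw [integral_prod _ hi]
    simp_rw [hr]
    rw [integral_const_mul, integral_obs_mul (f := fun w => w ^ 2) (g := fun _ z => S z + φ)
      (fun _ => hSm.add_const _) (fun _ => hSi.add (integrable_const _)), Finset.sum_const,
      Finset.card_univ, Fintype.card_perm, Fintype.card_fin, nsmul_eq_mul,
      inv_mul_cancel_left₀ hd, integral_add hSi (integrable_const _), hS0]
    simp
    ring
  · simp_rw [hr, mul_pow _ (_ * _)]
    rw [integral_const_mul]
    refine mul_le_mul_of_nonneg_left ?_ (sq_nonneg _)
    have e : ∀ x : Obs d, (x.1 ^ 2 * (S x.2.1 + φ)) ^ 2 = x.1 ^ (2 * 2) * (S x.2.1 + φ) ^ 2 :=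
      fun x => by ring
    have hSφ : MemLp (fun z => S z + φ) 2 (Measure.pi fun _ : Fin d => ρ) :=
      hSL.add (memLp_const φ)
    simp_rw [e]
    rw [integral_obs_mul (f := fun w => w ^ (2 * 2)) (g := fun _ z => (S z + φ) ^ 2)
      (fun _ => (hSm.add_const _).pow_const 2) (fun _ => hSφ.integrable_sq), Finset.sum_const,
      Finset.card_univ, Fintype.card_perm, Fintype.card_fin, nsmul_eq_mul,
      inv_mul_cancel_left₀ hd]
    have h1 : ∫ z, (S z + φ) ^ 2 ∂(Measure.pi fun _ : Fin d => ρ)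
        ≤ 2 * ((∫ x, x ^ 4 ∂ρ) + 1) * (φ * frobSq (T * T)) + 2 * φ ^ 2 := by
      have h2 : ∫ z, (S z + φ) ^ 2 ∂(Measure.pi fun _ : Fin d => ρ)
          ≤ ∫ z, (2 * S z ^ 2 + 2 * φ ^ 2) ∂(Measure.pi fun _ : Fin d => ρ) :=
        integral_mono hSφ.integrable_sq ((hSL.integrable_sq.const_mul 2).add (integrable_const _))
          fun z => by nlinarith [sq_nonneg (S z - φ)]
      rw [integral_add (hSL.integrable_sq.const_mul 2) (integrable_const _),
        integral_const_mul] at h2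
      have h3 := h.integral_sum_mul_centredSq_sq_le hvar W
      have h4 := frobSq_conj_le hT (transpose_covDefect T)
      have h5 : ∫ z, S z ^ 2 ∂(Measure.pi fun _ : Fin d => ρ)
          ≤ ((∫ x, x ^ 4 ∂ρ) + 1) * (φ * frobSq (T * T)) :=
        h3.trans (mul_le_mul_of_nonneg_left h4 (by linarith))
      simp only [integral_const, probReal_univ, one_smul] at h2
      linarith
    have h0 : 0 ≤ ∫ z, (S z + φ) ^ 2 ∂(Measure.pi fun _ : Fin d => ρ) :=
      integral_nonneg fun _ => sq_nonneg _
    exact mul_le_mul (hη.integral_pow_le 2) h1 h0 (sq_nonneg _)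

theorem integral_pairSum_statKernel {κ b : ℝ} (h : MomentBound ρ 2 κ) (hvar : ∫ x, x ^ 2 ∂ρ = 1)
    (hη : ScaleBound η b) {T : Matrix (Fin d) (Fin d) ℝ} (hT : Tᵀ = T) (n : ℕ) :
    ∫ x : Fin n → Obs d, pairSum (statKernel n T) x ∂(Measure.pi fun _ => obsLaw η ρ d)
      = ((d : ℝ) * n)⁻¹ * (n * (n - 1) * ((∫ w, w ^ 2 ∂η) ^ 2 * frobSq (covDefect T))) := by
  have hi : Integrable (Function.uncurry (statKernel n T))
      ((obsLaw η ρ d).prod (obsLaw η ρ d)) :=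
    ((obsKernel_bounds (s := 1) h hη hT).1.integrable (by norm_num)).const_mul _
  rw [(integral_pairSum hi).2]
  simp only [statKernel]
  rw [integral_const_mul, (integral_obsKernel h hvar hη hT).1, Fintype.card_fin]
  ring

/-- Up to constants the mean `D` is `φ n / d`, with `φ` the squared norm of the defect. In the
pair-sum bound the first term is bounded, since `frobSq (T * T)` is of order `d`. The projection
term splits into a part linear in `φ n / d` and a part `φ² n / d² = (φ n / d)² / n`. Everything is
therefore expressed through `D`, and is `o(D²)` when `D` diverges. -/
theorem integral_pairSum_statKernel_sub_sq_le {κ b C : ℝ} (h : MomentBound ρ 2 κ)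
    (hvar : ∫ x, x ^ 2 ∂ρ = 1) (hη : ScaleBound η b) {T : Matrix (Fin d) (Fin d) ℝ}
    (hT : Tᵀ = T) (hC : frobSq (T * T) ≤ C * d) (hm1 : 0 < ∫ w, w ^ 2 ∂η) (hd : 0 < d) {n : ℕ}
    (hn : 2 ≤ n) {D : ℝ}
    (hD : ∫ x : Fin n → Obs d, pairSum (statKernel n T) x ∂(Measure.pi fun _ => obsLaw η ρ d) = D) :
    MemLp (fun x : Fin n → Obs d => pairSum (statKernel n T) x - D) 2
      (Measure.pi fun _ => obsLaw η ρ d) ∧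
    ∫ x : Fin n → Obs d, (pairSum (statKernel n T) x - D) ^ 2 ∂(Measure.pi fun _ => obsLaw η ρ d)
      ≤ 4 * (b ^ 4 * (formConst 2 κ ^ 2 * C ^ 2))
        + 16 * (b ^ 2 * (((∫ x, x ^ 4 ∂ρ) + 1) * C)) * D
        + 32 * (b ^ 2 / (∫ w, w ^ 2 ∂η) ^ 2) * D ^ 2 * (n : ℝ)⁻¹ := by
  have hd' : (0 : ℝ) < d := by exact_mod_cast hd
  have hn' : (2 : ℝ) ≤ n := by exact_mod_cast hn
  have hm := one_le_fourth_moment h hvar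
  have hb := hη.1
  have hτ := frobSq_nonneg (T * T)
  have hφ := frobSq_nonneg (covDefect T)
  rw [integral_pairSum_statKernel h hvar hη hT] at hD
  obtain ⟨hθ, hF1⟩ := integral_obsKernel (η := η) h hvar hη hT
  obtain ⟨hKL, hK2⟩ := obsKernel_bounds (η := η) (s := 1) h hη hT
  set μ := obsLaw η ρ d
  set m1 := ∫ w, w ^ 2 ∂η
  set m := ∫ x, x ^ 4 ∂ρ
  set φ := frobSq (covDefect T)
  set τ := frobSq (T * T)
  set θ := m1 ^ 2 * φ with hθdef
  norm_num at hKL hK2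
  have hFL : MemLp (Function.uncurry fun x y => obsKernel T x y - θ) 2 (μ.prod μ) :=
    hKL.sub (memLp_const θ)
  have hKi : Integrable (fun e : Obs d × Obs d => obsKernel T e.1 e.2) (μ.prod μ) :=
    hKL.integrable (by norm_num)
  have h0 : ∫ e : Obs d × Obs d, (obsKernel T e.1 e.2 - θ) ∂(μ.prod μ) = 0 := by
    rw [integral_sub hKi (integrable_const _), hθ]; simp
  have hF2 : ∫ e : Obs d × Obs d, (obsKernel T e.1 e.2 - θ) ^ 2 ∂(μ.prod μ)
      ≤ 2 * (b ^ 4 * (formConst 2 κ ^ 2 * τ ^ 2)) := by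
    refine le_trans ?_ hK2
    have h3 := variance_le_expectation_sq (X := fun e : Obs d × Obs d => obsKernel T e.1 e.2)
      (μ := μ.prod μ) hKL.1
    rw [variance_eq_integral (X := fun e : Obs d × Obs d => obsKernel T e.1 e.2)
      hKL.1.aemeasurable, hθ] at h3
    exact h3
  have hG : ∫ x, (∫ y, (obsKernel T x y - θ) ∂μ) ^ 2 ∂μ
      ≤ m1 ^ 2 * (b ^ 2 * (2 * (m + 1) * (φ * τ) + 2 * φ ^ 2)) := by
    refine le_trans ?_ hF1
    have hL1 : MemLp (fun x => ∫ y, obsKernel T x y ∂μ) 2 μ := by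
      rw [memLp_two_iff_integrable_sq hKi.integral_prod_left.1]
      have := hKL.integrable_sq
      refine this.integral_prod_left.mono' (hKi.integral_prod_left.1.pow 2) ?_
      filter_upwards [this.prod_right_ae, hKL.1.prodMk_left] with x h1 h3
      rw [Real.norm_of_nonneg (sq_nonneg _)]
      exact sq_integral_le_integral_sq ((memLp_two_iff_integrable_sq h3).2 h1)
    have h3 := variance_le_expectation_sq (X := fun x => ∫ y, obsKernel T x y ∂μ) (μ := μ) hL1.1
    rw [variance_eq_integral (X := fun x => ∫ y, obsKernel T x y ∂μ) hL1.1.aemeasurable] at h3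
    have h4 : ∫ x, ∫ y, obsKernel T x y ∂μ ∂μ = θ := by rw [← hθ, integral_prod _ hKi]
    rw [h4] at h3
    refine (integral_congr_ae ?_).trans_le h3
    filter_upwards [hKi.prod_right_ae] with x hx
    rw [integral_sub hx (integrable_const _)]
    simp
  have hps := integral_pairSum_sq_le (ι := Fin n) hFL (fun x y => by
    simp only [obsKernel_symm T x y]) h0
  rw [Fintype.card_fin] at hps
  have e : ∀ x : Fin n → Obs d, pairSum (statKernel n T) x - D
      = ((d : ℝ) * n)⁻¹ * pairSum (fun x y => obsKernel T x y - θ) x := by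
    intro x
    rw [pairSum_sub_const, ← hD, Fintype.card_fin]
    simp only [statKernel, pairSum, ← Finset.mul_sum]
    ring
  have hPL : MemLp (fun x : Fin n → Obs d => pairSum (fun x y => obsKernel T x y - θ) x) 2
      (Measure.pi fun _ => μ) :=
    memLp_finsetSum _ fun q hq => memLp_pair hFL (Finset.mem_offDiag.1 hq).2.2
  simp_rw [e]
  refine ⟨hPL.const_mul _, ?_⟩
  simp_rw [mul_pow]
  rw [integral_const_mul]
  -- The factor `2` absorbs the passage from `n - 1` to `n`, which needs `n ≥ 2`.
  have hDle : m1 ^ 2 * φ * ((n : ℝ) / d) ≤ 2 * D := by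
    have : 2 * D = m1 ^ 2 * φ * ((2 * n - 2) / d) := by
      rw [← hD, hθdef]; field_simp
    rw [this]
    gcongr
    linarith
  set u := φ * ((n : ℝ) / d) with hu
  have hu0 : 0 ≤ u := by positivity
  have hub : m1 ^ 2 * u ≤ 2 * D := by rw [hu]; linarith
  have hD0 : 0 ≤ D := by nlinarith [sq_nonneg m1]
  calc _ ≤ (((d : ℝ) * n)⁻¹) ^ 2 * (2 * (n : ℝ) ^ 2 * (2 * (b ^ 4 * (formConst 2 κ ^ 2 * τ ^ 2)))
        + 4 * (n : ℝ) ^ 3 * (m1 ^ 2 * (b ^ 2 * (2 * (m + 1) * (φ * τ) + 2 * φ ^ 2)))) := by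
        refine mul_le_mul_of_nonneg_left (hps.trans (add_le_add
          (mul_le_mul_of_nonneg_left hF2 (by positivity))
          (mul_le_mul_of_nonneg_left hG (by positivity)))) (sq_nonneg _)
    _ ≤ (((d : ℝ) * n)⁻¹) ^ 2 * (2 * (n : ℝ) ^ 2 * (2 * (b ^ 4 * (formConst 2 κ ^ 2 * (C * d) ^ 2)))
        + 4 * (n : ℝ) ^ 3 * (m1 ^ 2 * (b ^ 2 * (2 * (m + 1) * (φ * (C * d)) + 2 * φ ^ 2)))) := by
        gcongr
    _ = 4 * (b ^ 4 * (formConst 2 κ ^ 2 * C ^ 2)) + 8 * (b ^ 2 * ((m + 1) * C)) * (m1 ^ 2 * u)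
        + 8 * (b ^ 2 / m1 ^ 2) * (m1 ^ 2 * u) ^ 2 * (n : ℝ)⁻¹ := by
        rw [hu]; field_simp; ring
    _ ≤ 4 * (b ^ 4 * (formConst 2 κ ^ 2 * C ^ 2)) + 8 * (b ^ 2 * ((m + 1) * C)) * (2 * D)
        + 8 * (b ^ 2 / m1 ^ 2) * (2 * D) ^ 2 * (n : ℝ)⁻¹ := by
        have hC0 : 0 ≤ C := by
          by_contra hcon
          have : C * d < 0 := mul_neg_of_neg_of_pos (not_le.1 hcon) hd'
          linarith
        gcongr
    _ = _ := by ring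

/-- Under the alternative only tightness of the normalizing statistic is needed; each of its three
nonnegative ingredients has a bounded mean. -/
theorem integral_abs_normStat_le {κ b C : ℝ} (h : MomentBound ρ 2 κ) (hη : ScaleBound η b)
    {T : Matrix (Fin d) (Fin d) ℝ} (hT : Tᵀ = T) (hTd : frobSq T = d)
    (hC : frobSq (T * T) ≤ C * d) (hd : 0 < d) {n : ℕ} (hn : 0 < n) :
    Integrable (fun x : Fin n → Obs d => normStat T x) (Measure.pi fun _ => obsLaw η ρ d) ∧
    ∫ x : Fin n → Obs d, |normStat T x| ∂(Measure.pi fun _ => obsLaw η ρ d)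
      ≤ ((d : ℝ) / n)⁻¹ * (b ^ 2 * formConst 2 κ * ((d : ℝ) / n)
        + b ^ 2 * (formConst 1 κ ^ 2 * C) + b ^ 2 * formConst 2 κ) := by
  have hd' : (0 : ℝ) < d := by exact_mod_cast hd
  have hn' : (1 : ℝ) ≤ n := by exact_mod_cast hn
  have hb := hη.1
  have hL := memLp_obsSq h hη T
  obtain ⟨hQi, hQ⟩ := obsSq_moments h hη T
  obtain ⟨hKi, hK⟩ := sqKernel_bounds (h.mono one_le_two) hη T
  rw [hTd] at hQ
  simp only [pow_one] at hKi hK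
  rw [frobSq_transpose_mul_self hT] at hK
  set μ := obsLaw η ρ d
  have hLi : ∀ i : Fin n, MemLp (fun x : Fin n → Obs d => obsSq T (x i)) 2
      (Measure.pi fun _ => μ) := fun i =>
    hL.comp_measurePreserving (measurePreserving_eval (fun _ : Fin n => μ) i)
  have iF2 : Integrable (fun x : Fin n → Obs d => fstMoment T x ^ 2) (Measure.pi fun _ => μ) :=
    ((memLp_finsetSum _ fun i _ => hLi i).const_mul _).integrable_sq
  have iQ : ∀ i : Fin n, Integrable (fun x : Fin n → Obs d => obsSq T (x i) ^ 2)
      (Measure.pi fun _ => μ) := fun i => integrable_coord i hQi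
  have iD : Integrable (fun x : Fin n → Obs d => diagMoment T x) (Measure.pi fun _ => μ) :=
    (integrable_finsetSum _ fun i _ => iQ i).const_mul _
  have hps := integral_pairSum (ι := Fin n) (F := sqKernel T) hKi
  have iU : Integrable (fun x : Fin n → Obs d => offDiagMoment T x) (Measure.pi fun _ => μ) :=
    hps.1.const_mul _
  have hsum : ∫ x : Fin n → Obs d, ∑ i, obsSq T (x i) ^ 2 ∂(Measure.pi fun _ => μ)
      ≤ n * (b ^ 2 * (formConst 2 κ * (d : ℝ) ^ 2)) := by
    rw [integral_finsetSum _ fun i _ => iQ i]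
    simp_rw [fun i : Fin n => integral_coord (ν := μ) i (F := fun e => obsSq T e ^ 2) hQi.1]
    simp only [Finset.sum_const, Finset.card_univ, Fintype.card_fin, nsmul_eq_mul]
    gcongr
  have bD : ∫ x : Fin n → Obs d, diagMoment T x ∂(Measure.pi fun _ => μ)
      ≤ b ^ 2 * formConst 2 κ * ((d : ℝ) / n) := by
    simp only [diagMoment]
    rw [integral_const_mul]
    calc _ ≤ ((d : ℝ) * n ^ 2)⁻¹ * (n * (b ^ 2 * (formConst 2 κ * (d : ℝ) ^ 2))) := by gcongr
      _ = _ := by field_simp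
  have bF : ∫ x : Fin n → Obs d, fstMoment T x ^ 2 ∂(Measure.pi fun _ => μ)
      ≤ b ^ 2 * formConst 2 κ := by
    have hpt : ∀ x : Fin n → Obs d, fstMoment T x ^ 2
        ≤ ((d : ℝ) * n)⁻¹ ^ 2 * (n * ∑ i, obsSq T (x i) ^ 2) := by
      intro x
      rw [fstMoment, mul_pow]
      refine mul_le_mul_of_nonneg_left ?_ (sq_nonneg _)
      have := sq_sum_le_card_mul_sum_sq (s := Finset.univ) (f := fun i => obsSq T (x i))
      simpa using this
    refine (integral_mono iF2
      (((integrable_finsetSum _ fun i _ => iQ i).const_mul _).const_mul _) hpt).trans ?_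
    rw [integral_const_mul, integral_const_mul]
    calc _ ≤ ((d : ℝ) * n)⁻¹ ^ 2 * (n * (n * (b ^ 2 * (formConst 2 κ * (d : ℝ) ^ 2)))) := by gcongr
      _ = _ := by field_simp
  have bU : ∫ x : Fin n → Obs d, offDiagMoment T x ∂(Measure.pi fun _ => μ)
      ≤ b ^ 2 * (formConst 1 κ ^ 2 * C) := by
    simp only [offDiagMoment]
    rw [integral_const_mul, hps.2, Fintype.card_fin]
    have hK0 : 0 ≤ ∫ e, sqKernel T e.1 e.2 ∂(μ.prod μ) := integral_nonneg fun _ => sq_nonneg _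
    calc _ ≤ ((d : ℝ) * n ^ 2)⁻¹ * (n * n * (b ^ (2 * 1) * (formConst 1 κ ^ 2 * (C * d)))) := by
          refine mul_le_mul_of_nonneg_left ?_ (by positivity)
          refine mul_le_mul ?_ (hK.trans ?_) hK0 (by positivity)
          · gcongr; linarith
          · gcongr
      _ = _ := by rw [mul_one]; field_simp
  constructor
  · exact ((iD.add iU).sub iF2).div_const _
  · have hpt : ∀ x : Fin n → Obs d, |normStat T x| ≤ ((d : ℝ) / n)⁻¹ *
        (diagMoment T x + offDiagMoment T x + fstMoment T x ^ 2) := by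
      intro x
      have h1 : 0 ≤ diagMoment T x :=
        mul_nonneg (by positivity) (Finset.sum_nonneg fun _ _ => sq_nonneg _)
      have h2 : 0 ≤ offDiagMoment T x :=
        mul_nonneg (by positivity) (Finset.sum_nonneg fun _ _ => sq_nonneg _)
      rw [normStat, div_eq_inv_mul, abs_mul, abs_of_pos (by positivity : (0 : ℝ) < ((d : ℝ) / n)⁻¹)]
      refine mul_le_mul_of_nonneg_left ?_ (by positivity)
      rw [abs_le]
      constructor <;> nlinarith [sq_nonneg (fstMoment T x)]
    refine (integral_mono_of_nonneg (ae_of_all _ fun x => abs_nonneg _)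
      (((iD.add iU).add iF2).const_mul _) (ae_of_all _ hpt)).trans ?_
    rw [integral_const_mul]
    refine mul_le_mul_of_nonneg_left ?_ (by positivity)
    have s1 := integral_add (iD.add iU) iF2
    have s2 := integral_add iD iU
    simp only [Pi.add_apply] at s1 s2 ⊢
    rw [s1, s2]
    linarith

/-- If the test fails to reject, either the statistic deviates from its mean `D n` by at least `D n
/ 2`, or the critical value is at least `D n / 2` in absolute value. Chebyshev's inequality bounds
the first event, Markov's the second. The critical point `y` is any fixed real number. -/
theorem tendsto_measure_test {κ b c C : ℝ} (h : MomentBound ρ 2 κ) (hvar : ∫ x, x ^ 2 ∂ρ = 1)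
    (hη : ScaleBound η b) (hm1 : 0 < ∫ w, w ^ 2 ∂η) {p : ℕ → ℕ} (hp : Tendsto p atTop atTop)
    (hc : 0 < c) (hpn : Tendsto (fun n : ℕ => (p n : ℝ) / (n : ℝ)) atTop (𝓝 c))
    {T : (n : ℕ) → Matrix (Fin (p n)) (Fin (p n)) ℝ} (hT : ∀ n, (T n)ᵀ = T n)
    (hTd : ∀ n, frobSq (T n) = p n) (hC : ∀ᶠ n in atTop, frobSq (T n * T n) ≤ C * p n)
    (hD : Tendsto (fun n : ℕ => ∫ x : Fin n → Obs (p n), pairSum (statKernel n (T n)) x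
      ∂(Measure.pi fun _ => obsLaw η ρ (p n))) atTop atTop) (y : ℝ) :
    Tendsto (fun n : ℕ => (Measure.pi fun _ : Fin n => obsLaw η ρ (p n))
      {x | √8 * normStat (T n) x * y < pairSum (statKernel n (T n)) x}ᶜ) atTop (𝓝 0) := by
  set D : ℕ → ℝ := fun n => ∫ x : Fin n → Obs (p n), pairSum (statKernel n (T n)) x
      ∂(Measure.pi fun _ => obsLaw η ρ (p n)) with hDdef
  set K1 := 4 * (b ^ 4 * (formConst 2 κ ^ 2 * C ^ 2))
  set K2 := 16 * (b ^ 2 * (((∫ x, x ^ 4 ∂ρ) + 1) * C))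
  set K3 := 32 * (b ^ 2 / (∫ w, w ^ 2 ∂η) ^ 2)
  have hinv : Tendsto (fun n : ℕ => (n : ℝ)⁻¹) atTop (𝓝 0) := tendsto_inv_atTop_nhds_zero_nat
  have hDinv : Tendsto (fun n => (D n)⁻¹) atTop (𝓝 0) := tendsto_inv_atTop_zero.comp hD
  have hlim : Tendsto (fun n : ℕ => (4 * K1 * (D n)⁻¹ ^ 2 + 4 * K2 * (D n)⁻¹ + 4 * K3 * (n : ℝ)⁻¹)
      + 2 * √8 * |y| * (D n)⁻¹ * (((p n : ℝ) / n)⁻¹ * (b ^ 2 * formConst 2 κ * ((p n : ℝ) / n)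
        + b ^ 2 * (formConst 1 κ ^ 2 * C) + b ^ 2 * formConst 2 κ)))
      atTop (𝓝 ((4 * K1 * 0 ^ 2 + 4 * K2 * 0 + 4 * K3 * 0)
      + 2 * √8 * |y| * 0 * (c⁻¹ * (b ^ 2 * formConst 2 κ * c
        + b ^ 2 * (formConst 1 κ ^ 2 * C) + b ^ 2 * formConst 2 κ)))) :=
    ((((hDinv.pow 2).const_mul _).add (hDinv.const_mul _)).add (hinv.const_mul _)).add
      ((hDinv.const_mul _).mul ((hpn.inv₀ hc.ne').mul
        (((hpn.const_mul _).add_const _).add_const _)))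
  norm_num at hlim
  rw [← ENNReal.tendsto_toReal_iff (fun _ => measure_ne_top _ _) ENNReal.zero_ne_top]
  refine squeeze_zero' (Eventually.of_forall fun _ => ENNReal.toReal_nonneg) ?_ hlim
  filter_upwards [hp.eventually_gt_atTop 0, eventually_ge_atTop 2, hC, hD.eventually_gt_atTop 0]
    with n hn1 hn2 hCn hDn
  obtain ⟨hVL, hV⟩ := integral_pairSum_statKernel_sub_sq_le (η := η) h hvar hη (hT n) hCn hm1 hn1
    hn2 (D := D n) rfl
  obtain ⟨hGi, hG⟩ := integral_abs_normStat_le (η := η) h hη (hT n) (hTd n) hCn hn1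
    (by omega : 0 < n)
  set μ := Measure.pi fun _ : Fin n => obsLaw η ρ (p n)
  set s : Set (Fin n → Obs (p n)) := {x | (D n / 2) ^ 2 ≤ (pairSum (statKernel n (T n)) x - D n) ^ 2}
  set t : Set (Fin n → Obs (p n)) := {x | D n ≤ 2 * √8 * |y| * |normStat (T n) x|}
  have hsub : {x | √8 * normStat (T n) x * y < pairSum (statKernel n (T n)) x}ᶜ ⊆ s ∪ t := by
    intro x hx
    simp only [Set.mem_compl_iff, Set.mem_ofPred_eq, not_lt] at hx
    by_contra hcon
    simp only [s, t, Set.mem_union, Set.mem_ofPred_eq, not_or, not_le] at hcon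
    have h1 := abs_lt_of_sq_lt_sq hcon.1 (by positivity)
    have h2 := (abs_lt.1 h1).1
    have h3 : √8 * normStat (T n) x * y ≤ √8 * |y| * |normStat (T n) x| := by
      calc _ ≤ |√8 * normStat (T n) x * y| := le_abs_self _
        _ = _ := by rw [abs_mul, abs_mul, abs_of_nonneg (Real.sqrt_nonneg 8)]; ring
    have := hcon.2
    linarith
  have hs := mul_meas_ge_le_integral_of_nonneg (ae_of_all _ fun x => sq_nonneg _)
    hVL.integrable_sq ((D n / 2) ^ 2)
  have ht := mul_meas_ge_le_integral_of_nonneg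
    (f := fun x => 2 * √8 * |y| * |normStat (T n) x|) (μ := μ) (ae_of_all _ fun x => by positivity)
    (hGi.abs.const_mul _) (D n)
  rw [integral_const_mul] at ht
  have hs' : μ.real s ≤ 4 * K1 * (D n)⁻¹ ^ 2 + 4 * K2 * (D n)⁻¹ + 4 * K3 * (n : ℝ)⁻¹ := by
    have : μ.real s ≤ ((D n / 2) ^ 2)⁻¹ * (K1 + K2 * D n + K3 * D n ^ 2 * (n : ℝ)⁻¹) := by
      rw [← div_eq_inv_mul, le_div_iff₀ (by positivity), mul_comm]
      exact hs.trans hV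
    refine this.trans (le_of_eq ?_)
    have hn0 : (n : ℝ) ≠ 0 := by positivity
    field_simp
    ring
  have ht' : μ.real t ≤ 2 * √8 * |y| * (D n)⁻¹ * (((p n : ℝ) / n)⁻¹ *
      (b ^ 2 * formConst 2 κ * ((p n : ℝ) / n)
        + b ^ 2 * (formConst 1 κ ^ 2 * C) + b ^ 2 * formConst 2 κ)) := by
    have h1 : μ.real t ≤ (D n)⁻¹ * (2 * √8 * |y| * ∫ x, |normStat (T n) x| ∂μ) := by
      rw [← div_eq_inv_mul, le_div_iff₀ hDn, mul_comm]
      exact ht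
    refine (h1.trans (mul_le_mul_of_nonneg_left (mul_le_mul_of_nonneg_left hG (by positivity))
      (by positivity))).trans (le_of_eq ?_)
    ring
  calc _ ≤ μ.real (s ∪ t) := measureReal_mono hsub
    _ ≤ μ.real s + μ.real t := measureReal_union_le _ _
    _ ≤ _ := by
      refine (add_le_add hs' ht').trans (le_of_eq ?_)
      try simp only [inv_div, inv_pow]

end Alternative

/-! ### Spectral moments of the sample covariance matrix -/

section Spectral

variable {n d : ℕ}

theorem sum_eigenvalues_sq {A : Matrix (Fin d) (Fin d) ℝ} (hA : A.IsHermitian) :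
    ∑ j, hA.eigenvalues j ^ 2 = (A ^ 2).trace := by
  have hs := hA.spectral_theorem
  rw [Unitary.conjStarAlgAut_apply] at hs
  set U := (hA.eigenvectorUnitary : Matrix (Fin d) (Fin d) ℝ)
  set D := diagonal (RCLike.ofReal ∘ hA.eigenvalues : Fin d → ℝ) with hD
  have hU : star U * U = 1 := Unitary.coe_star_mul_self hA.eigenvectorUnitary
  have h2 : A ^ 2 = U * (D * D * star U) := by
    calc A ^ 2 = (U * D * star U) * (U * D * star U) := by rw [sq]; congr 1
      _ = U * D * (star U * U) * D * star U := by simp only [Matrix.mul_assoc]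
      _ = _ := by rw [hU, Matrix.mul_one]; simp only [Matrix.mul_assoc]
  rw [h2, trace_mul_comm, Matrix.mul_assoc, hU, Matrix.mul_one, hD, diagonal_mul_diagonal,
    trace_diagonal]
  simp [sq]

theorem betaHat_eq (x : Fin n → Fin d → ℝ) (k : ℕ) :
    betaHat x k = (d : ℝ)⁻¹ * ∑ j, (isHermitian_sampleCov x).eigenvalues j ^ k := by
  rw [betaHat, spectralDist, integral_smul_measure,
    integral_finsetSum_measure fun j _ => integrable_dirac (by simp)]
  simp

theorem betaHat_one (x : Fin n → Fin d → ℝ) :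
    betaHat x 1 = (d : ℝ)⁻¹ * (sampleCov x).trace := by
  rw [betaHat_eq, (isHermitian_sampleCov x).trace_eq_sum_eigenvalues]
  simp

theorem betaHat_two (x : Fin n → Fin d → ℝ) :
    betaHat x 2 = (d : ℝ)⁻¹ * (sampleCov x ^ 2).trace := by
  rw [betaHat_eq, sum_eigenvalues_sq]

theorem trace_sampleCov (x : Fin n → Fin d → ℝ) :
    (sampleCov x).trace = (n : ℝ)⁻¹ * ∑ i, x i ⬝ᵥ x i := by
  simp [sampleCov, trace_smul, trace_sum, trace_vecMulVec]

theorem trace_sampleCov_sq (x : Fin n → Fin d → ℝ) :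
    (sampleCov x ^ 2).trace = ((n : ℝ) ^ 2)⁻¹ * ∑ i, ∑ j, (x i ⬝ᵥ x j) ^ 2 := by
  have h : ∀ i j, (vecMulVec (x i) (x i) * vecMulVec (x j) (x j)).trace = (x i ⬝ᵥ x j) ^ 2 := by
    intro i j
    rw [vecMulVec_mul_vecMulVec, trace_vecMulVec, dotProduct_smul, smul_eq_mul, sq]
  rw [sampleCov, sq, smul_mul_smul_comm, trace_smul, Finset.sum_mul_sum, trace_sum]
  simp_rw [trace_sum, h]
  rw [smul_eq_mul, ← sq, inv_pow]

theorem betaCheck_two (x : Fin n → Fin d → ℝ) (q : Fin n → Equiv.Perm (Fin d)) :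
    betaCheck x q 2
      = (d : ℝ)⁻¹ * (((n : ℝ) ^ 2)⁻¹ * ∑ i, ∑ j, ((x i ∘ q i) ⬝ᵥ (x j ∘ q j)) ^ 2) := by
  rw [betaCheck, trace_sampleCov_sq, div_eq_inv_mul]
  simp only [permutedSample, permMatrix_mulVec]

theorem sum_sum_eq_diag_add_pairSum {ι E : Type*} [Fintype ι] [DecidableEq ι] (F : E → E → ℝ)
    (x : ι → E) : ∑ i, ∑ j, F (x i) (x j) = ∑ i, F (x i) (x i) + pairSum F x := by
  rw [← Finset.sum_product', ← Finset.diag_union_offDiag,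
    Finset.sum_union (Finset.disjoint_diag_offDiag _), Finset.sum_diag]
  rfl

/-- The identity is exact: the diagonal terms cancel pairwise because `obsKernel_self` vanishes. -/
theorem testStat_eq (T : Matrix (Fin d) (Fin d) ℝ) (X : Fin n → Obs d) :
    n * testStat (fun i => obsVec T (X i)) (fun i => (X i).2.2) = pairSum (statKernel n T) X := by
  have h : testStat (fun i => obsVec T (X i)) (fun i => (X i).2.2)
      = (d : ℝ)⁻¹ * (((n : ℝ) ^ 2)⁻¹ * ∑ i, ∑ j, obsKernel T (X i) (X j)) := by
    rw [testStat, betaHat_two, betaCheck_two, trace_sampleCov_sq, ← mul_sub, ← mul_sub]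
    simp only [obsKernel, Finset.sum_sub_distrib]
  have h2 : pairSum (statKernel n T) X = ((d : ℝ) * n)⁻¹ * pairSum (obsKernel T) X := by
    simp only [pairSum, statKernel, Finset.mul_sum]
  rw [h, h2, sum_sum_eq_diag_add_pairSum]
  simp only [obsKernel_self, Finset.sum_const_zero, zero_add]
  rcases Nat.eq_zero_or_pos n with rfl | hn
  · simp
  · have : (n : ℝ) ≠ 0 := by positivity
    field_simp

theorem gammaHat_eq (T : Matrix (Fin d) (Fin d) ℝ) (X : Fin n → Obs d) :
    gammaHat (fun i => obsVec T (X i)) = normStat T X := by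
  rw [gammaHat, normStat, betaHat_two, betaHat_one, trace_sampleCov, trace_sampleCov_sq]
  have := sum_sum_eq_diag_add_pairSum (sqKernel T) X
  simp only [sqKernel] at this
  rw [this]
  congr 2
  · simp only [diagMoment, offDiagMoment, obsSq, mul_inv]
    ring
  · simp only [fstMoment, obsSq, mul_inv]
    ring

end Spectral

/-! ### The joint law of the observations -/

section Law

variable {Ω : Type*} [MeasurableSpace Ω] {P : Measure Ω} [IsProbabilityMeasure P]

theorem map_eq_pi_of_iIndepFun {ι α : Type*} [Fintype ι] [MeasurableSpace α] {Y : ι → Ω → α}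
    {μ : Measure α} (hY : ∀ i, Measurable (Y i)) (hind : iIndepFun Y P)
    (hμ : ∀ i, P.map (Y i) = μ) : P.map (fun ω i => Y i ω) = Measure.pi fun _ => μ := by
  rw [hind.map_fun_eq_pi_map fun i => (hY i).aemeasurable]
  simp_rw [hμ]

theorem map_array_eq_pi {z : ℕ → ℕ → Ω → ℝ} (hz_meas : ∀ i j, Measurable (z i j))
    (hz_indep : iIndepFun (fun ij : ℕ × ℕ => z ij.1 ij.2) P)
    (hz_ident : ∀ i j, IdentDistrib (z i j) (z 0 0) P P) (n d : ℕ) :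
    P.map (fun ω (i : Fin n) (j : Fin d) => z i j ω)
      = Measure.pi fun _ => Measure.pi fun _ => P.map (z 0 0) := by
  have : IsProbabilityMeasure (P.map (z 0 0)) :=
    Measure.isProbabilityMeasure_map (hz_meas 0 0).aemeasurable
  have hinj : Function.Injective fun u : Fin n × Fin d => ((u.1 : ℕ), (u.2 : ℕ)) := by
    rintro ⟨a, b⟩ ⟨a', b'⟩ h
    simp only [Prod.mk.injEq, Fin.val_inj] at h
    exact Prod.ext h.1 h.2
  have h1 := map_eq_pi_of_iIndepFun (P := P) (Y := fun u : Fin n × Fin d => z u.1 u.2)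
    (μ := P.map (z 0 0)) (fun u => hz_meas _ _) (hz_indep.precomp hinj)
    (fun u => (hz_ident _ _).map_eq)
  have h2 := Measure.infinitePi_map_curry (ι := Fin n) (κ := Fin d)
    (fun _ _ => P.map (z 0 0))
  simp only [Measure.infinitePi_eq_pi] at h2
  rw [← h2, ← h1, Measure.map_map (MeasurableEquiv.measurable _)
    (measurable_pi_lambda _ fun u => hz_meas _ _)]
  rfl

theorem map_perm_eq {d : ℕ} {q : Ω → Equiv.Perm (Fin d)} (hq : Measurable q)
    (hunif : ∀ σ, P {ω | q ω = σ} = (d.factorial : ℝ≥0∞)⁻¹) : P.map q = permLaw d := by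
  refine Measure.ext_of_singleton fun σ => ?_
  rw [Measure.map_apply hq (measurableSet_singleton σ), permLaw,
    PMF.toMeasure_apply_singleton _ _ (measurableSet_singleton σ)]
  simp only [PMF.uniformOfFintype_apply, Fintype.card_perm, Fintype.card_fin]
  exact hunif σ

/-- Scales, vectors and permutations form three independent blocks, each with a product law. A
measure-preserving rearrangement turns this product of arrays into an array of i.i.d. triples. -/
theorem map_obs_eq_pi {z : ℕ → ℕ → Ω → ℝ} {w : ℕ → Ω → ℝ}
    (hz_meas : ∀ i j, Measurable (z i j)) (hw_meas : ∀ i, Measurable (w i))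
    (hz_indep : iIndepFun (fun ij : ℕ × ℕ => z ij.1 ij.2) P) (hw_indep : iIndepFun w P)
    (hz_ident : ∀ i j, IdentDistrib (z i j) (z 0 0) P P)
    (hw_ident : ∀ i, IdentDistrib (w i) (w 0) P P)
    (hzw_indep : IndepFun (fun ω (ij : ℕ × ℕ) => z ij.1 ij.2 ω) (fun ω i => w i ω) P)
    {n d : ℕ} {q : Fin n → Ω → Equiv.Perm (Fin d)} (hq_meas : ∀ i, Measurable (q i))
    (hq_unif : ∀ i σ, P {ω | q i ω = σ} = (d.factorial : ℝ≥0∞)⁻¹) (hq_indep : iIndepFun q P)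
    (hqzw_indep : IndepFun (fun ω i => q i ω)
      (fun ω => ((fun ij : ℕ × ℕ => z ij.1 ij.2 ω), (fun i : ℕ => w i ω))) P) :
    P.map (fun ω (i : Fin n) => ((w i ω, (fun j : Fin d => z i j ω), q i ω) : Obs d))
      = Measure.pi fun _ => obsLaw (P.map (w 0)) (P.map (z 0 0)) d := by
  have hη : IsProbabilityMeasure (P.map (w 0)) :=
    Measure.isProbabilityMeasure_map (hw_meas 0).aemeasurable
  have hρ : IsProbabilityMeasure (P.map (z 0 0)) :=
    Measure.isProbabilityMeasure_map (hz_meas 0 0).aemeasurable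
  set η := P.map (w 0)
  set ρ := P.map (z 0 0)
  have hW : P.map (fun ω (i : Fin n) => w i ω) = Measure.pi fun _ => η :=
    map_eq_pi_of_iIndepFun (Y := fun (i : Fin n) => w i) (fun i => hw_meas i)
      (hw_indep.precomp Fin.val_injective) fun i => (hw_ident i).map_eq
  have hZ := map_array_eq_pi hz_meas hz_indep hz_ident n d
  have hQ : P.map (fun ω i => q i ω) = Measure.pi fun _ => permLaw d :=
    map_eq_pi_of_iIndepFun hq_meas hq_indep fun i => map_perm_eq (hq_meas i) (hq_unif i)
  have mW : Measurable fun ω (i : Fin n) => w i ω := by fun_prop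
  have mZ : Measurable fun ω (i : Fin n) (j : Fin d) => z i j ω := by fun_prop
  have mQ : Measurable fun ω i => q i ω := measurable_pi_lambda _ hq_meas
  have iZW : IndepFun (fun ω (i : Fin n) (j : Fin d) => z i j ω) (fun ω (i : Fin n) => w i ω) P :=
    hzw_indep.comp (φ := fun (u : ℕ × ℕ → ℝ) (i : Fin n) (j : Fin d) => u ((i : ℕ), (j : ℕ)))
      (ψ := fun (v : ℕ → ℝ) (i : Fin n) => v (i : ℕ)) (by fun_prop) (by fun_prop)
  have iQZW : IndepFun (fun ω i => q i ω)
      (fun ω => ((fun (i : Fin n) (j : Fin d) => z i j ω), fun (i : Fin n) => w i ω)) P :=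
    hqzw_indep.comp (φ := id) (ψ := fun v : (ℕ × ℕ → ℝ) × (ℕ → ℝ) =>
      ((fun (i : Fin n) (j : Fin d) => v.1 ((i : ℕ), (j : ℕ))), fun (i : Fin n) => v.2 (i : ℕ)))
      measurable_id (by fun_prop)
  have hZW : P.map (fun ω => ((fun (i : Fin n) (j : Fin d) => z i j ω), fun (i : Fin n) => w i ω))
      = (Measure.pi fun _ => Measure.pi fun _ => ρ).prod (Measure.pi fun _ => η) := by
    rw [(indepFun_iff_map_prod_eq_prod_map_map mZ.aemeasurable mW.aemeasurable).1 iZW, hZ, hW]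
  have hQZW : P.map (fun ω => ((fun i => q i ω),
      ((fun (i : Fin n) (j : Fin d) => z i j ω), fun (i : Fin n) => w i ω)))
      = (Measure.pi fun _ => permLaw d).prod
        ((Measure.pi fun _ => Measure.pi fun _ => ρ).prod (Measure.pi fun _ => η)) := by
    rw [(indepFun_iff_map_prod_eq_prod_map_map mQ.aemeasurable
      (mZ.prodMk mW).aemeasurable).1 iQZW, hQ, hZW]
  have p1 := (measurePreserving_arrowProdEquivProdArrow (Fin d → ℝ) ℝ (Fin n)
    (fun _ => Measure.pi fun _ => ρ) (fun _ => η)).symm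
  have p2 := (measurePreserving_arrowProdEquivProdArrow (Equiv.Perm (Fin d)) ((Fin d → ℝ) × ℝ)
    (Fin n) (fun _ => permLaw d) (fun _ => (Measure.pi fun _ => ρ).prod η)).symm
  have p3 : MeasurePreserving
      (fun u : Equiv.Perm (Fin d) × ((Fin d → ℝ) × ℝ) => ((u.2.2, u.2.1, u.1) : Obs d))
      ((permLaw d).prod ((Measure.pi fun _ => ρ).prod η)) (obsLaw η ρ d) :=
    (measurePreserving_prodAssoc _ _ _).comp
      (((Measure.measurePreserving_swap (μ := Measure.pi fun _ : Fin d => ρ) (ν := η)).prod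
        (MeasurePreserving.id (permLaw d))).comp Measure.measurePreserving_swap)
  have p4 := measurePreserving_pi (fun _ : Fin n => (permLaw d).prod
    ((Measure.pi fun _ : Fin d => ρ).prod η)) (fun _ => obsLaw η ρ d) fun _ => p3
  have p5 := p4.comp (p2.comp ((MeasurePreserving.id _).prod p1))
  rw [← p5.map_eq, ← hQZW, Measure.map_map p5.measurable (mQ.prodMk (mZ.prodMk mW))]
  rfl

theorem exists_momentBound {ρ : Measure ℝ} [IsProbabilityMeasure ρ] {r : ℕ}
    (h : Integrable (fun x : ℝ => x ^ (2 * r)) ρ) (hmean : ∫ x, x ∂ρ = 0) :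
    ∃ κ, MomentBound ρ r κ := by
  have h0 : ∀ k, 0 ≤ ∫ x : ℝ, x ^ (2 * k) ∂ρ := fun k =>
    integral_nonneg fun x => by rw [pow_mul]; positivity
  refine ⟨1 + ∑ k ∈ Finset.range (r + 1), ∫ x : ℝ, x ^ (2 * k) ∂ρ, ?_, ?_, hmean, ?_⟩
  · linarith [Finset.sum_nonneg fun k (_ : k ∈ Finset.range (r + 1)) => h0 k]
  · exact memLp_of_integrable_even_pow measurable_id.aestronglyMeasurable h
  · intro k hk
    have := Finset.single_le_sum (f := fun k => ∫ x : ℝ, x ^ (2 * k) ∂ρ) (fun k _ => h0 k)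
      (Finset.mem_range.2 (Nat.lt_succ_of_le hk))
    linarith

theorem le_integral_pow_of_le_sq {η : Measure ℝ} [IsProbabilityMeasure η] {a b : ℝ} (ha : 0 ≤ a)
    (hη : ScaleBound η b) (hlow : ∀ᵐ w ∂η, a ≤ w ^ 2) (k : ℕ) :
    a ^ k ≤ ∫ w, w ^ (2 * k) ∂η := by
  have : ∫ _, a ^ k ∂η ≤ ∫ w, w ^ (2 * k) ∂η := by
    refine integral_mono_ae (integrable_const _) (hη.integrable_pow k) ?_
    filter_upwards [hlow] with w hw
    rw [pow_mul]
    gcongr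
  simpa using this

end Law

/-! ### Spherical population covariance matrices -/

section Spherical

variable {d : ℕ}

/-- In `(T + 1) * (T - 1) = 0` the first factor is positive definite, hence invertible. -/
theorem eq_one_of_posDef_of_sq_eq_one {T : Matrix (Fin d) (Fin d) ℝ} (hT : T.PosDef)
    (h : T ^ 2 = 1) : T = 1 := by
  have h1 : (T + 1).PosDef := hT.add PosDef.one
  have h2 : (T + 1) * (T - 1) = 0 := by
    have : (T + 1) * (T - 1) = T ^ 2 - 1 := by noncomm_ring
    rw [this, h, sub_self]
  have h3 := (h1.isUnit.mul_right_eq_zero).1 h2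
  exact sub_eq_zero.1 h3

/-- Sphericity makes `T ^ 2` scalar, and the trace normalization fixes the scalar to be `1`. -/
theorem eq_one_of_isSpherical {T : Matrix (Fin d) (Fin d) ℝ} (hT : T.PosDef)
    (htr : (T ^ 2).trace = d) (hd : 0 < d) {m : ℝ} (hm : 0 < m) (h : IsSpherical (m • T ^ 2)) :
    T = 1 := by
  obtain ⟨s, -, hs⟩ := h
  refine eq_one_of_posDef_of_sq_eq_one hT ?_
  have h1 : T ^ 2 = (m⁻¹ * s) • (1 : Matrix (Fin d) (Fin d) ℝ) := by
    rw [mul_smul, ← hs, smul_smul, inv_mul_cancel₀ hm.ne', one_smul]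
  have hd' : (d : ℝ) ≠ 0 := by positivity
  have h2 : m⁻¹ * s = 1 := by
    rw [h1, trace_smul, trace_one, Fintype.card_fin, smul_eq_mul] at htr
    exact mul_right_cancel₀ hd' (htr.trans (one_mul _).symm)
  rw [h1, h2, one_smul]

theorem frobSq_eq_trace_sq {T : Matrix (Fin d) (Fin d) ℝ} (hT : Tᵀ = T) :
    frobSq T = (T ^ 2).trace := by
  rw [frobSq_eq_trace, hT, sq]

theorem frobSq_mul_self_eq_trace {T : Matrix (Fin d) (Fin d) ℝ} (hT : Tᵀ = T) :
    frobSq (T * T) = (T ^ 4).trace := by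
  rw [frobSq_eq_trace, transpose_mul, hT]
  congr 1
  noncomm_ring

end Spherical

/-! ### Measurability of the statistics -/

section Measurability

variable {d n : ℕ}

theorem measurable_statKernel (T : Matrix (Fin d) (Fin d) ℝ) :
    Measurable (Function.uncurry (statKernel n T)) :=
  (measurable_obsKernel T).const_mul _

theorem measurable_normStat (T : Matrix (Fin d) (Fin d) ℝ) :
    Measurable fun x : Fin n → Obs d => normStat T x := by
  have h : ∀ i : Fin n, Measurable fun x : Fin n → Obs d => obsSq T (x i) := fun i =>
    (measurable_obsSq T).comp (measurable_pi_apply i)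
  have h1 : Measurable fun x : Fin n → Obs d => fstMoment T x :=
    (Finset.measurable_sum _ fun i _ => h i).const_mul _
  have h2 : Measurable fun x : Fin n → Obs d => diagMoment T x :=
    (Finset.measurable_sum _ fun i _ => (h i).pow_const 2).const_mul _
  have h3 : Measurable fun x : Fin n → Obs d => offDiagMoment T x :=
    (measurable_pairSum (measurable_sqKernel T)).const_mul _
  exact ((h2.add h3).sub (h1.pow_const 2)).div_const _

end Measurability

/-! ### Convergence of random variables -/

section Convergence

variable {Ω : Type*} [MeasurableSpace Ω] {P : Measure Ω} [IsProbabilityMeasure P]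

theorem tendstoInDistribution_const_mul_gaussian {N : ℕ → Ω → ℝ} (hN : ∀ n, Measurable (N n))
    (s : ℝ) (h : ∀ t : ℝ, Tendsto (fun n => ∫ ω, Complex.exp ((t * N n ω : ℝ) * Complex.I) ∂P) atTop
      (𝓝 (Complex.exp (-(s ^ 2 * t ^ 2 / 2 : ℝ))))) :
    TendstoInDistribution N atTop (fun x : ℝ => s * x) (fun _ => P) (gaussianReal 0 1) where
  forall_aemeasurable n := (hN n).aemeasurable
  aemeasurable_limit := by fun_prop
  tendsto := by
    refine ProbabilityMeasure.tendsto_iff_tendsto_charFun.2 fun t => ?_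
    have h1 : charFun ((gaussianReal 0 1).map fun x : ℝ => s * x) t
        = Complex.exp (-(s ^ 2 * t ^ 2 / 2 : ℝ)) := by
      rw [charFun_map_mul, charFun_gaussianReal]
      congr 1
      push_cast
      simp
      ring
    have h2 : ∀ n, charFun (P.map (N n)) t
        = ∫ ω, Complex.exp ((t * N n ω : ℝ) * Complex.I) ∂P := by
      intro n
      rw [charFun_apply_real, integral_map (hN n).aemeasurable (by fun_prop)]
      simp only [Complex.ofReal_mul]
    simp only [ProbabilityMeasure.coe_mk]
    rw [h1]
    simp_rw [h2]
    exact h t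

theorem tendstoInMeasure_inv_const_mul {G : ℕ → Ω → ℝ} {M r : ℝ} (hM : M ≠ 0) (hr : r ≠ 0)
    (h : ∀ ε : ℝ, 0 < ε → Tendsto (fun n => P {ω | ε ≤ |G n ω - M|}) atTop (𝓝 0)) :
    TendstoInMeasure P (fun n ω => (r * G n ω)⁻¹) atTop fun _ => (r * M)⁻¹ := by
  rw [tendstoInMeasure_iff_dist]
  intro ε hε
  have hc : ContinuousAt (fun g : ℝ => (r * g)⁻¹) M :=
    (continuousAt_const.mul continuousAt_id).inv₀ (mul_ne_zero hr hM)
  obtain ⟨δ, hδ, hcδ⟩ := Metric.continuousAt_iff.1 hc ε hε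
  refine tendsto_of_tendsto_of_tendsto_of_le_of_le tendsto_const_nhds (h δ hδ)
    (fun _ => zero_le) fun n => measure_mono fun ω hω => ?_
  simp only [Set.mem_ofPred_eq] at hω ⊢
  by_contra hcon
  exact absurd (hcδ (by rw [Real.dist_eq]; exact not_le.1 hcon)) (not_lt.2 hω)

/-- Lévy's continuity theorem for the numerator, combined with Slutsky's theorem for the product
with the reciprocal of the denominator. -/
theorem tendstoInDistribution_studentized {N G : ℕ → Ω → ℝ} (hN : ∀ n, Measurable (N n))
    (hG : ∀ n, Measurable (G n)) {M r : ℝ} (hM : M ≠ 0) (hr : r ≠ 0)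
    (hcf : ∀ t : ℝ, Tendsto (fun n => ∫ ω, Complex.exp ((t * N n ω : ℝ) * Complex.I) ∂P) atTop
      (𝓝 (Complex.exp (-((r * M) ^ 2 * t ^ 2 / 2 : ℝ)))))
    (hlim : ∀ ε : ℝ, 0 < ε → Tendsto (fun n => P {ω | ε ≤ |G n ω - M|}) atTop (𝓝 0)) :
    TendstoInDistribution (fun n ω => N n ω / (r * G n ω)) atTop (id : ℝ → ℝ) (fun _ => P)
      (gaussianReal 0 1) := by
  have h := (tendstoInDistribution_const_mul_gaussian hN (r * M) hcf
    ).continuous_comp_prodMk_of_tendstoInMeasure_const (g := fun u : ℝ × ℝ => u.1 * u.2)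
    (by fun_prop) (tendstoInMeasure_inv_const_mul hM hr hlim)
    fun n => ((hG n).const_mul r).inv.aemeasurable
  have e : (fun x : ℝ => (r * M) * x * (r * M)⁻¹) = id := by
    ext x
    have := mul_ne_zero hr hM
    simp only [id]
    field_simp
  simp only [e] at h
  exact h

end Convergence

end ScaleMixture

/-! ### Transfer to the original probability space -/

theorem theorem4
    {Ω : Type*} [MeasurableSpace Ω] (P : Measure Ω) [IsProbabilityMeasure P]
    -- dimensions: `p = p n`, with `p / n → c ∈ (0, ∞)`
    (p : ℕ → ℕ) (c : ℝ) (hc : 0 < c) (hp : Tendsto p atTop atTop)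
    (hpn : Tendsto (fun n : ℕ => (p n : ℝ) / (n : ℝ)) atTop (𝓝 c))
    -- the two independent arrays of i.i.d. random variables
    (z : ℕ → ℕ → Ω → ℝ) (w : ℕ → Ω → ℝ)
    (hz_meas : ∀ i j, Measurable (z i j)) (hw_meas : ∀ i, Measurable (w i))
    (hz_indep : iIndepFun (fun ij : ℕ × ℕ => z ij.1 ij.2) P)
    (hw_indep : iIndepFun w P)
    (hz_ident : ∀ i j, IdentDistrib (z i j) (z 0 0) P P)
    (hw_ident : ∀ i, IdentDistrib (w i) (w 0) P P)
    (hzw_indep : IndepFun (fun ω (ij : ℕ × ℕ) => z ij.1 ij.2 ω) (fun ω i => w i ω) P)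
    (hz_mean : ∫ ω, z 0 0 ω ∂P = 0) (hz_var : ∫ ω, z 0 0 ω ^ 2 ∂P = 1)
    (hz_four : Integrable (fun ω => z 0 0 ω ^ 4) P)
    -- the matrices `T_p`, normalized by `tr(T_p²) = p`; spectral distribution of `T_p²`
    (T : (n : ℕ) → Matrix (Fin (p n)) (Fin (p n)) ℝ)
    (hT : ∀ n, (T n).PosDef) (hT_trace : ∀ n, (T n ^ 2).trace = p n)
    (H : Measure ℝ) [IsProbabilityMeasure H]
    (hH : ScaleMixture.WeaklyConverges
      (fun n => ScaleMixture.spectralDist (T n ^ 2)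
        (ScaleMixture.isHermitian_sq (hT n).isHermitian)) H)
    -- the distribution of `w²` is supported in some `[a, b]` with `0 < a < b`
    (hG : ∃ a b : ℝ, 0 < a ∧ a < b ∧
      ∀ᵐ t ∂(P.map fun ω => w 0 ω ^ 2), t ∈ Set.Icc a b)
    -- for each `n`: i.i.d. uniform random permutations, independent of the two arrays
    (Q : (n : ℕ) → Fin n → Ω → Equiv.Perm (Fin (p n)))
    (hQ_meas : ∀ n i, Measurable (Q n i))
    (hQ_unif : ∀ n i (σ : Equiv.Perm (Fin (p n))),
      P {ω | Q n i ω = σ} = ((p n).factorial : ℝ≥0∞)⁻¹)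
    (hQ_indep : ∀ n, iIndepFun (Q n) P)
    (hQzw_indep : ∀ n, IndepFun (fun ω i => Q n i ω)
      (fun ω => ((fun ij : ℕ × ℕ => z ij.1 ij.2 ω), (fun i : ℕ => w i ω))) P)
    -- names: the sample, the population covariance matrix, the statistics, `δ_n`
    (x : (n : ℕ) → Ω → Fin n → Fin (p n) → ℝ)
    (hx : ∀ n ω, x n ω =
      ScaleMixture.observations (T n) (fun i j => z i j ω) (fun i => w i ω))
    (popCov : (n : ℕ) → Matrix (Fin (p n)) (Fin (p n)) ℝ)
    (h_popCov : ∀ n, popCov n = (∫ ω, w 0 ω ^ 2 ∂P) • T n ^ 2)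
    (stat : ℕ → Ω → ℝ)
    (h_stat : ∀ n ω, stat n ω = ScaleMixture.testStat (x n ω) (fun i => Q n i ω))
    (gam : ℕ → Ω → ℝ) (h_gam : ∀ n ω, gam n ω = ScaleMixture.gammaHat (x n ω))
    (del : ℕ → ℝ) (h_del : ∀ n, del n = ∫ ω, stat n ω ∂P) :
    ((∀ᶠ n in atTop, ScaleMixture.IsSpherical (popCov n)) →
      Integrable (fun ω => z 0 0 ω ^ 8) P →
      TendstoInDistribution
        (fun (n : ℕ) ω => (n : ℝ) * stat n ω / (√8 * gam n ω)) atTop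
        (id : ℝ → ℝ) (fun _ => P) (gaussianReal 0 1))
    ∧
    ((∀ᶠ n in atTop, ¬ ScaleMixture.IsSpherical (popCov n)) →
      Integrable (fun t : ℝ => t ^ 2) H →
      Tendsto (fun n => (T n ^ 4).trace / (p n : ℝ)) atTop (𝓝 (∫ t, t ^ 2 ∂H)) →
      Tendsto (fun n : ℕ => (n : ℝ) * del n) atTop atTop →
      ∀ α : ℝ, 0 < α → α < 1 → ∀ zα : ℝ, cdf (gaussianReal 0 1) zα = 1 - α →
        Tendsto (fun n : ℕ => P {ω | √8 * gam n ω * zα < (n : ℝ) * stat n ω})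
          atTop (𝓝 1)) := by
  obtain ⟨a, b, ha, hab, hGae⟩ := hG
  have hη : IsProbabilityMeasure (P.map (w 0)) :=
    Measure.isProbabilityMeasure_map (hw_meas 0).aemeasurable
  have hρ : IsProbabilityMeasure (P.map (z 0 0)) :=
    Measure.isProbabilityMeasure_map (hz_meas 0 0).aemeasurable
  have hGw : ∀ᵐ t ∂(P.map (w 0)), t ^ 2 ∈ Set.Icc a b := by
    have h1 := ae_of_ae_map ((hw_meas 0).pow_const 2).aemeasurable hGae
    exact (ae_map_iff (hw_meas 0).aemeasurable
      (measurableSet_Icc.preimage (measurable_id.pow_const 2))).2 h1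
  have hsb : ScaleMixture.ScaleBound (P.map (w 0)) b :=
    ⟨(ha.trans hab).le, hGw.mono fun _ h => h.2⟩
  have hlow : ∀ᵐ t ∂(P.map (w 0)), a ≤ t ^ 2 := hGw.mono fun _ h => h.1
  have hm1 : 0 < ∫ t, t ^ 2 ∂(P.map (w 0)) := by
    have := ScaleMixture.le_integral_pow_of_le_sq ha.le hsb hlow 1
    simp only [pow_one, mul_one] at this
    linarith
  have hM : 0 < ∫ t, t ^ 4 ∂(P.map (w 0)) :=
    lt_of_lt_of_le (by positivity) (ScaleMixture.le_integral_pow_of_le_sq ha.le hsb hlow 2)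
  have hmean : ∫ t, t ∂(P.map (z 0 0)) = 0 := by
    rw [integral_map (hz_meas 0 0).aemeasurable (by fun_prop)]
    exact hz_mean
  have hvar : ∫ t, t ^ 2 ∂(P.map (z 0 0)) = 1 := by
    rw [integral_map (hz_meas 0 0).aemeasurable (by fun_prop)]
    exact hz_var
  have hwP : ∫ ω, w 0 ω ^ 2 ∂P = ∫ t, t ^ 2 ∂(P.map (w 0)) := by
    rw [integral_map (hw_meas 0).aemeasurable (by fun_prop)]
  have hsym : ∀ n, (T n)ᵀ = T n := fun n => by
    have := (hT n).isHermitian.eq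
    rwa [conjTranspose_eq_transpose_of_trivial] at this
  -- The statistics are functions of this array alone, so all probabilities can be computed under
  -- the product law `hXlaw`.
  let X : (n : ℕ) → Ω → Fin n → ScaleMixture.Obs (p n) := fun n ω i =>
    (w i ω, (fun j : Fin (p n) => z i j ω), Q n i ω)
  have hXm : ∀ n, Measurable (X n) := fun n => measurable_pi_lambda _ fun i =>
    (hw_meas i).prodMk ((measurable_pi_lambda (fun ω (j : Fin (p n)) => z i j ω)
      fun j => hz_meas i j).prodMk (hQ_meas n i))
  have hXlaw : ∀ n, P.map (X n) = Measure.pi fun _ =>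
      ScaleMixture.obsLaw (P.map (w 0)) (P.map (z 0 0)) (p n) := fun n =>
    ScaleMixture.map_obs_eq_pi hz_meas hw_meas hz_indep hw_indep hz_ident hw_ident hzw_indep
      (hQ_meas n) (hQ_unif n) (hQ_indep n) (hQzw_indep n)
  have hxX : ∀ n ω, x n ω = fun i => ScaleMixture.obsVec (T n) (X n ω i) := hx
  have hstat : ∀ (n : ℕ) (ω : Ω), (n : ℝ) * stat n ω
      = ScaleMixture.pairSum (ScaleMixture.statKernel n (T n)) (X n ω) := fun n ω => by
    rw [h_stat, hxX]
    exact ScaleMixture.testStat_eq (T n) (X n ω)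
  have hgam : ∀ n ω, gam n ω = ScaleMixture.normStat (T n) (X n ω) := fun n ω => by
    rw [h_gam, hxX]
    exact ScaleMixture.gammaHat_eq (T n) (X n ω)
  have hps : ∀ n, Measurable (ScaleMixture.pairSum (ι := Fin n)
      (ScaleMixture.statKernel n (T n))) := fun n =>
    ScaleMixture.measurable_pairSum (ScaleMixture.measurable_statKernel (T n))
  have hns : ∀ n, Measurable fun y : Fin n → ScaleMixture.Obs (p n) =>
      ScaleMixture.normStat (T n) y := fun n => ScaleMixture.measurable_normStat (T n)
  simp_rw [hstat, hgam]
  constructor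
  · intro hnull h8
    have hev : ∀ᶠ n in atTop, T n = 1 := by
      filter_upwards [hnull, hp.eventually_gt_atTop 0] with n hn hn0
      rw [h_popCov, hwP] at hn
      exact ScaleMixture.eq_one_of_isSpherical (hT n) (hT_trace n) hn0 hm1 hn
    obtain ⟨κ, hκ⟩ := ScaleMixture.exists_momentBound (ρ := P.map (z 0 0)) (r := 4)
      ((integrable_map_measure (by fun_prop) (hz_meas 0 0).aemeasurable).2 h8) hmean
    refine ScaleMixture.tendstoInDistribution_studentized
      (M := ∫ t, t ^ 4 ∂(P.map (w 0))) (r := √8)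
      (fun n => (hps n).comp (hXm n)) (fun n => (hns n).comp (hXm n)) hM.ne' (by positivity)
      (fun t => ?_) fun ε hε => ?_
    · have h := ScaleMixture.tendsto_integral_cexp_statKernel hκ hvar hsb hp t
      -- The limiting standard deviation is `√8 E w⁴`, exactly the limit of the denominator, so the
      -- quotient is asymptotically standard.
      have e8 : 8 * (∫ t, t ^ 4 ∂(P.map (w 0))) ^ 2 = (√8 * ∫ t, t ^ 4 ∂(P.map (w 0))) ^ 2 := by
        rw [mul_pow, Real.sq_sqrt (by norm_num)]
      rw [e8] at h
      refine h.congr' ?_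
      filter_upwards [hev] with n hn
      rw [← hn, ← hXlaw n, integral_map (hXm n).aemeasurable]
      · rfl
      · have := hps n
        fun_prop
    · refine (ScaleMixture.tendsto_measure_normStat hκ hvar hsb hp hc hpn hε).congr' ?_
      filter_upwards [hev] with n hn
      rw [← hn, ← hXlaw n, Measure.map_apply (hXm n)
        (measurableSet_le measurable_const ((hns n).sub_const _).abs)]
      rfl
  · intro _ _ htr hdel α _ _ zα _
    obtain ⟨κ, hκ⟩ := ScaleMixture.exists_momentBound (ρ := P.map (z 0 0)) (r := 2)
      ((integrable_map_measure (by fun_prop) (hz_meas 0 0).aemeasurable).2 hz_four) hmean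
    -- A convergent sequence eventually lies below its limit plus one; this supplies the constant
    -- `C`.
    have hC : ∀ᶠ n in atTop, ScaleMixture.frobSq (T n * T n)
        ≤ ((∫ t, t ^ 2 ∂H) + 1) * (p n : ℝ) := by
      filter_upwards [htr.eventually_le_const (lt_add_one _), hp.eventually_gt_atTop 0]
        with n hn hn0
      have hn0' : (0 : ℝ) < p n := by exact_mod_cast hn0
      rw [ScaleMixture.frobSq_mul_self_eq_trace (hsym n)]
      rwa [div_le_iff₀ hn0'] at hn
    have hD : Tendsto (fun n : ℕ => ∫ y : Fin n → ScaleMixture.Obs (p n),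
        ScaleMixture.pairSum (ScaleMixture.statKernel n (T n)) y
          ∂(Measure.pi fun _ => ScaleMixture.obsLaw (P.map (w 0)) (P.map (z 0 0)) (p n)))
        atTop atTop := by
      -- The mean of the pair sum under the product law is `n δₙ`.
      refine hdel.congr fun n => ?_
      rw [h_del, ← integral_const_mul, ← hXlaw n, integral_map (hXm n).aemeasurable
        (hps n).aestronglyMeasurable]
      simp_rw [hstat]
    have h := ScaleMixture.tendsto_measure_test hκ hvar hsb hm1 hp hc hpn hsym
      (fun n => (ScaleMixture.frobSq_eq_trace_sq (hsym n)).trans (hT_trace n)) hC hD zα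
    have hset : ∀ n, MeasurableSet {y : Fin n → ScaleMixture.Obs (p n) |
        √8 * ScaleMixture.normStat (T n) y * zα
          < ScaleMixture.pairSum (ScaleMixture.statKernel n (T n)) y} := fun n =>
      measurableSet_lt (((hns n).const_mul _).mul_const _) (hps n)
    have h1 := ENNReal.Tendsto.sub (tendsto_const_nhds (x := (1 : ℝ≥0∞))) h
      (Or.inl ENNReal.one_ne_top)
    rw [tsub_zero] at h1
    refine h1.congr fun n => ?_
    have hpr : IsProbabilityMeasure (P.map (X n)) :=
      Measure.isProbabilityMeasure_map (hXm n).aemeasurable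
    rw [← hXlaw n, prob_compl_eq_one_sub (hset n), ENNReal.sub_sub_cancel ENNReal.one_ne_top
      prob_le_one, Measure.map_apply (hXm n) (hset n)]
    rfl
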